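/- Let $\mathbb{T}=\mathbb{R}/\mathbb{Z}$ and let $\varphi:\mathbb{R}\to\mathbb{R}$ be a $C^\infty$ function such that (i) $0\le\varphi\le 1$ and $|\varphi'|\le 4/3$; (ii) $\varphi(y)=0$ for $y\notin[1/10,1]$; (iii) $\varphi(1/2)=1/2$, $\varphi'(1/2)=1$, $\varphi''(1/2)<0$; (iv) $\varphi(y)<y$ for $y\in(0,1)\setminus\{1/2\}$. For $\varepsilon>0$ let $f_\varepsilon:\mathbb{T}\to\mathbb{T}$ be $f_\varepsilon(y)=2y-\varepsilon\varphi(\varepsilon^{-1}y)$ for $y\in[0,\varepsilon]$ and $f_\varepsilon(y)=2y$ otherwise, put $f_{\varepsilon,a}(y)=f_\varepsilon(y)+a\varepsilon$, and for $\delta>0$ and a positive integer $m$ let $$F_a(x,y)=F_{\varepsilon,a,\delta,m}(x,y)=\bigl(mx,\ f_{\varepsilon,a}(y)+\delta\varepsilon\cos 2\pi x\bigr)\quad\text{on }\mathbb{T}^2 .$$ An SRB measure of $F_a$ is an $F_a$-invariant Borel probability measure $\mu$ for which Lebesgue almost every point $p$ is generic, that is, $\frac1n\sum_{k<n}\psi(F_a^k(p))\to\int\psi\,d\mu$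 for every continuous $\psi$. The central Lyapunov exponent $\chi^c(\mu)$ is the smaller of two numbers $\chi^c(\mu)<\chi^u(\mu)$, $\chi^u(\mu)>0$, such that at $\mu$-almost every and at Lebesgue almost every point $p$ there is a line $E$ in the tangent plane with $\frac1n\log\|D_pF_a^n v\|\to\chi^c(\mu)$ for $0\ne v\in E$ and $\frac1n\log\|D_pF_a^n v\|\to\chi^u(\mu)$ for $v\notin E$. Theorem. If $\varepsilon>0$ and $\delta>0$ are sufficiently small (depending only on $\varphi$), and $m$ is sufficiently large depending on $\varphi,\varepsilon,\delta$, then the following holds for every $a\in[-2\delta,2]$. (a) If $a+\delta<0$, then the region $W=\mathbb{T}\times((\delta-a)\varepsilon,\varepsilon/2)$ satisfies $F_a(W)\subset W$, and any two points of $W$ on the same fiber $\{x\}\times\mathbb{T}$ have orbits whose distance tends to $0$. The map $F_a$ has a unique SRB measure $\mu_{F_a}$; it is ergodic, its support is contained in $W$, and its central Lyapunov exponent exists and is negative: $\chi^c(\mu_{F_a})<0$. (b) If $a\ge1$, then $(f_{\varepsilon,a}^2)'(y)\ge 4/3$ for every $y\in\mathbb{T}$. The map $F_a$ has a unique SRB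 measure $\mu_{F_a}$; it is ergodic, and its central Lyapunov exponent exists and is positive: $\chi^c(\mu_{F_a})>0$. -/

import Mathlib

open MeasureTheory Filter Topology Set
open scoped ContDiff

namespace PartHyp

/-- The circle `ℝ / ℤ`. Its `volume` is Lebesgue (Haar) measure of total mass one. -/
abbrev Circ : Type := AddCircle (1 : ℝ)

/-- The two-dimensional torus, with the product Lebesgue probability measure as `volume`. -/
abbrev Torus : Type := Circ × Circ

/-- The representative in `[0, 1)` of a point of the circle. -/
noncomputable def rep (y : Circ) : ℝ := (AddCircle.equivIco (1 : ℝ) 0 y : ℝ)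

/-- The representative in `[-1/2, 1/2)` of a point of the circle; near `0` this is the local
inverse of the projection `ℝ → ℝ / ℤ`. -/
noncomputable def rep₀ (y : Circ) : ℝ := (AddCircle.equivIco (1 : ℝ) (-1 / 2) y : ℝ)

/-- Derivative of a circle map at `y`, computed in the flat charts centred at `y` and `f y`. -/
noncomputable def circDeriv (f : Circ → Circ) (y : Circ) : ℝ :=
  deriv (fun t : ℝ => rep₀ (f (y + (t : Circ)) - f y)) 0

/-- Derivative of a torus map at `p`, as a linear map of the tangent plane `ℝ × ℝ`, computed in the
flat charts centred at `p` and `F p`. -/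
noncomputable def torusDeriv (F : Torus → Torus) (p : Torus) : ℝ × ℝ →L[ℝ] ℝ × ℝ :=
  fderiv ℝ (fun v : ℝ × ℝ =>
    (rep₀ (F (p + ((v.1 : Circ), (v.2 : Circ))) - F p).1,
      rep₀ (F (p + ((v.1 : Circ), (v.2 : Circ))) - F p).2)) 0

/-- `p` is generic for `μ`: time averages of continuous functions along the orbit of `p` converge
to their `μ`-integrals. -/
def IsGeneric (F : Torus → Torus) (μ : Measure Torus) (p : Torus) : Prop :=
  ∀ ψ : C(Torus, ℝ),
    Tendsto (fun n : ℕ => birkhoffAverage ℝ F ψ n p) atTop (𝓝 (∫ q, ψ q ∂μ))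

/-- SRB measure: an invariant Borel probability measure for which Lebesgue almost every point of
the torus is generic. -/
structure IsSRB (F : Torus → Torus) (μ : Measure Torus) : Prop where
  isProbabilityMeasure : IsProbabilityMeasure μ
  invariant : MeasurePreserving F μ μ
  ae_generic : ∀ᵐ p ∂(volume : Measure Torus), IsGeneric F μ p

/-- The Lyapunov exponent of `F` at `p` in the direction `v` exists and equals `χ`. -/
def HasExponentAlong (F : Torus → Torus) (p : Torus) (v : ℝ × ℝ) (χ : ℝ) : Prop :=
  Tendsto (fun n : ℕ => (1 / (n : ℝ)) * Real.log ‖torusDeriv (F^[n]) p v‖) atTop (𝓝 χ)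

/-- The Lyapunov exponents of `F` at `p` are `χc` (along a line) and `χu` (off that line). -/
def HasExponentsAt (F : Torus → Torus) (p : Torus) (χc χu : ℝ) : Prop :=
  ∃ E : Submodule ℝ (ℝ × ℝ), Module.finrank ℝ E = 1 ∧
    (∀ v ∈ E, v ≠ 0 → HasExponentAlong F p v χc) ∧
    (∀ v, v ∉ E → HasExponentAlong F p v χu)

/-- `χc < χu`, with `χu > 0`, are the central and the unstable Lyapunov exponent of `(F, μ)`: they
are the exponents at `μ`-almost every point and also at Lebesgue almost every point. -/
structure HasLyapunovExponents (F : Torus → Torus) (μ : Measure Torus) (χc χu : ℝ) : Prop where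
  lt : χc < χu
  pos : 0 < χu
  ae_measure : ∀ᵐ p ∂μ, HasExponentsAt F p χc χu
  ae_volume : ∀ᵐ p ∂(volume : Measure Torus), HasExponentsAt F p χc χu

/-- `χ` is the central Lyapunov exponent of `(F, μ)`. -/
def IsCentralExponent (F : Torus → Torus) (μ : Measure Torus) (χ : ℝ) : Prop :=
  ∃ χu : ℝ, HasLyapunovExponents F μ χ χu

/-- The standing conditions on the profile `φ` of the deformation. -/
structure IsProfile (φ : ℝ → ℝ) : Prop where
  smooth : ContDiff ℝ ∞ φ
  range : ∀ y, 0 ≤ φ y ∧ φ y ≤ 1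
  deriv_le : ∀ y, |deriv φ y| ≤ 4 / 3
  eq_zero : ∀ y, y ∉ Icc (1 / 10 : ℝ) 1 → φ y = 0
  half : φ (1 / 2) = 1 / 2
  deriv_half : deriv φ (1 / 2) = 1
  deriv2_half : deriv (deriv φ) (1 / 2) < 0
  lt_self : ∀ y ∈ Ioo (0 : ℝ) 1 \ {1 / 2}, φ y < y

/-- The deformed doubling map `f_ε` of the circle. -/
noncomputable def fEps (φ : ℝ → ℝ) (ε : ℝ) (y : Circ) : Circ :=
  if rep y ∈ Icc 0 ε then (2 : ℕ) • y - ((ε * φ (ε⁻¹ * rep y) : ℝ) : Circ) else (2 : ℕ) • y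

/-- The map `f_{ε,a} = f_ε + a ε` of the circle. -/
noncomputable def fEpsA (φ : ℝ → ℝ) (ε a : ℝ) (y : Circ) : Circ :=
  fEps φ ε y + ((a * ε : ℝ) : Circ)

/-- The skew product `(x, y) ↦ (m x, f_{ε,a}(y) + δ ε cos 2πx)`. -/
noncomputable def skew (φ : ℝ → ℝ) (ε δ : ℝ) (m : ℕ) (a : ℝ) (p : Torus) : Torus :=
  (m • p.1, fEpsA φ ε a p.2 + ((δ * ε * Real.cos (2 * Real.pi * rep p.1) : ℝ) : Circ))

/-- The region `W = 𝕋 × ((δ - a) ε, ε / 2)`. -/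
def trapRegion (ε δ a : ℝ) : Set Torus :=
  {p | rep p.2 ∈ Ioo ((δ - a) * ε) (ε / 2)}

end PartHyp

/-!
The two regimes are treated by different mechanisms; in both, everything about the measure follows
once one knows a probability measure `μ` for which Lebesgue almost every point *and* `μ`-almost
every point is generic. Such a `μ` is invariant (`measurePreserving_of_generic`), ergodic
(`ergodic_of_ae_generic`) and the only SRB measure (`IsSRB.unique`). Moreover the derivative of
`F_a ^ n` is lower triangular with diagonal entries `m ^ n` and a product of fiber slopes, and all
slopes are at most `10 / 3 < m`. So at a generic point the vertical direction has the exponent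
`∫ log f'_{ε,a} dμ` and all other directions have the exponent `log m`
(`hasExponentsAt_of_isGeneric`).

*Expanding regime* (`expanding_regime`). If `a ≥ 1`, then a point where the slope is less than `2`
is mapped outside the deformed interval, so two consecutive slopes multiply to at least `4 / 3`. In
the metric `|Φ y - Φ y'|` with `Φ y = y + 9 / 10 * f y` the fiber maps therefore expand already in
one step, by `11 / 10`. For large `m` the transfer operator maps the cone of densities with
log-Lipschitz constant `R` to the cone with constant `21 / 22 * R`
(`ExpandingFibers.logLip_transfer`), which allows to split off a fixed proportion of Lebesgue
measure at each step. This gives exponential loss of memory (`ExpandingFibers.exists_decay`), hence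
decay of correlations, hence almost everywhere convergence of time averages by a strong law of large
numbers (`ae_tendsto_average_of_correlation`). The limit measure is absolutely continuous. Its
central exponent is positive because of the bound `4 / 3` for two consecutive slopes. Projecting to
the base also shows that almost every point of the circle is equidistributed under multiplication
by `m` (`ae_equidistributed`), which is needed in the other regime.

*Contracting regime*. If `a + δ < 0`, all orbits in the trapping region `W` reach a closed strip,
the core, in which the fibers contract uniformly. Consequently the orbit of a point of `W` is, up to
a small error, a continuous function of its base point in the recent past, and time averages
converge to a common limit over equidistributed base points
(`TrapParams.exists_tendsto_birkhoffAverage`). This produces `μ`, carried by the core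
(`TrapParams.exists_isSRB`), with negative exponent.

It remains to see that almost every orbit enters `W`
(`EntranceParams.ae_exists_iterate_mem_trapRegion`). Consider the images of a nearly horizontal
curve. After rescaling, each of the `m ^ n` pieces of the `n`-th image is again nearly horizontal. If
within a bounded time `N` some piece lies in `W`, then the set of points of the curve that miss
`W` loses a fixed proportion of its measure, for every curve, so it is null. Such a piece exists
because the heights of the images form intervals which must meet a slightly smaller region: off
that region the fiber map does not contract for a suitable weight `ρ`
(`EntranceParams.weight_le`), up to a factor that is as close to one as one likes, while the noise
`δ ε cos` lengthens the interval by a definite amount at each step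
(`EntranceParams.weightedLength_ge`). The weight grows along the passage from `1 / 2` to `1`, the
only place where the slope may be small, and the growth is paid back during the long time in which
`y` doubles from `ε` to `1`; this is where small `ε` is needed.
-/


namespace PartHyp

/-! ### Time averages and generic points -/

section Averages

variable {X : Type*}

lemma birkhoffAverage_eq_sum (F : X → X) (ψ : X → ℝ) (n : ℕ) (p : X) :
    birkhoffAverage ℝ F ψ n p = (n : ℝ)⁻¹ * ∑ k ∈ Finset.range n, ψ (F^[k] p) := by
  simp [birkhoffAverage, birkhoffSum]

lemma abs_birkhoffAverage_sub_le_of_orbits {Y : Type*} {F : X → X} {G : Y → Y} {ψ : X → ℝ}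
    {ϕ : Y → ℝ} {p : X} {q : Y} {e : ℝ} (he : 0 ≤ e)
    (h : ∀ k, |ψ (F^[k] p) - ϕ (G^[k] q)| ≤ e) (n : ℕ) :
    |birkhoffAverage ℝ F ψ n p - birkhoffAverage ℝ G ϕ n q| ≤ e := by
  rcases Nat.eq_zero_or_pos n with rfl | hn
  · simpa using he
  rw [birkhoffAverage_eq_sum, birkhoffAverage_eq_sum, ← mul_sub, ← Finset.sum_sub_distrib, abs_mul,
    abs_of_nonneg (by positivity)]
  calc (n : ℝ)⁻¹ * |∑ k ∈ Finset.range n, (ψ (F^[k] p) - ϕ (G^[k] q))|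
      ≤ (n : ℝ)⁻¹ * ∑ k ∈ Finset.range n, e := by
        gcongr
        exact (Finset.abs_sum_le_sum_abs _ _).trans (Finset.sum_le_sum fun k _ => h _)
    _ = e := by simp; field_simp

lemma abs_birkhoffAverage_sub_le (F : X → X) (ψ₁ ψ₂ : X → ℝ) (p : X) {e : ℝ} (he : 0 ≤ e)
    (h : ∀ x, |ψ₁ x - ψ₂ x| ≤ e) (n : ℕ) :
    |birkhoffAverage ℝ F ψ₁ n p - birkhoffAverage ℝ F ψ₂ n p| ≤ e :=
  abs_birkhoffAverage_sub_le_of_orbits he (fun _ => h _) n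

lemma abs_birkhoffAverage_le (F : X → X) (ψ : X → ℝ) {M : ℝ} (hM : 0 ≤ M) (h : ∀ x, |ψ x| ≤ M)
    (n : ℕ) (p : X) : |birkhoffAverage ℝ F ψ n p| ≤ M := by
  have := abs_birkhoffAverage_sub_le F ψ (fun _ => 0) p hM (by simpa using h) n
  simpa [birkhoffAverage_eq_sum F (fun _ => (0 : ℝ))] using this

lemma birkhoffAverage_const_fun (F : X → X) {n : ℕ} (hn : n ≠ 0) (p : X) (c : ℝ) :
    birkhoffAverage ℝ F (fun _ => c) n p = c := by
  have : (n : ℝ) ≠ 0 := by exact_mod_cast hn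
  rw [birkhoffAverage_eq_sum]; simp; field_simp

/-- If the observables along two orbits approach each other, so do their time averages. -/
lemma tendsto_birkhoffAverage_of_tendsto_sub {Y : Type*} {F : X → X} {G : Y → Y} {ψ : X → ℝ}
    {ϕ : Y → ℝ} {p : X} {q : Y} {c : ℝ}
    (h : Tendsto (fun k => ψ (F^[k] p) - ϕ (G^[k] q)) atTop (𝓝 0))
    (hq : Tendsto (fun n => birkhoffAverage ℝ G ϕ n q) atTop (𝓝 c)) :
    Tendsto (fun n => birkhoffAverage ℝ F ψ n p) atTop (𝓝 c) := by
  have h1 := h.cesaro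
  have h2 := h1.add hq
  rw [zero_add] at h2
  refine h2.congr fun n => ?_
  rw [birkhoffAverage_eq_sum, birkhoffAverage_eq_sum, Finset.sum_sub_distrib]
  ring

lemma tendsto_birkhoffAverage_sub_iterate {F : X → X} {ψ : X → ℝ} {M : ℝ}
    (hM : ∀ x, |ψ x| ≤ M) (p : X) (j : ℕ) :
    Tendsto (fun n => birkhoffAverage ℝ F ψ n p - birkhoffAverage ℝ F ψ n (F^[j] p))
      atTop (𝓝 0) := by
  have key : Tendsto (fun n : ℕ => (n : ℝ)⁻¹ * (2 * j * M)) atTop (𝓝 0) := by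
    simpa using tendsto_inv_atTop_nhds_zero_nat.mul_const (2 * j * M : ℝ)
  refine squeeze_zero_norm (fun n => ?_) key
  have e1 : ∑ k ∈ Finset.range n, ψ (F^[k] p) + ∑ k ∈ Finset.range j, ψ (F^[n + k] p)
      = ∑ k ∈ Finset.range j, ψ (F^[k] p) + ∑ k ∈ Finset.range n, ψ (F^[k] (F^[j] p)) := by
    rw [← Finset.sum_range_add (fun k => ψ (F^[k] p)), add_comm n j, Finset.sum_range_add]
    congr 1
    refine Finset.sum_congr rfl fun k _ => ?_
    rw [← Function.iterate_add_apply, add_comm]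
  have b : ∀ g : ℕ → X, |∑ k ∈ Finset.range j, ψ (g k)| ≤ j * M := fun g => by
    refine (Finset.abs_sum_le_sum_abs _ _).trans ((Finset.sum_le_sum fun k _ => hM _).trans ?_)
    simp
  rw [birkhoffAverage_eq_sum, birkhoffAverage_eq_sum, ← mul_sub, Real.norm_eq_abs, abs_mul,
    abs_of_nonneg (by positivity)]
  gcongr
  have b1 := b (fun k => F^[k] p)
  have b2 := b (fun k => F^[n + k] p)
  rw [abs_le] at *
  constructor <;> linarith [b1.1, b1.2, b2.1, b2.2]

lemma tendsto_birkhoffAverage_iterate {F : X → X} {ψ : X → ℝ} {M : ℝ}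
    (hM : ∀ x, |ψ x| ≤ M) {p : X} {c : ℝ} (j : ℕ) :
    Tendsto (fun n => birkhoffAverage ℝ F ψ n (F^[j] p)) atTop (𝓝 c) ↔
      Tendsto (fun n => birkhoffAverage ℝ F ψ n p) atTop (𝓝 c) := by
  have h0 := tendsto_birkhoffAverage_sub_iterate (F := F) hM p j
  refine ⟨fun h => by simpa using h0.add h, fun h => by simpa using h.sub h0⟩

end Averages

section Compact

set_option linter.unusedSectionVars false

variable {X : Type*} [MetricSpace X] [CompactSpace X] [MeasurableSpace X] [BorelSpace X]

lemma integrable_continuousMap (μ : Measure X) [IsFiniteMeasure μ] (ψ : C(X, ℝ)) :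
    Integrable ψ μ := ψ.continuous.integrable_of_hasCompactSupport (HasCompactSupport.of_compactSpace _)

lemma ext_of_integral_continuousMap {μ ν : Measure X} [IsFiniteMeasure μ] [IsFiniteMeasure ν]
    (h : ∀ ψ : C(X, ℝ), ∫ x, ψ x ∂μ = ∫ x, ψ x ∂ν) : μ = ν :=
  ext_of_forall_integral_eq_of_IsFiniteMeasure fun f => h f.toContinuousMap

/-- If the time averages of every continuous function converge at a point, the limits are the
integrals against a probability measure (Riesz–Markov–Kakutani). -/
lemma exists_measure_of_tendsto_birkhoffAverage {F : X → X} {p : X}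
    (h : ∀ ψ : C(X, ℝ), ∃ c, Tendsto (fun n => birkhoffAverage ℝ F ψ n p) atTop (𝓝 c)) :
    ∃ μ : Measure X, IsProbabilityMeasure μ ∧
      ∀ ψ : C(X, ℝ), Tendsto (fun n => birkhoffAverage ℝ F ψ n p) atTop (𝓝 (∫ q, ψ q ∂μ)) := by
  choose c hc using h
  have hadd : ∀ ψ₁ ψ₂, c (ψ₁ + ψ₂) = c ψ₁ + c ψ₂ := fun ψ₁ ψ₂ =>
    tendsto_nhds_unique (hc _) (((hc ψ₁).add (hc ψ₂)).congr fun n => by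
      simp only [birkhoffAverage_eq_sum, ← mul_add, ← Finset.sum_add_distrib]; rfl)
  have hsmul : ∀ (r : ℝ) ψ, c (r • ψ) = r * c ψ := fun r ψ =>
    tendsto_nhds_unique (hc _) (((hc ψ).const_mul r).congr fun n => by
      simp only [birkhoffAverage_eq_sum]
      rw [mul_left_comm, Finset.mul_sum]; rfl)
  have hmono : ∀ ψ₁ ψ₂ : C(X, ℝ), (∀ x, ψ₁ x ≤ ψ₂ x) → c ψ₁ ≤ c ψ₂ := fun ψ₁ ψ₂ hle => by
    refine le_of_tendsto_of_tendsto' (hc _) (hc _) fun n => ?_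
    simp only [birkhoffAverage_eq_sum]
    gcongr
    exact hle _
  let Λ : CompactlySupportedContinuousMap X ℝ →ₚ[ℝ] ℝ :=
    { toFun := fun f => c f.toContinuousMap
      map_add' := fun f g => hadd _ _
      map_smul' := fun r f => hsmul _ _
      monotone' := fun f g hfg => hmono _ _ fun x => hfg x }
  have hint : ∀ ψ : C(X, ℝ), ∫ q, ψ q ∂(RealRMK.rieszMeasure Λ) = c ψ := fun ψ =>
    RealRMK.integral_rieszMeasure Λ (CompactlySupportedContinuousMap.continuousMapEquiv ψ)
  refine ⟨RealRMK.rieszMeasure Λ, ⟨?_⟩, fun ψ => by rw [hint]; exact hc ψ⟩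
  have h1 : c 1 = 1 := by
    refine tendsto_nhds_unique (hc 1) (tendsto_const_nhds.congr' ?_)
    filter_upwards [eventually_ne_atTop 0] with n hn
    exact (birkhoffAverage_const_fun F hn p 1).symm
  have h2 := hint 1
  rw [h1] at h2
  simp only [ContinuousMap.one_apply, integral_const, smul_eq_mul, mul_one, Measure.real] at h2
  rwa [ENNReal.toReal_eq_one_iff] at h2

/-- A measure with a generic point is invariant. -/
lemma measurePreserving_of_generic {F : X → X} (hF : Continuous F) {μ : Measure X}
    [IsProbabilityMeasure μ] {p : X}
    (hp : ∀ ψ : C(X, ℝ), Tendsto (fun n => birkhoffAverage ℝ F ψ n p) atTop (𝓝 (∫ q, ψ q ∂μ))) :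
    MeasurePreserving F μ μ := by
  refine ⟨hF.measurable, ?_⟩
  have : IsProbabilityMeasure (μ.map F) := Measure.isProbabilityMeasure_map hF.aemeasurable
  refine ext_of_integral_continuousMap fun ψ => ?_
  rw [integral_map hF.aemeasurable ψ.continuous.aestronglyMeasurable]
  have h1 := hp (ψ.comp ⟨F, hF⟩)
  have h2 := (tendsto_birkhoffAverage_iterate (ψ.norm_coe_le_norm) 1).mpr (hp ψ)
  refine tendsto_nhds_unique (h1.congr fun n => ?_) h2
  simp only [birkhoffAverage_eq_sum]
  congr 1
  refine Finset.sum_congr rfl fun k _ => ?_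
  exact congrArg ψ ((Function.iterate_succ_apply' F k p).symm.trans (Function.iterate_succ_apply F k p))

/-- If for a dense set of observables the time averages converge almost everywhere to a constant,
then almost every point is generic for one and the same probability measure. -/
lemma exists_measure_ae_generic {F : X → X} {ν : Measure X} [NeZero ν] {S : Set C(X, ℝ)}
    (hS : Dense S)
    (h : ∀ ψ ∈ S, ∃ c, ∀ᵐ p ∂ν, Tendsto (fun n => birkhoffAverage ℝ F ψ n p) atTop (𝓝 c)) :
    ∃ μ : Measure X, IsProbabilityMeasure μ ∧ ∀ᵐ p ∂ν, ∀ ψ : C(X, ℝ),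
      Tendsto (fun n => birkhoffAverage ℝ F ψ n p) atTop (𝓝 (∫ q, ψ q ∂μ)) := by
  obtain ⟨D, hDS, hDc, hDd⟩ := (TopologicalSpace.IsSeparable.of_separableSpace S).exists_countable_dense_subset
  have hD : Dense D := fun x => closure_minimal hDd isClosed_closure (hS x)
  choose! c hc using h
  have hae : ∀ᵐ p ∂ν, ∀ ψ ∈ D, Tendsto (fun n => birkhoffAverage ℝ F ψ n p) atTop (𝓝 (c ψ)) :=
    (ae_ball_iff hDc).2 fun ψ hψ => hc ψ (hDS hψ)
  obtain ⟨p₀, hp₀⟩ := hae.exists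
  have happrox : ∀ ψ : C(X, ℝ), ∀ e > 0, ∃ ϕ ∈ D, ∀ x, |ψ x - ϕ x| ≤ e := fun ψ e he => by
    obtain ⟨ϕ, hϕ, hd⟩ := hD.exists_dist_lt ψ he
    refine ⟨ϕ, hϕ, fun x => ?_⟩
    rw [← Real.dist_eq]
    exact (ContinuousMap.dist_apply_le_dist x).trans hd.le
  have hconv : ∀ ψ : C(X, ℝ), ∃ c, Tendsto (fun n => birkhoffAverage ℝ F ψ n p₀) atTop (𝓝 c) := by
    intro ψ
    refine cauchySeq_tendsto_of_complete (Metric.cauchySeq_iff'.2 fun e he => ?_)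
    obtain ⟨ϕ, hϕ, hϕe⟩ := happrox ψ (e / 4) (by positivity)
    obtain ⟨N, hN⟩ := Metric.cauchySeq_iff'.1 (hp₀ ϕ hϕ).cauchySeq (e / 4) (by positivity)
    refine ⟨N, fun n hn => ?_⟩
    have h1 := hN n hn
    have h2 := abs_birkhoffAverage_sub_le F ψ ϕ p₀ (by positivity) hϕe n
    have h3 := abs_birkhoffAverage_sub_le F ψ ϕ p₀ (by positivity) hϕe N
    rw [Real.dist_eq] at *
    rw [abs_lt] at *
    rw [abs_le] at *
    constructor <;> linarith [h1.1, h1.2, h2.1, h2.2, h3.1, h3.2]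
  obtain ⟨μ, hμ, hgen⟩ := exists_measure_of_tendsto_birkhoffAverage hconv
  refine ⟨μ, hμ, hae.mono fun p hp ψ => ?_⟩
  have hz : Tendsto (fun n => birkhoffAverage ℝ F ψ n p - birkhoffAverage ℝ F ψ n p₀) atTop
      (𝓝 0) := by
    rw [Metric.tendsto_atTop]
    intro e he
    obtain ⟨ϕ, hϕ, hϕe⟩ := happrox ψ (e / 4) (by positivity)
    have h4 := (hp ϕ hϕ).sub (hp₀ ϕ hϕ)
    rw [sub_self, Metric.tendsto_atTop] at h4
    obtain ⟨N, hN⟩ := h4 (e / 4) (by positivity)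
    refine ⟨N, fun n hn => ?_⟩
    have h1 := hN n hn
    have h2 := abs_birkhoffAverage_sub_le F ψ ϕ p (by positivity) hϕe n
    have h3 := abs_birkhoffAverage_sub_le F ψ ϕ p₀ (by positivity) hϕe n
    rw [Real.dist_eq] at *
    rw [abs_lt] at *
    rw [abs_le] at *
    constructor <;> linarith [h1.1, h1.2, h2.1, h2.2, h3.1, h3.2]
  simpa using hz.add (hgen ψ)

/-- An invariant measure for which almost every point is generic is ergodic. -/
lemma ergodic_of_ae_generic {F : X → X} {μ : Measure X} [IsProbabilityMeasure μ]
    (hF : MeasurePreserving F μ μ)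
    (hgen : ∀ᵐ p ∂μ, ∀ ψ : C(X, ℝ),
      Tendsto (fun n => birkhoffAverage ℝ F ψ n p) atTop (𝓝 (∫ q, ψ q ∂μ))) :
    Ergodic F μ := by
  refine ⟨hF, ⟨fun s hs hinv => ?_⟩⟩
  set f : X → ℝ := s.indicator 1 with hf
  have hfi : Integrable f μ := (integrable_const (1 : ℝ)).indicator hs
  have hfF : ∀ k x, f (F^[k] x) = f x := by
    intro k
    induction k with
    | zero => intro x; rfl
    | succ k ih =>
      intro x
      rw [Function.iterate_succ_apply, ih, hf]
      have : F x ∈ s ↔ x ∈ s := by rw [← mem_preimage, hinv]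
      by_cases hx : x ∈ s
      · rw [indicator_of_mem hx, indicator_of_mem (this.2 hx)]; rfl
      · rw [indicator_of_notMem hx, indicator_of_notMem (fun h => hx (this.1 h))]
  have hfc : ∀ c : ℝ, Integrable (fun x => |f x - c|) μ := fun c =>
    (hfi.sub (integrable_const c)).abs
  -- the indicator is within `2 e` in `L¹` of a constant, for every `e > 0`,
  -- because the time averages of a continuous `L¹`-approximation converge to a constant
  have hclose : ∀ e > 0, ∫ x, |f x - ∫ y, f y ∂μ| ∂μ ≤ 2 * e := by
    intro e he
    obtain ⟨g, hgc, hge, hgcont, hgi⟩ := hfi.exists_hasCompactSupport_integral_sub_le he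
    let ψ : C(X, ℝ) := ⟨g, hgcont⟩
    have hψi : Integrable ψ μ := integrable_continuousMap μ ψ
    have hk : ∀ k, ∫ x, |f x - ψ (F^[k] x)| ∂μ ≤ e := by
      intro k
      have hp := hF.iterate k
      have : ∫ x, |f x - ψ (F^[k] x)| ∂μ = ∫ x, |f x - ψ x| ∂μ := by
        calc ∫ x, |f x - ψ (F^[k] x)| ∂μ = ∫ x, |f (F^[k] x) - ψ (F^[k] x)| ∂μ := by
              simp only [hfF]
          _ = ∫ x, |f x - ψ x| ∂(μ.map F^[k]) :=
              (integral_map (f := fun x => |f x - ψ x|) hp.measurable.aemeasurable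
                (by rw [hp.map_eq]; exact (hfi.sub hψi).abs.aestronglyMeasurable)).symm
          _ = _ := by rw [hp.map_eq]
      rw [this]; exact hge
    have hAi : ∀ n, Integrable (fun x => birkhoffAverage ℝ F ψ n x) μ := fun n => by
      simp only [birkhoffAverage_eq_sum]
      exact (integrable_finsetSum _ fun k _ => ((hF.iterate k).integrable_comp_of_integrable hψi)).const_mul _
    have hn : ∀ n ≥ 1, ∫ x, |f x - birkhoffAverage ℝ F ψ n x| ∂μ ≤ e := by
      intro n hn
      have hn0 : (0 : ℝ) < n := by exact_mod_cast hn
      calc ∫ x, |f x - birkhoffAverage ℝ F ψ n x| ∂μ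
          ≤ ∫ x, (n : ℝ)⁻¹ * ∑ k ∈ Finset.range n, |f x - ψ (F^[k] x)| ∂μ := by
            refine integral_mono (hfi.sub (hAi n)).abs ?_ fun x => ?_
            · exact (integrable_finsetSum _ fun k _ =>
                (hfi.sub ((hF.iterate k).integrable_comp_of_integrable hψi)).abs).const_mul _
            · have : f x - birkhoffAverage ℝ F ψ n x
                  = (n : ℝ)⁻¹ * ∑ k ∈ Finset.range n, (f x - ψ (F^[k] x)) := by
                rw [birkhoffAverage_eq_sum, Finset.sum_sub_distrib]; simp; field_simp
              change |f x - birkhoffAverage ℝ F ψ n x| ≤ _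
              rw [this, abs_mul, abs_of_nonneg (by positivity)]
              gcongr
              exact Finset.abs_sum_le_sum_abs _ _
        _ = (n : ℝ)⁻¹ * ∑ k ∈ Finset.range n, ∫ x, |f x - ψ (F^[k] x)| ∂μ := by
            rw [integral_const_mul, integral_finsetSum]
            exact fun k _ => (hfi.sub ((hF.iterate k).integrable_comp_of_integrable hψi)).abs
        _ ≤ (n : ℝ)⁻¹ * ∑ k ∈ Finset.range n, e := by
            gcongr; exact hk _
        _ = e := by simp; field_simp
    have hlim : Tendsto (fun n => ∫ x, |f x - birkhoffAverage ℝ F ψ n x| ∂μ) atTop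
        (𝓝 (∫ x, |f x - ∫ q, ψ q ∂μ| ∂μ)) := by
      refine tendsto_integral_of_dominated_convergence (fun x => 1 + ‖ψ‖)
        (fun n => (hfi.sub (hAi n)).abs.aestronglyMeasurable) (integrable_const _)
        (fun n => Eventually.of_forall fun x => ?_) (hgen.mono fun x hx => ?_)
      · have h1 : |f x| ≤ 1 := by
          by_cases hx : x ∈ s <;> simp [hf, hx]
        have h2 := abs_birkhoffAverage_le F ψ (norm_nonneg _) (ψ.norm_coe_le_norm) n x
        rw [Real.norm_eq_abs, abs_abs]
        exact (abs_sub _ _).trans (add_le_add h1 h2)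
      · exact ((hx ψ).const_sub _).abs
    have hle : ∫ x, |f x - ∫ q, ψ q ∂μ| ∂μ ≤ e :=
      le_of_tendsto hlim (by filter_upwards [eventually_ge_atTop 1] with n h using hn n h)
    have hdiff : |(∫ q, ψ q ∂μ) - ∫ y, f y ∂μ| ≤ e := by
      rw [abs_sub_comm, ← integral_sub hfi hψi]
      exact (abs_integral_le_integral_abs).trans hge
    calc ∫ x, |f x - ∫ y, f y ∂μ| ∂μ
        ≤ ∫ x, (|f x - ∫ q, ψ q ∂μ| + |(∫ q, ψ q ∂μ) - ∫ y, f y ∂μ|) ∂μ :=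
          integral_mono (hfc _) ((hfc _).add (integrable_const _))
            fun x => abs_sub_le _ _ _
      _ ≤ 2 * e := by
          rw [integral_add (hfc _) (integrable_const _)]
          simp
          linarith
  have hzero : ∫ x, |f x - ∫ y, f y ∂μ| ∂μ = 0 := by
    refine le_antisymm (le_of_forall_pos_le_add fun e he => ?_)
      (integral_nonneg fun x => abs_nonneg _)
    have := hclose (e / 2) (by positivity)
    linarith
  rw [integral_eq_zero_iff_of_nonneg (fun x => abs_nonneg _) (hfc _)] at hzero
  have hcst : ∀ᵐ x ∂μ, f x = ∫ y, f y ∂μ := hzero.mono fun x hx => by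
    simpa [sub_eq_zero] using hx
  rw [eventuallyConst_set]
  by_cases h1 : (∫ y, f y ∂μ) = 1
  · left
    filter_upwards [hcst] with x hx
    by_contra hxs
    rw [h1, hf, indicator_of_notMem hxs] at hx
    exact zero_ne_one hx
  · right
    filter_upwards [hcst] with x hx hxs
    rw [hf, indicator_of_mem hxs] at hx
    exact h1 (hx.symm.trans rfl)

/-- A measure whose integrals of nonnegative continuous functions are at most a fixed multiple of
those of `ν` is absolutely continuous with respect to `ν`. -/
lemma absolutelyContinuous_of_integral_le {μ ν : Measure X} [IsFiniteMeasure μ] [IsFiniteMeasure ν]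
    {C : ℝ}
    (h : ∀ ψ : C(X, ℝ), (∀ x, 0 ≤ ψ x) → ∫ x, ψ x ∂μ ≤ C * ∫ x, ψ x ∂ν) : μ ≪ ν := by
  have hclosed : ∀ s : Set X, IsClosed s → ν s = 0 → μ s = 0 := by
    intro s hs hν
    have hpos : ∀ n : ℕ, (0 : ℝ) < 1 / ((n : ℝ) + 1) := fun n => by positivity
    have hlim := tendsto_one_div_add_atTop_nhds_zero_nat (𝕜 := ℝ)
    have t1 := tendsto_integral_thickenedIndicator_of_isClosed μ hs hpos hlim
    have t2 := tendsto_integral_thickenedIndicator_of_isClosed ν hs hpos hlim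
    have hle : μ.real s ≤ C * ν.real s := by
      refine le_of_tendsto_of_tendsto' t1 (t2.const_mul C) fun n => ?_
      exact h ⟨fun x => (thickenedIndicator (hpos n) s x : ℝ), by fun_prop⟩ fun x => NNReal.coe_nonneg _
    have hν' : ν.real s = 0 := by simp [Measure.real, hν]
    rw [hν', mul_zero] at hle
    have := le_antisymm hle measureReal_nonneg
    simpa [Measure.real, ENNReal.toReal_eq_zero_iff] using this
  refine Measure.AbsolutelyContinuous.mk fun s hs hν => ?_
  rw [hs.measure_eq_iSup_isClosed_of_ne_top (measure_ne_top μ s)]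
  simp only [ENNReal.iSup_eq_zero]
  exact fun K hK hKc => hclosed K hKc (measure_mono_null hK hν)

end Compact

/-! ### Averages of weakly correlated variables -/

/-- A strong law of large numbers: bounded variables with exponentially decaying correlations have
averages tending to zero almost surely. The averages over the first `N ^ 2` variables converge by
summability of their second moments, and boundedness controls the gaps between squares. -/
lemma ae_tendsto_average_of_correlation {Ω : Type*} [MeasurableSpace Ω] {ν : Measure Ω}
    [IsProbabilityMeasure ν] {u : ℕ → Ω → ℝ} {M C θ : ℝ} (hm : ∀ k, Measurable (u k))
    (hM : ∀ k x, |u k x| ≤ M) (hC : 0 ≤ C)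
    (hθ₀ : 0 ≤ θ) (hθ₁ : θ < 1)
    (hcorr : ∀ j n, |∫ x, u j x * u (j + n) x ∂ν| ≤ C * θ ^ n) :
    ∀ᵐ x ∂ν, Tendsto (fun n : ℕ => (n : ℝ)⁻¹ * ∑ k ∈ Finset.range n, u k x) atTop (𝓝 0) := by
  set S : ℕ → Ω → ℝ := fun n x => ∑ k ∈ Finset.range n, u k x with hS
  have hSm : ∀ n, Measurable (S n) := fun n => Finset.measurable_fun_sum _ fun k _ => hm k
  have hSb : ∀ n x, |S n x| ≤ n * M := fun n x => by
    refine (Finset.abs_sum_le_sum_abs _ _).trans ((Finset.sum_le_sum fun k _ => hM k x).trans ?_)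
    simp
  have hint : ∀ (f : Ω → ℝ) (B : ℝ), Measurable f → (∀ x, |f x| ≤ B) → Integrable f ν :=
    fun f B hf hB => .of_bound hf.aestronglyMeasurable B (ae_of_all _ hB)
  have huu : ∀ j k, Integrable (fun x => u j x * u k x) ν := fun j k =>
    hint _ (M * M) ((hm j).mul (hm k)) fun x => by
      rw [abs_mul]; exact mul_le_mul (hM j x) (hM k x) (abs_nonneg _) ((abs_nonneg _).trans (hM j x))
  have hSS : ∀ n, Integrable (fun x => S n x ^ 2) ν := fun n =>
    hint _ ((n * M) ^ 2) ((hSm n).pow_const 2) fun x => by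
      rw [abs_pow]; exact pow_le_pow_left₀ (abs_nonneg _) (hSb n x) 2
  have hSu : ∀ n, Integrable (fun x => S n x * u n x) ν := fun n =>
    hint _ (n * M * M) ((hSm n).mul (hm n)) fun x => by
      rw [abs_mul]
      exact mul_le_mul (hSb n x) (hM n x) (abs_nonneg _) ((abs_nonneg _).trans (hSb n x))
  have hD : 0 < 1 - θ := by linarith
  set D := C / (1 - θ) with hDdef
  have hCD : C ≤ D := by rw [hDdef, le_div_iff₀ hD]; nlinarith
  have hcross : ∀ n, ∫ x, S n x * u n x ∂ν ≤ D := by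
    intro n
    have e1 : ∫ x, S n x * u n x ∂ν = ∑ j ∈ Finset.range n, ∫ x, u j x * u n x ∂ν := by
      rw [← integral_finsetSum _ fun j _ => huu j n]
      simp only [hS, Finset.sum_mul]
    rw [e1]
    calc ∑ j ∈ Finset.range n, ∫ x, u j x * u n x ∂ν
        ≤ ∑ j ∈ Finset.range n, C * θ ^ (n - j) := by
          refine Finset.sum_le_sum fun j hj => ?_
          have hj' : j + (n - j) = n := by have := Finset.mem_range.1 hj; omega
          have := hcorr j (n - j)
          rw [hj'] at this
          exact (le_abs_self _).trans this
      _ ≤ ∑ j ∈ Finset.range (n + 1), C * θ ^ (n - j) :=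
          Finset.sum_le_sum_of_subset_of_nonneg (Finset.range_mono (by omega))
            fun j _ _ => by positivity
      _ = C * ∑ j ∈ Finset.range (n + 1), θ ^ j := by
          rw [Finset.mul_sum, ← Finset.sum_range_reflect]
          refine Finset.sum_congr rfl fun j hj => ?_
          congr 2
          have := Finset.mem_range.1 hj
          omega
      _ ≤ C * (1 - θ)⁻¹ := by
          gcongr
          exact (summable_geometric_of_lt_one hθ₀ hθ₁).sum_le_tsum _ (fun i _ => by positivity)
            |>.trans_eq (tsum_geometric_of_lt_one hθ₀ hθ₁)
      _ = D := by rw [hDdef, div_eq_mul_inv]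
  have hvar : ∀ n : ℕ, ∫ x, S n x ^ 2 ∂ν ≤ n * (3 * D) := by
    intro n
    induction n with
    | zero => simp [hS]
    | succ n ih =>
      have e : ∀ x, S (n + 1) x ^ 2 = S n x ^ 2 + 2 * (S n x * u n x) + u n x * u n x := fun x => by
        simp only [hS, Finset.sum_range_succ]; ring
      simp only [e]
      have h1 : Integrable (fun x => S n x ^ 2 + 2 * (S n x * u n x)) ν :=
        (hSS n).add ((hSu n).const_mul 2)
      rw [integral_add h1 (huu n n), integral_add (hSS n) ((hSu n).const_mul 2), integral_const_mul]
      have h0 := (le_abs_self _).trans (hcorr n 0)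
      simp only [add_zero, pow_zero, mul_one] at h0
      have := hcross n
      push_cast
      linarith
  have hM0 : 0 ≤ M := by
    obtain ⟨x⟩ : Nonempty Ω := ν.nonempty_of_neZero
    exact (abs_nonneg _).trans (hM 0 x)
  -- the second moments of the averages over `(N + 1) ^ 2` variables are summable
  have hsq : ∀ᵐ x ∂ν, Tendsto (fun N : ℕ => (((N : ℝ) + 1) ^ 2)⁻¹ * S ((N + 1) ^ 2) x) atTop
      (𝓝 0) := by
    set g : ℕ → Ω → ℝ := fun N x => ((((N : ℝ) + 1) ^ 2)⁻¹ * S ((N + 1) ^ 2) x) ^ 2 with hg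
    have hgm : ∀ N, Measurable (g N) := fun N => ((hSm _).const_mul _).pow_const 2
    have hgi : ∀ N, ∫⁻ x, ENNReal.ofReal (g N x) ∂ν
        ≤ ENNReal.ofReal (3 * D * (1 / ((N : ℝ) + 1) ^ 2)) := by
      intro N
      have hN : (0 : ℝ) < (N : ℝ) + 1 := by positivity
      have e : ∀ x, g N x = ((((N : ℝ) + 1) ^ 2)⁻¹) ^ 2 * S ((N + 1) ^ 2) x ^ 2 := fun x => by
        simp only [hg]; ring
      rw [← ofReal_integral_eq_lintegral_ofReal]
      · apply ENNReal.ofReal_le_ofReal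
        simp only [e]
        rw [integral_const_mul]
        have := hvar ((N + 1) ^ 2)
        push_cast at this
        calc _ ≤ ((((N : ℝ) + 1) ^ 2)⁻¹) ^ 2 * (((N : ℝ) + 1) ^ 2 * (3 * D)) := by gcongr
          _ = _ := by field_simp
      · exact ((hSS _).const_mul _).congr (ae_of_all _ fun x => (e x).symm)
      · exact ae_of_all _ fun x => by simp only [hg]; positivity
    have hsum : ∑' N, ∫⁻ x, ENNReal.ofReal (g N x) ∂ν ≠ ⊤ := by
      refine ne_top_of_le_ne_top ?_ (ENNReal.tsum_le_tsum hgi)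
      have hs : Summable fun N : ℕ => 3 * D * (1 / ((N : ℝ) + 1) ^ 2) := by
        refine Summable.mul_left _ ?_
        have := (summable_nat_add_iff 1).2 (Real.summable_one_div_nat_pow.2 one_lt_two)
        simpa using this
      exact hs.tsum_ofReal_ne_top
    rw [← lintegral_tsum fun N => (hgm N).ennreal_ofReal.aemeasurable] at hsum
    have hfin := ae_lt_top' (AEMeasurable.tsum fun N => (hgm N).ennreal_ofReal.aemeasurable)
      hsum
    filter_upwards [hfin] with x hx
    have h1 := ENNReal.tendsto_atTop_zero_of_tsum_ne_top hx.ne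
    have h2 : Tendsto (fun N => g N x) atTop (𝓝 0) := by
      have := (ENNReal.tendsto_toReal ENNReal.zero_ne_top).comp h1
      refine this.congr fun N => ?_
      simp only [Function.comp]
      exact ENNReal.toReal_ofReal (by simp only [hg]; positivity)
    have h3 := h2.sqrt
    rw [Real.sqrt_zero] at h3
    rw [tendsto_zero_iff_abs_tendsto_zero]
    exact h3.congr fun N => Real.sqrt_sq_eq_abs _
  filter_upwards [hsq] with x hx
  set b : ℕ → ℝ := fun N => |(((N : ℝ) + 1) ^ 2)⁻¹ * S ((N + 1) ^ 2) x| with hb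
  -- compare the average at `n` with that at the largest square below `n`, which is `(r + 1) ^ 2`
  -- with `r = Nat.sqrt n - 1`
  have hroot : Tendsto (fun n : ℕ => Nat.sqrt n - 1) atTop atTop := by
    refine (tendsto_sub_atTop_nat 1).comp (tendsto_atTop.2 fun k => ?_)
    filter_upwards [eventually_ge_atTop (k * k)] with n hn using Nat.le_sqrt.2 hn
  have hb0 : Tendsto (fun n : ℕ => b (Nat.sqrt n - 1) + 2 * M * (1 / (((Nat.sqrt n - 1 : ℕ) : ℝ) + 1)))
      atTop (𝓝 0) := by
    have h1 := hx.abs.comp hroot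
    have h2 := (tendsto_one_div_add_atTop_nhds_zero_nat (𝕜 := ℝ)).comp hroot
    have h3 := h1.add (h2.const_mul (2 * M))
    rw [abs_zero, mul_zero, add_zero] at h3
    exact h3
  refine squeeze_zero_norm' ?_ hb0
  filter_upwards [eventually_ge_atTop 1] with n hn
  have hr1 : 1 ≤ Nat.sqrt n := Nat.le_sqrt.2 (by simpa using hn)
  obtain ⟨r, hr⟩ : ∃ r, Nat.sqrt n = r + 1 := ⟨Nat.sqrt n - 1, by omega⟩
  have hlo : (r + 1) ^ 2 ≤ n := by rw [← hr]; exact Nat.sqrt_le' n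
  have hhi : n ≤ (r + 1) ^ 2 + 2 * (r + 1) := by
    have := Nat.sqrt_le_add n
    rw [hr] at this; nlinarith
  obtain ⟨d, hd⟩ := Nat.exists_eq_add_of_le hlo
  have hdr : (d : ℝ) ≤ 2 * ((r : ℝ) + 1) := by
    have : d ≤ 2 * (r + 1) := by omega
    exact_mod_cast this
  have hsplit : |S n x| ≤ |S ((r + 1) ^ 2) x| + d * M := by
    have : S n x = S ((r + 1) ^ 2) x + ∑ k ∈ Finset.range d, u ((r + 1) ^ 2 + k) x := by
      simp only [hS]; rw [hd, Finset.sum_range_add]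
    rw [this]
    refine (abs_add_le _ _).trans (add_le_add le_rfl ?_)
    refine (Finset.abs_sum_le_sum_abs _ _).trans ((Finset.sum_le_sum fun k _ => hM _ x).trans ?_)
    simp
  have hrpos : (0 : ℝ) < (r : ℝ) + 1 := by positivity
  have hnr : ((r : ℝ) + 1) ^ 2 ≤ n := by exact_mod_cast hlo
  rw [hr, Nat.add_sub_cancel, Real.norm_eq_abs, abs_mul, abs_of_nonneg (by positivity)]
  calc (n : ℝ)⁻¹ * |S n x| ≤ (((r : ℝ) + 1) ^ 2)⁻¹ * (|S ((r + 1) ^ 2) x| + d * M) := by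
        gcongr
    _ ≤ (((r : ℝ) + 1) ^ 2)⁻¹ * (|S ((r + 1) ^ 2) x| + 2 * ((r : ℝ) + 1) * M) := by
        gcongr
    _ = b r + 2 * M * (1 / ((r : ℝ) + 1)) := by
        simp only [hb]
        rw [abs_mul, abs_of_nonneg (by positivity : (0 : ℝ) ≤ (((r : ℝ) + 1) ^ 2)⁻¹)]
        field_simp

end PartHyp

namespace PartHyp

/-! ### Lifts to the universal cover -/

/-- The covering map of the torus by the plane. -/
def proj (p : ℝ × ℝ) : Torus := ((p.1 : Circ), (p.2 : Circ))

lemma isOpenQuotientMap_proj : IsOpenQuotientMap proj :=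
  IsOpenQuotientMap.prodMap (f := fun x : ℝ => (x : Circ)) (g := fun x : ℝ => (x : Circ))
    QuotientAddGroup.isOpenQuotientMap_mk QuotientAddGroup.isOpenQuotientMap_mk

lemma exists_proj_eq (p : Torus) : ∃ v, proj v = p := isOpenQuotientMap_proj.surjective p

lemma proj_add (p v : ℝ × ℝ) : proj (p + v) = proj p + ((v.1 : Circ), (v.2 : Circ)) := rfl

lemma proj_sub (p v : ℝ × ℝ) : proj (p - v) = proj p - proj v := rfl

lemma proj_add_natCast (x y : ℝ) (j : ℕ) : proj (x + j, y) = proj (x, y) := by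
  have : ((j : ℝ) : Circ) = 0 := by
    rw [← nsmul_one, AddCircle.coe_nsmul, AddCircle.coe_period, nsmul_zero]
  simp [proj, this]

lemma proj_sub_intCast (x y : ℝ) (k : ℤ) : proj (x, y - k) = proj (x, y) := by
  have : ((k : ℝ) : Circ) = 0 := by
    rw [← zsmul_one, AddCircle.coe_zsmul, AddCircle.coe_period, zsmul_zero]
  simp [proj, this]

lemma coe_rep (y : Circ) : ((rep y : ℝ) : Circ) = y := AddCircle.coe_equivIco

lemma rep_coe (y : ℝ) : rep (y : Circ) = Int.fract y := by
  have := AddCircle.coe_equivIco_mk_apply (p := (1 : ℝ)) y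
  rw [div_one, mul_one] at this
  exact this

lemma rep₀_coe {t : ℝ} (ht : t ∈ Ico (-1 / 2 : ℝ) (1 / 2)) : rep₀ (t : Circ) = t := by
  unfold rep₀
  exact AddCircle.equivIco_coe_of_mem (by rw [show (-1 / 2 : ℝ) + 1 = 1 / 2 by norm_num]; exact ht)

lemma eventually_rep₀ {X : Type*} [TopologicalSpace X] {H : X → ℝ} {p : X} (hH : ContinuousAt H p) :
    ∀ᶠ v in 𝓝 p, rep₀ ((H v - H p : ℝ) : Circ) = H v - H p := by
  have h0 : Tendsto (fun v => H v - H p) (𝓝 p) (𝓝 0) := by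
    simpa using hH.tendsto.sub_const (H p)
  have := h0.eventually (Ico_mem_nhds (show (-1 / 2 : ℝ) < 0 by norm_num) (by norm_num : (0 : ℝ) < 1 / 2))
  exact this.mono fun v hv => rep₀_coe hv

lemma torusDeriv_eq {F : Torus → Torus} {H : ℝ × ℝ → ℝ × ℝ} (hFH : ∀ p, F (proj p) = proj (H p))
    {p : ℝ × ℝ} {L : ℝ × ℝ →L[ℝ] ℝ × ℝ} (hL : HasFDerivAt H L p) :
    torusDeriv F (proj p) = L := by
  refine HasFDerivAt.fderiv ?_
  have hc := hL.continuousAt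
  have e1 := eventually_rep₀ (H := fun v => (H v).1) (p := p) (continuous_fst.continuousAt.comp hc)
  have e2 := eventually_rep₀ (H := fun v => (H v).2) (p := p) (continuous_snd.continuousAt.comp hc)
  have hshift : Tendsto (fun v : ℝ × ℝ => p + v) (𝓝 0) (𝓝 p) := by
    have : Continuous fun v : ℝ × ℝ => p + v := by fun_prop
    simpa using this.tendsto 0
  have h1 : HasFDerivAt (fun v : ℝ × ℝ => H (p + v) - H p) L 0 := by
    have hL' : HasFDerivAt H L (p + 0) := by simpa using hL
    have := hL'.comp (0 : ℝ × ℝ) ((hasFDerivAt_id (0 : ℝ × ℝ)).const_add p)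
    simpa using this.sub_const (H p)
  refine h1.congr_of_eventuallyEq ?_
  filter_upwards [hshift.eventually e1, hshift.eventually e2] with v h1 h2
  rw [← proj_add, hFH, hFH, ← proj_sub]
  exact Prod.ext h1 h2

lemma circDeriv_eq {f : Circ → Circ} {g : ℝ → ℝ} (hfg : ∀ y : ℝ, f y = g y) {y d : ℝ}
    (hd : HasDerivAt g d y) : circDeriv f (y : Circ) = d := by
  refine HasDerivAt.deriv ?_
  have e1 := eventually_rep₀ hd.continuousAt
  have hshift : Tendsto (fun t : ℝ => y + t) (𝓝 0) (𝓝 y) := by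
    have : Continuous fun t : ℝ => y + t := by fun_prop
    simpa using this.tendsto 0
  have h1 : HasDerivAt (fun t : ℝ => g (y + t) - g y) d 0 := by
    have h2 : HasDerivAt g d (y + 0) := by simpa using hd
    have := HasDerivAt.comp (0 : ℝ) h2 ((hasDerivAt_id (0 : ℝ)).const_add y)
    simpa using this.sub_const (g y)
  refine h1.congr_of_eventuallyEq ?_
  filter_upwards [hshift.eventually e1] with t ht
  rw [← AddCircle.coe_add, hfg, hfg, ← AddCircle.coe_sub]
  exact ht

/-- A differentiable profile supported in `[1/10, 1]`, rescaled to `[0, ε]` and continued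
periodically, is differentiable. -/
lemma hasDerivAt_periodize {g : ℝ → ℝ} (hg : Differentiable ℝ g)
    (h0 : ∀ u, u ∉ Icc (1 / 10 : ℝ) 1 → g u = 0) {ε : ℝ} (hε : 0 < ε) (hε1 : ε < 1) (y : ℝ) :
    HasDerivAt (fun t => g (ε⁻¹ * Int.fract t)) (ε⁻¹ * deriv g (ε⁻¹ * Int.fract y)) y := by
  by_cases hy : Int.fract y = 0
  · have hz : ∀ᶠ t in 𝓝 y, g (ε⁻¹ * Int.fract t) = 0 := by
      have hyi : (⌊y⌋ : ℝ) = y := by have := Int.self_sub_floor y; linarith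
      have hm : Ioo (y - (1 - ε)) (y + ε / 10) ∈ 𝓝 y := Ioo_mem_nhds (by linarith) (by linarith)
      filter_upwards [hm] with t ht
      apply h0
      rintro ⟨h1, h2⟩
      rw [inv_mul_eq_div, le_div_iff₀ hε] at h1
      rw [inv_mul_eq_div, div_le_iff₀ hε] at h2
      rcases lt_or_ge t y with hty | hty
      · have : ⌊t⌋ = ⌊y⌋ - 1 := Int.floor_eq_iff.2 ⟨by push_cast; linarith [ht.1], by push_cast; linarith⟩
        have hf := Int.self_sub_floor t
        rw [this] at hf; push_cast at hf
        linarith [ht.1]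
      · have : ⌊t⌋ = ⌊y⌋ := Int.floor_eq_iff.2 ⟨by linarith, by linarith [ht.2]⟩
        have hf := Int.self_sub_floor t
        rw [this] at hf
        linarith [ht.2]
    have hd : deriv g (ε⁻¹ * Int.fract y) = 0 := by
      rw [hy, mul_zero]
      have : g =ᶠ[𝓝 0] fun _ => 0 := by
        filter_upwards [Iio_mem_nhds (show (0 : ℝ) < 1 / 10 by norm_num)] with u hu
        exact h0 u fun h => not_le.2 hu h.1
      rw [this.deriv_eq, deriv_const]
    rw [hd, mul_zero]
    exact (hasDerivAt_const y (0 : ℝ)).congr_of_eventuallyEq hz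
  · have hpos : 0 < Int.fract y := lt_of_le_of_ne (Int.fract_nonneg y) (Ne.symm hy)
    have hm : Ioo (⌊y⌋ : ℝ) (⌊y⌋ + 1) ∈ 𝓝 y :=
      Ioo_mem_nhds (by have := Int.self_sub_floor y; linarith) (Int.lt_floor_add_one y)
    have heq : (fun t => g (ε⁻¹ * Int.fract t)) =ᶠ[𝓝 y] fun t => g (ε⁻¹ * (t - ⌊y⌋)) := by
      filter_upwards [hm] with t ht
      have : ⌊t⌋ = ⌊y⌋ := Int.floor_eq_iff.2 ⟨ht.1.le, ht.2⟩
      rw [← Int.self_sub_floor, this]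
    refine HasDerivAt.congr_of_eventuallyEq ?_ heq
    have h1 : HasDerivAt (fun t : ℝ => ε⁻¹ * (t - ⌊y⌋)) ε⁻¹ y := by
      simpa using ((hasDerivAt_id y).sub_const (⌊y⌋ : ℝ)).const_mul ε⁻¹
    have h2 := (hg (ε⁻¹ * Int.fract y)).hasDerivAt
    rw [← Int.self_sub_floor y] at h2 ⊢
    rw [mul_comm]
    exact HasDerivAt.comp y h2 h1

/-- The lift to the line of the deformed doubling map. -/
noncomputable def fLift (φ : ℝ → ℝ) (ε y : ℝ) : ℝ := 2 * y - ε * φ (ε⁻¹ * Int.fract y)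

/-- The derivative of the lift of the deformed doubling map. -/
noncomputable def fSlope (φ : ℝ → ℝ) (ε y : ℝ) : ℝ := 2 - deriv φ (ε⁻¹ * Int.fract y)

/-- The lift to the plane of the skew product. -/
noncomputable def skewLift (φ : ℝ → ℝ) (ε δ : ℝ) (m : ℕ) (a : ℝ) (p : ℝ × ℝ) : ℝ × ℝ :=
  (m * p.1, fLift φ ε p.2 + a * ε + δ * ε * Real.cos (2 * Real.pi * p.1))

variable {φ : ℝ → ℝ} {ε : ℝ}

lemma IsProfile.differentiable (hφ : IsProfile φ) : Differentiable ℝ φ :=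
  hφ.smooth.differentiable (by simp)

lemma IsProfile.contDiff_deriv (hφ : IsProfile φ) : ContDiff ℝ ∞ (deriv φ) :=
  (contDiff_infty_iff_deriv.1 hφ.smooth).2

lemma IsProfile.differentiable_deriv (hφ : IsProfile φ) : Differentiable ℝ (deriv φ) :=
  hφ.contDiff_deriv.differentiable (by simp)

lemma IsProfile.deriv_eq_zero (hφ : IsProfile φ) {u : ℝ} (hu : u ∉ Icc (1 / 10 : ℝ) 1) :
    deriv φ u = 0 := by
  have : φ =ᶠ[𝓝 u] fun _ => 0 := by
    filter_upwards [isClosed_Icc.isOpen_compl.mem_nhds hu] with v hv using hφ.eq_zero v hv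
  rw [this.deriv_eq, deriv_const]

lemma hasDerivAt_fLift (hφ : IsProfile φ) (hε : 0 < ε) (hε1 : ε < 1) (y : ℝ) :
    HasDerivAt (fLift φ ε) (fSlope φ ε y) y := by
  have h1 := (hasDerivAt_periodize hφ.differentiable hφ.eq_zero hε hε1 y).const_mul ε
  rw [mul_inv_cancel_left₀ hε.ne'] at h1
  have h2 : HasDerivAt (fun t : ℝ => 2 * t) 2 y := by simpa using (hasDerivAt_id y).const_mul (2 : ℝ)
  exact h2.sub h1

lemma hasDerivAt_fSlope (hφ : IsProfile φ) (hε : 0 < ε) (hε1 : ε < 1) (y : ℝ) :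
    HasDerivAt (fSlope φ ε) (-(ε⁻¹ * deriv (deriv φ) (ε⁻¹ * Int.fract y))) y :=
  (hasDerivAt_periodize hφ.differentiable_deriv (fun _ => hφ.deriv_eq_zero) hε hε1 y).const_sub 2

lemma continuous_fSlope (hφ : IsProfile φ) (hε : 0 < ε) (hε1 : ε < 1) :
    Continuous (fSlope φ ε) :=
  continuous_iff_continuousAt.2 fun y => (hasDerivAt_fSlope hφ hε hε1 y).continuousAt

lemma continuous_fLift (hφ : IsProfile φ) (hε : 0 < ε) (hε1 : ε < 1) :
    Continuous (fLift φ ε) :=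
  continuous_iff_continuousAt.2 fun y => (hasDerivAt_fLift hφ hε hε1 y).continuousAt

lemma fSlope_ge (hφ : IsProfile φ) (y : ℝ) : 2 / 3 ≤ fSlope φ ε y := by
  have := (abs_le.1 (hφ.deriv_le (ε⁻¹ * Int.fract y))).2
  unfold fSlope; linarith

lemma fSlope_le (hφ : IsProfile φ) (y : ℝ) : fSlope φ ε y ≤ 10 / 3 := by
  have := (abs_le.1 (hφ.deriv_le (ε⁻¹ * Int.fract y))).1
  unfold fSlope; linarith

lemma fSlope_pos (hφ : IsProfile φ) (y : ℝ) : 0 < fSlope φ ε y :=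
  lt_of_lt_of_le (by norm_num) (fSlope_ge hφ y)

lemma fLift_add_int (y : ℝ) (k : ℤ) : fLift φ ε (y + k) = fLift φ ε y + 2 * k := by
  simp [fLift]; ring

lemma fLift_add_one (y : ℝ) : fLift φ ε (y + 1) = fLift φ ε y + 2 := by
  simpa using fLift_add_int (φ := φ) (ε := ε) y 1

lemma fSlope_add_int (y : ℝ) (k : ℤ) : fSlope φ ε (y + k) = fSlope φ ε y := by
  simp [fSlope]

lemma fSlope_fract (y : ℝ) : fSlope φ ε (Int.fract y) = fSlope φ ε y := by
  simp [fSlope]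

lemma fLift_sub_ge (hφ : IsProfile φ) (hε : 0 < ε) (hε1 : ε < 1) {y z : ℝ} (h : y ≤ z) :
    2 / 3 * (z - y) ≤ fLift φ ε z - fLift φ ε y :=
  mul_sub_le_image_sub_of_le_deriv (fun y => (hasDerivAt_fLift hφ hε hε1 y).differentiableAt)
    (fun y => by rw [(hasDerivAt_fLift hφ hε hε1 y).deriv]; exact fSlope_ge hφ y) h

lemma fLift_sub_le (hφ : IsProfile φ) (hε : 0 < ε) (hε1 : ε < 1) {y z : ℝ} (h : y ≤ z) :
    fLift φ ε z - fLift φ ε y ≤ 10 / 3 * (z - y) :=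
  image_sub_le_mul_sub_of_deriv_le (fun y => (hasDerivAt_fLift hφ hε hε1 y).differentiableAt)
    (fun y => by rw [(hasDerivAt_fLift hφ hε hε1 y).deriv]; exact fSlope_le hφ y) h

lemma abs_fLift_sub_le (hφ : IsProfile φ) (hε : 0 < ε) (hε1 : ε < 1) (y z : ℝ) :
    |fLift φ ε z - fLift φ ε y| ≤ 10 / 3 * |z - y| := by
  rcases le_total y z with h | h
  · have h1 := fLift_sub_ge hφ hε hε1 h
    have h2 := fLift_sub_le hφ hε hε1 h
    rw [abs_of_nonneg (by linarith : 0 ≤ z - y), abs_of_nonneg (by linarith)]; exact h2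
  · have h1 := fLift_sub_ge hφ hε hε1 h
    have h2 := fLift_sub_le hφ hε hε1 h
    rw [abs_of_nonpos (by linarith : z - y ≤ 0), abs_of_nonpos (by linarith)]; linarith

lemma fLift_strictMono (hφ : IsProfile φ) (hε : 0 < ε) (hε1 : ε < 1) : StrictMono (fLift φ ε) :=
  fun y z h => by have := fLift_sub_ge hφ hε hε1 h.le; linarith

lemma fEps_coe (hφ : IsProfile φ) (hε : 0 < ε) (y : ℝ) :
    fEps φ ε (y : Circ) = (fLift φ ε y : Circ) := by
  unfold fEps fLift
  rw [rep_coe]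
  split_ifs with h
  · rw [AddCircle.coe_sub, two_nsmul, two_mul, AddCircle.coe_add]
  · have : φ (ε⁻¹ * Int.fract y) = 0 := by
      apply hφ.eq_zero
      rintro ⟨-, h2⟩
      rw [inv_mul_eq_div, div_le_iff₀ hε, one_mul] at h2
      exact h ⟨Int.fract_nonneg y, h2⟩
    rw [this, mul_zero, sub_zero, two_nsmul, two_mul, AddCircle.coe_add]

lemma fEpsA_coe (hφ : IsProfile φ) (hε : 0 < ε) (a y : ℝ) :
    fEpsA φ ε a (y : Circ) = ((fLift φ ε y + a * ε : ℝ) : Circ) := by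
  rw [fEpsA, fEps_coe hφ hε, AddCircle.coe_add]

lemma cos_fract (x : ℝ) : Real.cos (2 * Real.pi * Int.fract x) = Real.cos (2 * Real.pi * x) := by
  rw [← Int.self_sub_floor, mul_sub, mul_comm (2 * Real.pi) (⌊x⌋ : ℝ),
    Real.cos_sub_int_mul_two_pi]

lemma skew_proj (hφ : IsProfile φ) (hε : 0 < ε) (δ : ℝ) (m : ℕ) (a : ℝ) (p : ℝ × ℝ) :
    skew φ ε δ m a (proj p) = proj (skewLift φ ε δ m a p) := by
  unfold skew proj skewLift
  simp only [rep_coe, cos_fract, fEpsA_coe hφ hε]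
  rw [← AddCircle.coe_add, ← AddCircle.coe_nsmul, nsmul_eq_mul]

lemma iterate_skew_proj (hφ : IsProfile φ) (hε : 0 < ε) (δ : ℝ) (m : ℕ) (a : ℝ) (n : ℕ)
    (p : ℝ × ℝ) : (skew φ ε δ m a)^[n] (proj p) = proj ((skewLift φ ε δ m a)^[n] p) := by
  induction n generalizing p with
  | zero => rfl
  | succ n ih => rw [Function.iterate_succ_apply, skew_proj hφ hε, ih, Function.iterate_succ_apply]

lemma continuous_skewLift (hφ : IsProfile φ) (hε : 0 < ε) (hε1 : ε < 1) (δ : ℝ) (m : ℕ) (a : ℝ) :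
    Continuous (skewLift φ ε δ m a) := by
  have := continuous_fLift hφ hε hε1
  unfold skewLift
  fun_prop

lemma continuous_proj : Continuous proj := isOpenQuotientMap_proj.continuous

lemma continuous_of_comp_proj {Z : Type*} [TopologicalSpace Z] {f : Torus → Z}
    (h : Continuous fun p => f (proj p)) : Continuous f :=
  (isOpenQuotientMap_proj.isQuotientMap.continuous_iff).2 h

lemma continuous_skew (hφ : IsProfile φ) (hε : 0 < ε) (hε1 : ε < 1) (δ : ℝ) (m : ℕ) (a : ℝ) :
    Continuous (skew φ ε δ m a) := by
  refine continuous_of_comp_proj ?_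
  simp only [skew_proj hφ hε]
  exact continuous_proj.comp (continuous_skewLift hφ hε hε1 δ m a)

lemma iterate_skewLift_fst (δ : ℝ) (m : ℕ) (a : ℝ) (n : ℕ) (p : ℝ × ℝ) :
    ((skewLift φ ε δ m a)^[n] p).1 = (m : ℝ) ^ n * p.1 := by
  induction n with
  | zero => simp
  | succ n ih => rw [Function.iterate_succ_apply', skewLift, ih, pow_succ]; ring

/-! ### Lyapunov exponents along generic orbits -/

/-- The logarithm of the vertical derivative, as a continuous function on the torus. -/
noncomputable def logSlope (hφ : IsProfile φ) (hε : 0 < ε) (hε1 : ε < 1) : C(Torus, ℝ) where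
  toFun p := Real.log (fSlope φ ε (rep p.2))
  continuous_toFun := by
    refine continuous_of_comp_proj ?_
    simp only [proj, rep_coe, fSlope_fract]
    exact ((continuous_fSlope hφ hε hε1).comp continuous_snd).log fun p => (fSlope_pos hφ _).ne'

lemma logSlope_proj (hφ : IsProfile φ) (hε : 0 < ε) (hε1 : ε < 1) (p : ℝ × ℝ) :
    logSlope hφ hε hε1 (proj p) = Real.log (fSlope φ ε p.2) := by
  change Real.log (fSlope φ ε (rep (p.2 : Circ))) = _
  rw [rep_coe, fSlope_fract]

/-- The lower triangular map `(v, w) ↦ (a v, b v + c w)` of the plane. -/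
noncomputable def lowerTri (a b c : ℝ) : ℝ × ℝ →L[ℝ] ℝ × ℝ :=
  (a • ContinuousLinearMap.fst ℝ ℝ ℝ).prod
    (b • ContinuousLinearMap.fst ℝ ℝ ℝ + c • ContinuousLinearMap.snd ℝ ℝ ℝ)

lemma lowerTri_apply (a b c : ℝ) (v : ℝ × ℝ) : lowerTri a b c v = (a * v.1, b * v.1 + c * v.2) :=
  rfl

lemma lowerTri_comp (a b c a' b' c' : ℝ) :
    (lowerTri a b c).comp (lowerTri a' b' c') = lowerTri (a * a') (b * a' + c * b') (c * c') := by
  refine ContinuousLinearMap.ext fun v => ?_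
  simp only [ContinuousLinearMap.comp_apply, lowerTri_apply]
  ext <;> simp <;> ring

lemma hasFDerivAt_skewLift (hφ : IsProfile φ) (hε : 0 < ε) (hε1 : ε < 1) (δ : ℝ) (m : ℕ) (a : ℝ)
    (p : ℝ × ℝ) :
    HasFDerivAt (skewLift φ ε δ m a)
      (lowerTri m (-(δ * ε * (2 * Real.pi) * Real.sin (2 * Real.pi * p.1))) (fSlope φ ε p.2)) p := by
  have h1 : HasFDerivAt (fun p : ℝ × ℝ => (m : ℝ) * p.1)
      ((m : ℝ) • ContinuousLinearMap.fst ℝ ℝ ℝ) p := hasFDerivAt_fst.const_mul _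
  have h2 : HasFDerivAt (fun p : ℝ × ℝ => fLift φ ε p.2)
      (fSlope φ ε p.2 • ContinuousLinearMap.snd ℝ ℝ ℝ) p :=
    (hasDerivAt_fLift hφ hε hε1 p.2).comp_hasFDerivAt p hasFDerivAt_snd
  have hc : HasDerivAt (fun x => δ * ε * Real.cos (2 * Real.pi * x))
      (-(δ * ε * (2 * Real.pi) * Real.sin (2 * Real.pi * p.1))) p.1 := by
    have h := ((Real.hasDerivAt_cos (2 * Real.pi * p.1)).comp p.1
      ((hasDerivAt_id p.1).const_mul (2 * Real.pi))).const_mul (δ * ε)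
    refine h.congr_deriv ?_
    ring
  have h3 : HasFDerivAt (fun p : ℝ × ℝ => δ * ε * Real.cos (2 * Real.pi * p.1))
      ((-(δ * ε * (2 * Real.pi) * Real.sin (2 * Real.pi * p.1))) • ContinuousLinearMap.fst ℝ ℝ ℝ) p :=
    hc.comp_hasFDerivAt p hasFDerivAt_fst
  refine (h1.prodMk ((h2.add_const (a * ε)).add h3)).congr_fderiv ?_
  rw [lowerTri, add_comm]

lemma exists_hasFDerivAt_iterate (hφ : IsProfile φ) (hε : 0 < ε) (hε1 : ε < 1) {δ : ℝ}
    {m : ℕ} (hm : 5 ≤ m) (a : ℝ) (p : ℝ × ℝ) (n : ℕ) :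
    ∃ b : ℝ, |b| ≤ |δ * ε * (2 * Real.pi)| * (m : ℝ) ^ n ∧
      HasFDerivAt (skewLift φ ε δ m a)^[n] (lowerTri ((m : ℝ) ^ n) b
        (∏ k ∈ Finset.range n, fSlope φ ε ((skewLift φ ε δ m a)^[k] p).2)) p := by
  have hm' : (5 : ℝ) ≤ m := by exact_mod_cast hm
  induction n with
  | zero =>
    refine ⟨0, by rw [abs_zero]; positivity, ?_⟩
    have : lowerTri ((m : ℝ) ^ 0) 0 (∏ k ∈ Finset.range 0,
        fSlope φ ε ((skewLift φ ε δ m a)^[k] p).2) = ContinuousLinearMap.id ℝ (ℝ × ℝ) := by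
      refine ContinuousLinearMap.ext fun v => ?_
      rw [lowerTri_apply]; simp
    rw [this, Function.iterate_zero]
    exact hasFDerivAt_id p
  | succ n ih =>
    obtain ⟨b, hb, hd⟩ := ih
    have h := (hasFDerivAt_skewLift hφ hε hε1 δ m a ((skewLift φ ε δ m a)^[n] p)).comp p hd
    rw [lowerTri_comp] at h
    rw [← Function.iterate_succ', ← pow_succ', mul_comm _ (∏ k ∈ _, _),
      ← Finset.prod_range_succ] at h
    refine ⟨_, ?_, h⟩
    · set K := |δ * ε * (2 * Real.pi)| with hK
      have hK0 : 0 ≤ K := abs_nonneg _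
      have hs := fSlope_le (ε := ε) hφ ((skewLift φ ε δ m a)^[n] p).2
      have hs0 := fSlope_pos (ε := ε) hφ ((skewLift φ ε δ m a)^[n] p).2
      have hP : (0 : ℝ) ≤ (m : ℝ) ^ n := by positivity
      refine (abs_add_le _ _).trans ?_
      rw [abs_mul, abs_mul, abs_neg, abs_mul, abs_of_nonneg hP, abs_of_pos hs0, ← hK]
      have h1 : K * |Real.sin (2 * Real.pi * ((skewLift φ ε δ m a)^[n] p).1)| * (m : ℝ) ^ n
          ≤ K * 1 * (m : ℝ) ^ n := by gcongr; exact Real.abs_sin_le_one _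
      have h2 : fSlope φ ε ((skewLift φ ε δ m a)^[n] p).2 * |b| ≤ 10 / 3 * (K * (m : ℝ) ^ n) := by
        gcongr
      have h3 : 0 ≤ K * (m : ℝ) ^ n := by positivity
      rw [pow_succ]
      nlinarith

lemma tendsto_log_const_div {c : ℝ} :
    Tendsto (fun n : ℕ => 1 / (n : ℝ) * c) atTop (𝓝 0) := by
  simpa using tendsto_inv_atTop_nhds_zero_nat.mul_const c

/-- At a generic point the vertical direction has the integral of `logSlope` as its exponent, and
all other directions have exponent `log m`. -/
lemma hasExponentsAt_of_isGeneric (hφ : IsProfile φ) (hε : 0 < ε) (hε1 : ε < 1) {δ : ℝ}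
    {m : ℕ} (hm : 5 ≤ m) {a : ℝ} {μ : Measure Torus} {p : Torus}
    (hp : IsGeneric (skew φ ε δ m a) μ p) :
    HasExponentsAt (skew φ ε δ m a) p (∫ q, logSlope hφ hε hε1 q ∂μ) (Real.log m) := by
  obtain ⟨v, rfl⟩ := exists_proj_eq p
  have hm' : (5 : ℝ) ≤ m := by exact_mod_cast hm
  have hm0 : (0 : ℝ) < m := by linarith
  set s : ℕ → ℝ := fun k => fSlope φ ε ((skewLift φ ε δ m a)^[k] v).2 with hs
  have hs0 : ∀ k, 0 < s k := fun k => fSlope_pos hφ _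
  have hs1 : ∀ k, s k ≤ m := fun k => (fSlope_le hφ _).trans (by linarith)
  choose b hb hd using exists_hasFDerivAt_iterate hφ hε hε1 (δ := δ) hm a v
  have hD : ∀ n, torusDeriv ((skew φ ε δ m a)^[n]) (proj v)
      = lowerTri ((m : ℝ) ^ n) (b n) (∏ k ∈ Finset.range n, s k) := fun n =>
    torusDeriv_eq (iterate_skew_proj hφ hε δ m a n) (hd n)
  refine ⟨Submodule.span ℝ {((0 : ℝ), (1 : ℝ))}, finrank_span_singleton (by simp), ?_, ?_⟩
  · intro w hw hw0
    obtain ⟨t, rfl⟩ := Submodule.mem_span_singleton.1 hw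
    have ht : t ≠ 0 := by rintro rfl; simp at hw0
    have h1 := hp (logSlope hφ hε hε1)
    have h2 := h1.add (tendsto_log_const_div (c := Real.log |t|))
    rw [add_zero] at h2
    refine h2.congr' ?_
    filter_upwards [eventually_ge_atTop 1] with n hn
    rw [hD, lowerTri_apply]
    have hprod : 0 < ∏ k ∈ Finset.range n, s k := Finset.prod_pos fun k _ => hs0 k
    have e : ‖((m : ℝ) ^ n * (t • ((0 : ℝ), (1 : ℝ))).1,
        b n * (t • ((0 : ℝ), (1 : ℝ))).1 + (∏ k ∈ Finset.range n, s k) * (t • ((0 : ℝ), (1 : ℝ))).2)‖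
        = (∏ k ∈ Finset.range n, s k) * |t| := by
      rw [Prod.norm_def]
      simp only [Prod.smul_mk, mul_zero, norm_zero, smul_eq_mul, mul_one, zero_add]
      rw [max_eq_right (norm_nonneg _), Real.norm_eq_abs, abs_mul, abs_of_pos hprod]
    rw [e, Real.log_mul hprod.ne' (abs_ne_zero.2 ht), Real.log_prod fun k _ => (hs0 k).ne',
      birkhoffAverage_eq_sum, mul_add, one_div]
    congr 2
    refine Finset.sum_congr rfl fun k _ => ?_
    rw [iterate_skew_proj hφ hε, logSlope_proj]
  · intro w hw
    have hw1 : w.1 ≠ 0 := by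
      intro h
      refine hw (Submodule.mem_span_singleton.2 ⟨w.2, ?_⟩)
      ext <;> simp [h]
    set K := |δ * ε * (2 * Real.pi)| with hK
    set C := (1 + K) * |w.1| + |w.2| with hC
    have hCpos : 0 < C := by positivity
    have hlo : ∀ n : ℕ, (m : ℝ) ^ n * |w.1| ≤ ‖torusDeriv ((skew φ ε δ m a)^[n]) (proj v) w‖ := by
      intro n
      rw [hD, lowerTri_apply]
      refine le_trans (le_of_eq ?_) (norm_fst_le _)
      rw [Real.norm_eq_abs, abs_mul, abs_of_pos (pow_pos hm0 n)]
    have hhi : ∀ n : ℕ, ‖torusDeriv ((skew φ ε δ m a)^[n]) (proj v) w‖ ≤ (m : ℝ) ^ n * C := by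
      intro n
      have hP : (0 : ℝ) < (m : ℝ) ^ n := by positivity
      have hprod : 0 < ∏ k ∈ Finset.range n, s k := Finset.prod_pos fun k _ => hs0 k
      have hprod1 : ∏ k ∈ Finset.range n, s k ≤ (m : ℝ) ^ n := by
        refine (Finset.prod_le_prod (fun k _ => (hs0 k).le) fun k _ => hs1 k).trans ?_
        simp
      rw [hD, lowerTri_apply]
      have hK0 : 0 ≤ K := abs_nonneg _
      refine max_le ?_ ?_
      · rw [Real.norm_eq_abs, abs_mul, abs_of_pos hP]
        gcongr
        rw [hC]
        nlinarith [abs_nonneg w.1, abs_nonneg w.2, mul_nonneg hK0 (abs_nonneg w.1)]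
      · rw [Real.norm_eq_abs]
        refine (abs_add_le _ _).trans ?_
        rw [abs_mul, abs_mul, abs_of_pos hprod]
        calc |b n| * |w.1| + (∏ k ∈ Finset.range n, s k) * |w.2|
            ≤ K * (m : ℝ) ^ n * |w.1| + (m : ℝ) ^ n * |w.2| := by
              gcongr; exact hb n
          _ ≤ (m : ℝ) ^ n * C := by
              rw [hC]; nlinarith [mul_nonneg hP.le (abs_nonneg w.1)]
    have hlog : ∀ (c : ℝ), 0 < c → ∀ n : ℕ, 1 ≤ n → 1 / (n : ℝ) * Real.log ((m : ℝ) ^ n * c)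
        = Real.log m + 1 / (n : ℝ) * Real.log c := by
      intro c hc n hn
      have : (n : ℝ) ≠ 0 := by positivity
      rw [Real.log_mul (by positivity) hc.ne', Real.log_pow]
      field_simp
    have lim : ∀ c : ℝ, Tendsto (fun n : ℕ => Real.log m + 1 / (n : ℝ) * c) atTop
        (𝓝 (Real.log m)) := fun c => by
      simpa using (tendsto_log_const_div (c := c)).const_add (Real.log m)
    refine tendsto_of_tendsto_of_tendsto_of_le_of_le' (lim (Real.log |w.1|)) (lim (Real.log C)) ?_ ?_
    · filter_upwards [eventually_ge_atTop 1] with n hn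
      rw [← hlog _ (abs_pos.2 hw1) n hn]
      gcongr
      exact hlo n
    · filter_upwards [eventually_ge_atTop 1] with n hn
      rw [← hlog _ hCpos n hn]
      have : 0 < ‖torusDeriv ((skew φ ε δ m a)^[n]) (proj v) w‖ :=
        lt_of_lt_of_le (by positivity) (hlo n)
      gcongr
      exact hhi n

end PartHyp

namespace PartHyp

/-! ### Density of Lipschitz functions -/

/-- Lipschitz functions are dense among the continuous functions on a compact metric space. -/
lemma dense_lipschitz (X : Type*) [MetricSpace X] [CompactSpace X] :
    Dense {ψ : C(X, ℝ) | ∃ K : ℝ, ∀ x y, |ψ x - ψ y| ≤ K * dist x y} := by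
  let A : Subalgebra ℝ C(X, ℝ) :=
    { carrier := {ψ | ∃ K : ℝ, ∀ x y, |ψ x - ψ y| ≤ K * dist x y}
      mul_mem' := by
        rintro f g ⟨K, hK⟩ ⟨L, hL⟩
        refine ⟨‖f‖ * L + K * ‖g‖, fun x y => ?_⟩
        have e : (f * g) x - (f * g) y = f x * (g x - g y) + (f x - f y) * g y := by
          simp only [ContinuousMap.mul_apply]; ring
        rw [e]
        refine (abs_add_le _ _).trans ?_
        rw [abs_mul, abs_mul]
        have h1 : |f x| * |g x - g y| ≤ ‖f‖ * (L * dist x y) :=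
          mul_le_mul (f.norm_coe_le_norm x) (hL x y) (abs_nonneg _) (norm_nonneg _)
        have h2 : |f x - f y| * |g y| ≤ (K * dist x y) * ‖g‖ :=
          mul_le_mul (hK x y) (g.norm_coe_le_norm y) (abs_nonneg _) ((abs_nonneg _).trans (hK x y))
        linarith
      add_mem' := by
        rintro f g ⟨K, hK⟩ ⟨L, hL⟩
        refine ⟨K + L, fun x y => ?_⟩
        have e : (f + g) x - (f + g) y = (f x - f y) + (g x - g y) := by
          simp only [ContinuousMap.add_apply]; ring
        rw [e, add_mul]
        exact (abs_add_le _ _).trans (add_le_add (hK x y) (hL x y))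
      algebraMap_mem' := fun r => ⟨0, fun x y => by simp⟩ }
  have hsep : A.SeparatesPoints := by
    intro x y hxy
    refine ⟨fun z => dist z x, ⟨⟨fun z => dist z x, by fun_prop⟩, ⟨1, fun z w => ?_⟩, rfl⟩, ?_⟩
    · rw [one_mul]; exact abs_dist_sub_le z w x
    · simp [dist_comm, hxy]
  have h := ContinuousMap.subalgebra_topologicalClosure_eq_top_of_separatesPoints A hsep
  intro ψ
  have : ψ ∈ A.topologicalClosure := by rw [h]; trivial
  exact this

/-! ### The transfer operator of a fibered expanding map -/

/-- Lebesgue measure on the fundamental domain `(0, 1] × (0, 1]` of the torus. -/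
noncomputable def unitSquare : Measure (ℝ × ℝ) :=
  (volume.restrict (Ioc (0 : ℝ) 1)).prod (volume.restrict (Ioc (0 : ℝ) 1))

lemma measurePreserving_proj : MeasurePreserving proj unitSquare volume := by
  have h := AddCircle.measurePreserving_mk (1 : ℝ) 0
  rw [zero_add] at h
  exact h.prod h

instance : IsProbabilityMeasure (volume : Measure Circ) := ⟨by simp⟩

instance : IsProbabilityMeasure unitSquare := by
  have : IsProbabilityMeasure ((volume : Measure ℝ).restrict (Ioc (0 : ℝ) 1)) := ⟨by simp⟩
  unfold unitSquare; infer_instance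

lemma integrable_unitSquare {r : ℝ × ℝ → ℝ} (hr : Continuous r) : Integrable r unitSquare := by
  unfold unitSquare
  rw [Measure.prod_restrict]
  exact (hr.continuousOn.integrableOn_compact (isCompact_Icc.prod isCompact_Icc)).mono_set
    (prod_mono Ioc_subset_Icc_self Ioc_subset_Icc_self)

lemma integral_unitSquare {r : ℝ × ℝ → ℝ} (hr : Continuous r) :
    ∫ p, r p ∂unitSquare = ∫ x in (0 : ℝ)..1, ∫ y in (0 : ℝ)..1, r (x, y) := by
  have h := integrable_unitSquare hr
  unfold unitSquare at h ⊢
  rw [integral_prod _ h]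
  simp only [intervalIntegral.integral_of_le zero_le_one]

lemma integral_comp_proj (ψ : C(Torus, ℝ)) : ∫ p, ψ (proj p) ∂unitSquare = ∫ q, ψ q := by
  rw [← measurePreserving_proj.map_eq, integral_map measurePreserving_proj.measurable.aemeasurable
    ψ.continuous.aestronglyMeasurable]

/-- Biperiodic positive continuous functions on the plane whose logarithm is `R`-Lipschitz for the
metric `|x - x'| + |Φ y - Φ y'|`. -/
structure LogLip (Φ : ℝ → ℝ) (R : ℝ) (r : ℝ × ℝ → ℝ) : Prop where
  cont : Continuous r
  periodic_fst : ∀ x y, r (x + 1, y) = r (x, y)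
  periodic_snd : ∀ x y, r (x, y + 1) = r (x, y)
  pos : ∀ p, 0 < r p
  le : ∀ x y x' y', r (x, y) ≤ r (x', y') * Real.exp (R * (|x - x'| + |Φ y - Φ y'|))

/-- The map `(x, y) ↦ (m x, T y + c x)` lifts a skew product of the torus over `x ↦ m x` whose
fiber maps, of degree two, expand in the metric `|Φ y - Φ y'|` by the factor `11 / 10`. The function
`s` is the derivative of `T`, and `D` bounds its distortion. The constants in the bounds for `Φ` are
those of `Φ y = y + 9 / 10 * f y`, where `f` lifts the deformed doubling map. The condition `m_large`
makes the base expansion dominate the slope `κ` of `c`. -/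
structure ExpandingFibers (m : ℕ) (T s c Φ : ℝ → ℝ) (D κ : ℝ) : Prop where
  hasDerivAt : ∀ y, HasDerivAt T (s y) y
  continuous_s : Continuous s
  s_ge : ∀ y, 2 / 3 ≤ s y
  T_add_one : ∀ y, T (y + 1) = T y + 2
  s_add_one : ∀ y, s (y + 1) = s y
  c_add_one : ∀ x, c (x + 1) = c x
  c_lip : ∀ x x', |c x - c x'| ≤ κ * |x - x'|
  Φ_add_one : ∀ y, Φ (y + 1) = Φ y + 14 / 5
  Φ_lip : ∀ y y', |Φ y - Φ y'| ≤ 4 * |y - y'|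
  Φ_ge : ∀ y y', |y - y'| ≤ |Φ y - Φ y'|
  log_lip : ∀ y y', s y ≤ s y' * Real.exp (D * |Φ y - Φ y'|)
  contract : ∀ x y y', |Φ y - Φ y'| ≤ 10 / 11 * |Φ (T y + c x) - Φ (T y' + c x)|
  D_nonneg : 0 ≤ D
  m_large : 22 * (1 + 12 * κ) ≤ 21 * m

namespace ExpandingFibers

variable {m : ℕ} {T s c Φ : ℝ → ℝ} {D κ : ℝ}

lemma s_pos (h : ExpandingFibers m T s c Φ D κ) (y : ℝ) : 0 < s y :=
  lt_of_lt_of_le (by norm_num) (h.s_ge y)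

lemma T_sub_ge (h : ExpandingFibers m T s c Φ D κ) {y z : ℝ} (hyz : y ≤ z) :
    2 / 3 * (z - y) ≤ T z - T y :=
  mul_sub_le_image_sub_of_le_deriv (fun y => (h.hasDerivAt y).differentiableAt)
    (fun y => by rw [(h.hasDerivAt y).deriv]; exact h.s_ge y) hyz

lemma strictMono_T (h : ExpandingFibers m T s c Φ D κ) : StrictMono T :=
  fun y z hyz => by have := h.T_sub_ge hyz.le; linarith

lemma continuous_T (h : ExpandingFibers m T s c Φ D κ) : Continuous T :=
  continuous_iff_continuousAt.2 fun y => (h.hasDerivAt y).continuousAt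

lemma surjective_T (h : ExpandingFibers m T s c Φ D κ) : Function.Surjective T := by
  refine h.continuous_T.surjective ?_ ?_
  · refine tendsto_atTop.2 fun b => ?_
    filter_upwards [eventually_ge_atTop (max 0 (3 / 2 * (b - T 0)))] with z hz
    have h1 := h.T_sub_ge ((le_max_left _ _).trans hz)
    have h2 := (le_max_right _ _).trans hz
    linarith
  · refine tendsto_atBot.2 fun b => ?_
    filter_upwards [eventually_le_atBot (min 0 (3 / 2 * (b - T 0)))] with z hz
    have h1 := h.T_sub_ge (hz.trans (min_le_left _ _))
    have h2 := hz.trans (min_le_right _ _)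
    linarith

/-- The inverse of the lifted fiber map. -/
noncomputable def inv (h : ExpandingFibers m T s c Φ D κ) : ℝ ≃o ℝ :=
  (h.strictMono_T.orderIsoOfSurjective T h.surjective_T).symm

lemma T_inv (h : ExpandingFibers m T s c Φ D κ) (z : ℝ) : T (h.inv z) = z :=
  (h.strictMono_T.orderIsoOfSurjective T h.surjective_T).apply_symm_apply z

lemma inv_T (h : ExpandingFibers m T s c Φ D κ) (y : ℝ) : h.inv (T y) = y :=
  (h.strictMono_T.orderIsoOfSurjective T h.surjective_T).symm_apply_apply y

lemma continuous_inv (h : ExpandingFibers m T s c Φ D κ) : Continuous h.inv :=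
  h.inv.continuous

lemma inv_add_two (h : ExpandingFibers m T s c Φ D κ) (z : ℝ) : h.inv (z + 2) = h.inv z + 1 := by
  apply h.strictMono_T.injective
  rw [h.T_inv, h.T_add_one, h.T_inv]

lemma continuous_c (h : ExpandingFibers m T s c Φ D κ) : Continuous c :=
  (LipschitzWith.of_dist_le' (K := κ) fun x y => by
    rw [Real.dist_eq, Real.dist_eq]; exact h.c_lip x y).continuous

lemma κ_nonneg (h : ExpandingFibers m T s c Φ D κ) : 0 ≤ κ := by
  have := (abs_nonneg _).trans (h.c_lip 1 0)
  simpa using this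

lemma m_pos (h : ExpandingFibers m T s c Φ D κ) : (0 : ℝ) < m := by
  have := h.m_large
  have := h.κ_nonneg
  linarith

/-- The fiberwise part of the transfer operator: the sum over the two inverse branches. -/
noncomputable def fiberSum (h : ExpandingFibers m T s c Φ D κ) (r : ℝ × ℝ → ℝ) (p : ℝ × ℝ) : ℝ :=
  r (p.1, h.inv (p.2 - c p.1)) / s (h.inv (p.2 - c p.1)) +
    r (p.1, h.inv (p.2 + 1 - c p.1)) / s (h.inv (p.2 + 1 - c p.1))

/-- The transfer operator of `(x, y) ↦ (m x, T y + c x)`: the sum of a density over all inverse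
branches, weighted by the inverse Jacobian. -/
noncomputable def transfer (h : ExpandingFibers m T s c Φ D κ) (r : ℝ × ℝ → ℝ) (p : ℝ × ℝ) : ℝ :=
  (m : ℝ)⁻¹ * ∑ j ∈ Finset.range m, h.fiberSum r ((p.1 + j) / m, p.2)

lemma continuous_fiberSum (h : ExpandingFibers m T s c Φ D κ) {r : ℝ × ℝ → ℝ} (hr : Continuous r) :
    Continuous (h.fiberSum r) := by
  have := h.continuous_inv
  have := h.continuous_c
  have := h.continuous_s
  unfold fiberSum
  refine Continuous.add ?_ ?_
  · refine Continuous.div (by fun_prop) (by fun_prop) fun p => (h.s_pos _).ne'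
  · refine Continuous.div (by fun_prop) (by fun_prop) fun p => (h.s_pos _).ne'

lemma continuous_transfer (h : ExpandingFibers m T s c Φ D κ) {r : ℝ × ℝ → ℝ} (hr : Continuous r) :
    Continuous (h.transfer r) := by
  have := h.continuous_fiberSum hr
  unfold transfer
  fun_prop

lemma integral_fiber (h : ExpandingFibers m T s c Φ D κ) {r : ℝ × ℝ → ℝ} (hr : Continuous r)
    (hper : ∀ x y, r (x, y + 1) = r (x, y)) {ψ : ℝ → ℝ} (hψ : Continuous ψ)
    (hψp : ∀ z, ψ (z + 1) = ψ z) (x : ℝ) :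
    ∫ y in (0 : ℝ)..1, ψ (T y + c x) * r (x, y) = ∫ z in (0 : ℝ)..1, ψ z * h.fiberSum r (x, z) := by
  have hi := h.continuous_inv
  have hs := h.continuous_s
  set G : ℝ → ℝ := fun z => ψ z * (r (x, h.inv (z - c x)) / s (h.inv (z - c x))) with hG
  have hGc : Continuous G :=
    hψ.mul (Continuous.div (by fun_prop) (by fun_prop) fun p => (h.s_pos _).ne')
  have hGp : Function.Periodic G 2 := by
    intro z
    have e1 : z + 2 - c x = (z - c x) + 2 := by ring
    have e2 : ψ (z + 2) = ψ z := by
      rw [show z + 2 = z + 1 + 1 by ring, hψp, hψp]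
    simp only [hG]
    rw [e1, e2, h.inv_add_two, hper, h.s_add_one]
  have e1 : ∀ y, ψ (T y + c x) * r (x, y) = (G ∘ fun y => T y + c x) y * s y := by
    intro y
    simp only [hG, Function.comp, add_sub_cancel_right, h.inv_T]
    field_simp [(h.s_pos y).ne']
  simp only [e1]
  rw [intervalIntegral.integral_comp_mul_deriv (fun y _ => (h.hasDerivAt y).add_const (c x))
    hs.continuousOn hGc]
  have e2 : T 1 + c x = T 0 + c x + 2 := by
    have := h.T_add_one 0
    rw [zero_add] at this
    linarith
  rw [e2, hGp.intervalIntegral_add_eq _ 0, zero_add,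
    ← intervalIntegral.integral_add_adjacent_intervals (hGc.intervalIntegrable 0 1)
      (hGc.intervalIntegrable 1 2)]
  have e3 : ∫ z in (1 : ℝ)..2, G z = ∫ z in (0 : ℝ)..1, G (z + 1) := by
    rw [intervalIntegral.integral_comp_add_right]; norm_num
  rw [e3, ← intervalIntegral.integral_add (hGc.intervalIntegrable _ _)
    ((by fun_prop : Continuous fun z => G (z + 1)).intervalIntegrable _ _)]
  refine intervalIntegral.integral_congr fun z _ => ?_
  simp only [hG, fiberSum, hψp]
  ring

lemma integral_base (hm : 0 < m) {B : ℝ → ℝ} (hB : Continuous B) :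
    ∫ x in (0 : ℝ)..1, B x
      = (m : ℝ)⁻¹ * ∑ j ∈ Finset.range m, ∫ x in (0 : ℝ)..1, B ((x + j) / m) := by
  have hm' : (m : ℝ) ≠ 0 := by positivity
  have h1 : ∫ x in (0 : ℝ)..1, B x = (m : ℝ)⁻¹ * ∫ t in (0 : ℝ)..m, B (t / m) := by
    rw [intervalIntegral.integral_comp_div _ hm']
    simp [hm']
  have hc : Continuous fun t => B (t / m) := by fun_prop
  have h2 := intervalIntegral.sum_integral_adjacent_intervals (f := fun t => B (t / m))
    (a := fun k : ℕ => (k : ℝ)) (μ := volume) (n := m)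
    (fun k _ => hc.intervalIntegrable _ _)
  rw [Nat.cast_zero] at h2
  rw [h1, ← h2]
  congr 1
  refine Finset.sum_congr rfl fun j _ => ?_
  have := intervalIntegral.integral_comp_add_right (a := 0) (b := 1) (fun t => B (t / m)) (j : ℝ)
  rw [this]
  simp [add_comm]

/-- The transfer operator is dual to composition with the map. -/
lemma integral_comp_mul (h : ExpandingFibers m T s c Φ D κ) {r : ℝ × ℝ → ℝ} (hr : Continuous r)
    (hper : ∀ x y, r (x, y + 1) = r (x, y)) (ψ : C(Torus, ℝ)) :
    ∫ p, ψ (proj (m * p.1, T p.2 + c p.1)) * r p ∂unitSquare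
      = ∫ p, ψ (proj p) * h.transfer r p ∂unitSquare := by
  have hT := h.continuous_T
  have hc := h.continuous_c
  have hπ := continuous_proj
  have hf := h.continuous_fiberSum hr
  rw [integral_unitSquare (by fun_prop), integral_unitSquare
    (by have := h.continuous_transfer hr; fun_prop)]
  have hper1 : ∀ x y, proj (x, y + 1) = proj (x, y) := fun x y => by
    simp [proj]
  have e1 : ∀ x : ℝ, ∫ y in (0 : ℝ)..1, ψ (proj (m * x, T y + c x)) * r (x, y)
      = ∫ z in (0 : ℝ)..1, ψ (proj (m * x, z)) * h.fiberSum r (x, z) := fun x =>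
    h.integral_fiber hr hper (ψ := fun z => ψ (proj (m * x, z))) (by fun_prop)
      (fun z => by rw [hper1]) x
  simp only [e1]
  have hB : Continuous fun x : ℝ => ∫ z in (0 : ℝ)..1, ψ (proj (m * x, z)) * h.fiberSum r (x, z) :=
    intervalIntegral.continuous_parametric_intervalIntegral_of_continuous' (by
      simp only [Function.uncurry_def]; fun_prop) 0 1
  have hm : 0 < m := by exact_mod_cast h.m_pos
  have hm' : (m : ℝ) ≠ 0 := h.m_pos.ne'
  have hBj : ∀ j : ℕ, Continuous fun x : ℝ => ∫ z in (0 : ℝ)..1,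
      ψ (proj (m * ((x + j) / m), z)) * h.fiberSum r ((x + j) / m, z) := fun j =>
    hB.comp (by fun_prop : Continuous fun x : ℝ => (x + j) / m)
  rw [integral_base hm hB, ← intervalIntegral.integral_finsetSum fun j _ =>
    (hBj j).intervalIntegrable _ _, ← intervalIntegral.integral_const_mul]
  refine intervalIntegral.integral_congr fun x _ => ?_
  have e2 : ∀ j : ℕ, ∫ z in (0 : ℝ)..1, ψ (proj (m * ((x + j) / m), z)) * h.fiberSum r ((x + j) / m, z)
      = ∫ z in (0 : ℝ)..1, ψ (proj (x, z)) * h.fiberSum r ((x + j) / m, z) := fun j => by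
    rw [mul_div_cancel₀ _ hm']
    simp only [proj_add_natCast]
  simp only [e2]
  rw [← intervalIntegral.integral_finsetSum fun j _ =>
    Continuous.intervalIntegrable (by fun_prop) _ _, ← intervalIntegral.integral_const_mul]
  refine intervalIntegral.integral_congr fun z _ => ?_
  simp only [transfer]
  rw [← Finset.mul_sum]
  ring

/-- The branches of the transfer operator improve the regularity in the fiber direction, by the
factor `21 / 22`. The loss in the base direction is compensated by the factor `1 / m`. -/
lemma branch_le (h : ExpandingFibers m T s c Φ D κ) {R : ℝ} (hR : 20 * D ≤ R) {r : ℝ × ℝ → ℝ}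
    (hr : LogLip Φ R r) (x z x' z' : ℝ) :
    r (x, h.inv (z - c x)) / s (h.inv (z - c x)) ≤
      r (x', h.inv (z' - c x')) / s (h.inv (z' - c x')) *
        Real.exp (R * (1 + 12 * κ) * |x - x'| + 21 / 22 * R * |Φ z - Φ z'|) := by
  set w := h.inv (z - c x) with hw
  set w' := h.inv (z' - c x') with hw'
  set w'' := h.inv (z' - c x) with hw''
  have hD := h.D_nonneg
  have hκ := h.κ_nonneg
  have h1 : |Φ w - Φ w''| ≤ 10 / 11 * |Φ z - Φ z'| := by
    have := h.contract x w w''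
    rwa [hw, hw'', h.T_inv, h.T_inv, sub_add_cancel, sub_add_cancel] at this
  have h2 : |w'' - w'| ≤ 3 / 2 * (κ * |x - x'|) := by
    have hc := h.c_lip x x'
    have e : T w'' - T w' = c x' - c x := by rw [hw', hw'', h.T_inv, h.T_inv]; ring
    rcases le_total w' w'' with hle | hle
    · have := h.T_sub_ge hle
      rw [abs_of_nonneg (by linarith)]
      rw [abs_le] at hc; linarith [hc.1, hc.2]
    · have := h.T_sub_ge hle
      rw [abs_of_nonpos (by linarith)]
      rw [abs_le] at hc; linarith [hc.1, hc.2]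
  have h3 : |Φ w'' - Φ w'| ≤ 6 * κ * |x - x'| := by
    have := h.Φ_lip w'' w'
    linarith
  have h4 : |Φ w - Φ w'| ≤ 10 / 11 * |Φ z - Φ z'| + 6 * κ * |x - x'| :=
    (abs_sub_le _ (Φ w'') _).trans (add_le_add h1 h3)
  have h5 := hr.le x w x' w'
  have h6 := h.log_lip w' w
  rw [abs_sub_comm] at h6
  have hs := h.s_pos w
  have hs' := h.s_pos w'
  have hR0 : 0 ≤ R := by linarith
  rw [div_mul_eq_mul_div, div_le_div_iff₀ hs hs']
  calc r (x, w) * s w'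
      ≤ (r (x', w') * Real.exp (R * (|x - x'| + |Φ w - Φ w'|))) *
          (s w * Real.exp (D * |Φ w - Φ w'|)) :=
        mul_le_mul h5 h6 hs'.le (mul_nonneg (hr.pos _).le (Real.exp_pos _).le)
    _ = r (x', w') * Real.exp (R * (|x - x'| + |Φ w - Φ w'|) + D * |Φ w - Φ w'|) * s w := by
        rw [Real.exp_add]; ring
    _ ≤ _ := by
        refine mul_le_mul_of_nonneg_right
          (mul_le_mul_of_nonneg_left (Real.exp_le_exp.2 ?_) (hr.pos _).le) hs.le
        have a1 := abs_nonneg (x - x')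
        have a2 := abs_nonneg (Φ z - Φ z')
        calc R * (|x - x'| + |Φ w - Φ w'|) + D * |Φ w - Φ w'|
            = R * |x - x'| + (R + D) * |Φ w - Φ w'| := by ring
          _ ≤ R * |x - x'| + (R + D) * (10 / 11 * |Φ z - Φ z'| + 6 * κ * |x - x'|) := by
              gcongr
          _ ≤ R * |x - x'| + ((21 / 20 * R) * (10 / 11 * |Φ z - Φ z'|) +
                2 * R * (6 * κ * |x - x'|)) := by
              rw [mul_add]; gcongr <;> linarith
          _ = _ := by ring

/-- The transfer operator maps log-Lipschitz densities to densities with a better constant. -/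
lemma logLip_transfer (h : ExpandingFibers m T s c Φ D κ) {R : ℝ} (hR : 20 * D ≤ R)
    {r : ℝ × ℝ → ℝ} (hr : LogLip Φ R r) : LogLip Φ (21 / 22 * R) (h.transfer r) := by
  have hD := h.D_nonneg
  have hκ := h.κ_nonneg
  have hR0 : 0 ≤ R := by linarith
  have hm := h.m_pos
  have hm1 : 0 < m := by exact_mod_cast hm
  have hpos : ∀ p, 0 < h.fiberSum r p := fun p =>
    add_pos (div_pos (hr.pos _) (h.s_pos _)) (div_pos (hr.pos _) (h.s_pos _))
  refine ⟨h.continuous_transfer hr.cont, fun x z => ?_, fun x z => ?_, fun p => ?_, ?_⟩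
  · have hp1 : ∀ x z, h.fiberSum r (x + 1, z) = h.fiberSum r (x, z) := fun x z => by
      simp only [fiberSum, h.c_add_one, hr.periodic_fst]
    simp only [transfer]
    congr 1
    obtain ⟨k, rfl⟩ : ∃ k, m = k + 1 := ⟨m - 1, by omega⟩
    rw [Finset.sum_range_succ, Finset.sum_range_succ']
    congr 1
    · refine Finset.sum_congr rfl fun j _ => ?_
      push_cast
      congr 3; ring
    · symm
      rw [← hp1]
      congr 2
      push_cast at hm ⊢
      field_simp
      ring
  · simp only [transfer]
    congr 1
    refine Finset.sum_congr rfl fun j _ => ?_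
    simp only [fiberSum]
    rw [add_comm]
    congr 1
    rw [show z + 1 + 1 - c ((x + j) / m) = (z - c ((x + j) / m)) + 2 by ring, h.inv_add_two,
      hr.periodic_snd, h.s_add_one]
  · exact mul_pos (by positivity) (Finset.sum_pos (fun j _ => hpos _)
      (Finset.nonempty_range_iff.2 hm1.ne'))
  · intro x z x' z'
    simp only [transfer]
    rw [mul_assoc, Finset.sum_mul]
    gcongr with j
    set t := (x + j) / m
    set t' := (x' + j) / m
    have ht : |t - t'| = |x - x'| / m := by
      have : t - t' = (x - x') / m := by simp only [t, t']; ring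
      rw [this, abs_div, abs_of_pos hm]
    have hE : Real.exp (R * (1 + 12 * κ) * |t - t'| + 21 / 22 * R * |Φ z - Φ z'|)
        ≤ Real.exp (21 / 22 * R * (|x - x'| + |Φ z - Φ z'|)) := by
      refine Real.exp_le_exp.2 ?_
      have h1 : R * (1 + 12 * κ) * (|x - x'| / m) ≤ 21 / 22 * R * |x - x'| := by
        rw [← mul_div_assoc, div_le_iff₀ hm]
        have := mul_le_mul_of_nonneg_left h.m_large (mul_nonneg hR0 (abs_nonneg (x - x')))
        linarith
      rw [ht]
      linarith
    have hΦ1 : |Φ (z + 1) - Φ (z' + 1)| = |Φ z - Φ z'| := by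
      rw [h.Φ_add_one, h.Φ_add_one]; congr 1; ring
    simp only [fiberSum]
    rw [add_mul]
    refine add_le_add ((h.branch_le hR hr t z t' z').trans ?_)
      ((h.branch_le hR hr t (z + 1) t' (z' + 1)).trans ?_)
    · have := div_pos (hr.pos (t', h.inv (z' - c t'))) (h.s_pos (h.inv (z' - c t')))
      gcongr
    · rw [hΦ1]
      have := div_pos (hr.pos (t', h.inv (z' + 1 - c t'))) (h.s_pos (h.inv (z' + 1 - c t')))
      gcongr

end ExpandingFibers
end PartHyp

namespace PartHyp

/-! ### Loss of memory and the absolutely continuous measure -/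

lemma LogLip.apply_fract {Φ : ℝ → ℝ} {R : ℝ} {r : ℝ × ℝ → ℝ} (hr : LogLip Φ R r) (x y : ℝ) :
    r (Int.fract x, Int.fract y) = r (x, y) := by
  have h1 : Function.Periodic (fun x => r (x, Int.fract y)) 1 := fun x => hr.periodic_fst x _
  have h2 : Function.Periodic (fun y => r (x, y)) 1 := fun y => hr.periodic_snd x y
  have e1 := h1.sub_int_mul_eq (x := x) ⌊x⌋
  have e2 := h2.sub_int_mul_eq (x := y) ⌊y⌋
  simp only [mul_one, Int.self_sub_floor] at e1 e2
  rw [e1, e2]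

namespace ExpandingFibers

variable {m : ℕ} {T s c Φ : ℝ → ℝ} {D κ : ℝ}

lemma logLip_le_mul_exp (h : ExpandingFibers m T s c Φ D κ) {R : ℝ} (hR : 0 ≤ R)
    {r : ℝ × ℝ → ℝ} (hr : LogLip Φ R r) (p q : ℝ × ℝ) : r p ≤ r q * Real.exp (5 * R) := by
  obtain ⟨x, y⟩ := p
  obtain ⟨x', y'⟩ := q
  rw [← hr.apply_fract x y, ← hr.apply_fract x' y']
  refine (hr.le _ _ (Int.fract x') (Int.fract y')).trans ?_
  refine mul_le_mul_of_nonneg_left (Real.exp_le_exp.2 ?_) (hr.pos _).le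
  have h1 : ∀ u v : ℝ, |Int.fract u - Int.fract v| ≤ 1 := fun u v => by
    have := Int.fract_nonneg u
    have := Int.fract_nonneg v
    have := Int.fract_lt_one u
    have := Int.fract_lt_one v
    rw [abs_le]; constructor <;> linarith
  have h2 := h.Φ_lip (Int.fract y) (Int.fract y')
  have h3 := h1 x x'
  have h4 := h1 y y'
  rw [mul_comm 5 R]
  gcongr
  linarith

/-- One step of the transfer operator leaves a fixed proportion `θ` of the mass uniformly
distributed, and the rest again has a normalized log-Lipschitz density. -/
lemma exists_split (h : ExpandingFibers m T s c Φ D κ) {R : ℝ} (hR : 20 * D ≤ R)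
    {F : Torus → Torus} (hF : ∀ p, F (proj p) = proj (m * p.1, T p.2 + c p.1)) :
    ∃ θ : ℝ, 0 < θ ∧ θ < 1 ∧ ∀ r : ℝ × ℝ → ℝ, LogLip Φ R r → ∫ p, r p ∂unitSquare = 1 →
      ∃ r' : ℝ × ℝ → ℝ, LogLip Φ R r' ∧ ∫ p, r' p ∂unitSquare = 1 ∧ ∀ χ : C(Torus, ℝ),
        ∫ p, χ (F (proj p)) * r p ∂unitSquare
          = θ * ∫ p, χ (proj p) ∂unitSquare + (1 - θ) * ∫ p, χ (proj p) * r' p ∂unitSquare := by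
  have hR0 : 0 ≤ R := by linarith [h.D_nonneg]
  set θ : ℝ := 1 / 22 * Real.exp (-(5 * R)) with hθ
  have hexp1 : Real.exp (-(5 * R)) ≤ 1 := Real.exp_le_one_iff.2 (by linarith)
  have hθ0 : 0 < θ := by positivity
  have hθ1 : θ < 1 := by linarith
  have hθ' : 0 < 1 - θ := by linarith
  refine ⟨θ, hθ0, hθ1, fun r hr hr1 => ?_⟩
  have hq := h.logLip_transfer hR hr
  set q := h.transfer r with hqdef
  have hdual : ∀ χ : C(Torus, ℝ), ∫ p, χ (F (proj p)) * r p ∂unitSquare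
      = ∫ p, χ (proj p) * q p ∂unitSquare := fun χ => by
    simp only [hF]; exact h.integral_comp_mul hr.cont hr.periodic_snd χ
  have hq1 : ∫ p, q p ∂unitSquare = 1 := by
    have := hdual 1
    simpa [hr1] using this.symm
  have hqi := integrable_unitSquare hq.cont
  have hqmin : ∀ p, 22 * θ ≤ q p := by
    intro p
    have h1 : ∫ p', q p' ∂unitSquare ≤ ∫ _, q p * Real.exp (5 * (21 / 22 * R)) ∂unitSquare :=
      integral_mono hqi (integrable_const _) fun p' =>
        h.logLip_le_mul_exp (by linarith) hq p' p
    rw [hq1, integral_const, probReal_univ, one_smul] at h1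
    have h2 : Real.exp (5 * (21 / 22 * R)) ≤ Real.exp (5 * R) := Real.exp_le_exp.2 (by linarith)
    have h3 : 1 ≤ q p * Real.exp (5 * R) :=
      h1.trans (mul_le_mul_of_nonneg_left h2 (hq.pos p).le)
    rw [hθ, Real.exp_neg, ← mul_assoc, show (22 : ℝ) * (1 / 22) = 1 by norm_num, one_mul,
      inv_le_iff_one_le_mul₀ (Real.exp_pos _)]
    exact h3
  refine ⟨fun p => (q p - θ) / (1 - θ), ⟨?_, ?_, ?_, ?_, ?_⟩, ?_, ?_⟩
  · have := hq.cont
    fun_prop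
  · intro x y; simp only [hq.periodic_fst]
  · intro x y; simp only [hq.periodic_snd]
  · intro p
    have := hqmin p
    exact div_pos (by linarith) hθ'
  · intro x y x' y'
    set d := |x - x'| + |Φ y - Φ y'| with hd
    have hd0 : 0 ≤ d := by positivity
    rw [div_mul_eq_mul_div]
    gcongr
    have h1 := hq.le x y x' y'
    rw [← hd] at h1
    have hconv : Real.exp (21 / 22 * R * d) ≤ 21 / 22 * Real.exp (R * d) + 1 / 22 := by
      have := convexOn_exp.2 (mem_univ (R * d)) (mem_univ 0) (by norm_num : (0 : ℝ) ≤ 21 / 22)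
        (by norm_num : (0 : ℝ) ≤ 1 / 22) (by norm_num)
      simpa [mul_assoc] using this
    have hE : 1 ≤ Real.exp (R * d) := Real.one_le_exp (by positivity)
    have h2 := hqmin (x', y')
    have h3 := mul_le_mul_of_nonneg_left hconv (hq.pos (x', y')).le
    have h4 := mul_le_mul_of_nonneg_right h2 (sub_nonneg.2 hE)
    nlinarith
  · rw [integral_div, integral_sub hqi (integrable_const _), hq1, integral_const, probReal_univ,
      one_smul, div_self hθ'.ne']
  · intro χ
    rw [hdual]
    have hc : Continuous fun p => χ (proj p) := χ.continuous.comp continuous_proj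
    have hi1 := integrable_unitSquare hc
    have hi2 : Integrable (fun p => χ (proj p) * q p) unitSquare :=
      integrable_unitSquare (hc.mul hq.cont)
    have e : ∀ p, χ (proj p) * ((q p - θ) / (1 - θ))
        = (1 - θ)⁻¹ * (χ (proj p) * q p - θ * χ (proj p)) := fun p => by
      field_simp
    simp only [e]
    rw [integral_const_mul, integral_sub hi2 (hi1.const_mul θ), integral_const_mul]
    field_simp
    ring

lemma abs_integral_mul_le {r : ℝ × ℝ → ℝ} (hr : Continuous r) (hr0 : ∀ p, 0 < r p)
    (hr1 : ∫ p, r p ∂unitSquare = 1) (χ : C(Torus, ℝ)) :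
    |∫ p, χ (proj p) * r p ∂unitSquare| ≤ ‖χ‖ := by
  have hc : Continuous fun p => χ (proj p) := χ.continuous.comp continuous_proj
  refine abs_integral_le_integral_abs.trans ?_
  calc ∫ p, |χ (proj p) * r p| ∂unitSquare ≤ ∫ p, ‖χ‖ * r p ∂unitSquare := by
        refine integral_mono (integrable_unitSquare (hc.mul hr).abs)
          ((integrable_unitSquare hr).const_mul _) fun p => ?_
        simp only [abs_mul, abs_of_pos (hr0 p)]
        exact mul_le_mul_of_nonneg_right (χ.norm_coe_le_norm _) (hr0 p).le
    _ = ‖χ‖ := by rw [integral_const_mul, hr1, mul_one]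

/-- Exponential loss of memory: the images of two normalized log-Lipschitz densities approach each
other at an exponential rate. -/
lemma exists_decay (h : ExpandingFibers m T s c Φ D κ) {R : ℝ} (hR : 20 * D ≤ R)
    {F : Torus → Torus} (hFc : Continuous F)
    (hF : ∀ p, F (proj p) = proj (m * p.1, T p.2 + c p.1)) :
    ∃ τ : ℝ, 0 ≤ τ ∧ τ < 1 ∧ ∀ (n : ℕ) (r₁ r₂ : ℝ × ℝ → ℝ), LogLip Φ R r₁ → LogLip Φ R r₂ →
      ∫ p, r₁ p ∂unitSquare = 1 → ∫ p, r₂ p ∂unitSquare = 1 → ∀ χ : C(Torus, ℝ),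
        |∫ p, χ (F^[n] (proj p)) * r₁ p ∂unitSquare - ∫ p, χ (F^[n] (proj p)) * r₂ p ∂unitSquare|
          ≤ 2 * ‖χ‖ * τ ^ n := by
  obtain ⟨θ, hθ0, hθ1, hsplit⟩ := h.exists_split hR hF
  refine ⟨1 - θ, by linarith, by linarith, fun n => ?_⟩
  induction n with
  | zero =>
    intro r₁ r₂ h₁ h₂ hi₁ hi₂ χ
    have a := abs_integral_mul_le h₁.cont h₁.pos hi₁ χ
    have b := abs_integral_mul_le h₂.cont h₂.pos hi₂ χ
    simp only [Function.iterate_zero, id, pow_zero, mul_one]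
    refine (abs_sub _ _).trans ?_
    linarith
  | succ n ih =>
    intro r₁ r₂ h₁ h₂ hi₁ hi₂ χ
    obtain ⟨q₁, k₁, j₁, e₁⟩ := hsplit r₁ h₁ hi₁
    obtain ⟨q₂, k₂, j₂, e₂⟩ := hsplit r₂ h₂ hi₂
    let χn : C(Torus, ℝ) := χ.comp ⟨F^[n], hFc.iterate n⟩
    have f₁ := e₁ χn
    have f₂ := e₂ χn
    simp only [χn, ContinuousMap.comp_apply, ContinuousMap.coe_mk] at f₁ f₂
    simp only [Function.iterate_succ_apply]
    rw [f₁, f₂, add_sub_add_left_eq_sub, ← mul_sub, abs_mul, abs_of_pos (by linarith), pow_succ]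
    have := mul_le_mul_of_nonneg_left (ih q₁ q₂ k₁ k₂ j₁ j₂ χ) (by linarith : 0 ≤ 1 - θ)
    linarith

lemma logLip_one {R : ℝ} (hR : 0 ≤ R) : LogLip Φ R fun _ => 1 :=
  ⟨continuous_const, fun _ _ => rfl, fun _ _ => rfl, fun _ => one_pos, fun x y x' y' => by
    rw [one_mul]; exact Real.one_le_exp (by positivity)⟩

/-- The `n`-th image of a normalized log-Lipschitz density is again one. -/
lemma exists_density_iterate (h : ExpandingFibers m T s c Φ D κ) {R : ℝ} (hR : 20 * D ≤ R)
    {F : Torus → Torus} (hFc : Continuous F)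
    (hF : ∀ p, F (proj p) = proj (m * p.1, T p.2 + c p.1)) (n : ℕ) :
    ∃ r : ℝ × ℝ → ℝ, LogLip Φ R r ∧ ∫ p, r p ∂unitSquare = 1 ∧ ∀ χ : C(Torus, ℝ),
      ∫ p, χ (F^[n] (proj p)) ∂unitSquare = ∫ p, χ (proj p) * r p ∂unitSquare := by
  have hR0 : 0 ≤ R := by linarith [h.D_nonneg]
  induction n with
  | zero => exact ⟨_, logLip_one hR0, by simp, by simp⟩
  | succ n ih =>
    obtain ⟨r, hr, hr1, hrχ⟩ := ih
    have hq := h.logLip_transfer hR hr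
    have hdual : ∀ χ : C(Torus, ℝ), ∫ p, χ (F (proj p)) * r p ∂unitSquare
        = ∫ p, χ (proj p) * h.transfer r p ∂unitSquare := fun χ => by
      simp only [hF]; exact h.integral_comp_mul hr.cont hr.periodic_snd χ
    refine ⟨h.transfer r, ⟨hq.cont, hq.periodic_fst, hq.periodic_snd, hq.pos, ?_⟩, ?_, ?_⟩
    · intro x y x' y'
      refine (hq.le x y x' y').trans ?_
      refine mul_le_mul_of_nonneg_left (Real.exp_le_exp.2 ?_) (hq.pos _).le
      gcongr
      linarith
    · have := hdual 1
      simpa [hr1] using this.symm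
    · intro χ
      rw [← hdual]
      simp only [Function.iterate_succ_apply']
      exact hrχ (χ.comp ⟨F, hFc⟩)

/-- Time averages of positive log-Lipschitz observables converge to a constant Lebesgue almost
everywhere, since the correlations of the observable along orbits decay exponentially. -/
lemma exists_ae_tendsto (h : ExpandingFibers m T s c Φ D κ) {F : Torus → Torus}
    (hFc : Continuous F) (hF : ∀ p, F (proj p) = proj (m * p.1, T p.2 + c p.1))
    {ψ : C(Torus, ℝ)} {R₁ : ℝ} (hR₁ : 0 ≤ R₁) (hψ : LogLip Φ R₁ fun p => ψ (proj p)) :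
    ∃ l, ∀ᵐ p ∂(volume : Measure Torus),
      Tendsto (fun n => birkhoffAverage ℝ F ψ n p) atTop (𝓝 l) := by
  have hD := h.D_nonneg
  set R := 20 * D + R₁ with hRdef
  have hR : 20 * D ≤ R := by linarith
  obtain ⟨τ, hτ0, hτ1, hdecay⟩ := h.exists_decay hR hFc hF
  choose r hr hr1 hrχ using h.exists_density_iterate le_rfl hFc hF
  have hrR : ∀ j, LogLip Φ R (r j) := fun j =>
    ⟨(hr j).cont, (hr j).periodic_fst, (hr j).periodic_snd, (hr j).pos, fun x y x' y' =>
      ((hr j).le x y x' y').trans (mul_le_mul_of_nonneg_left (Real.exp_le_exp.2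
        (mul_le_mul_of_nonneg_right hR (by positivity))) ((hr j).pos _).le)⟩
  let ψi : ℕ → C(Torus, ℝ) := fun n => ψ.comp ⟨F^[n], hFc.iterate n⟩
  have hψc : Continuous fun p => ψ (proj p) := ψ.continuous.comp continuous_proj
  have hψn : ∀ n, Continuous fun p => ψ (F^[n] (proj p)) := fun n =>
    (ψi n).continuous.comp continuous_proj
  set C : ℕ → ℝ := fun j => ∫ p, ψ (F^[j] (proj p)) ∂unitSquare with hC
  have hCr : ∀ j, C j = ∫ p, ψ (proj p) * r j p ∂unitSquare := fun j => hrχ j ψ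
  have hCpos : ∀ j, 0 < C j := fun j => by
    rw [hCr]
    have hi := integrable_unitSquare (hψc.mul (hr j).cont)
    have hp : ∀ p, 0 < ψ (proj p) * r j p := fun p => mul_pos (hψ.pos p) ((hr j).pos p)
    rw [integral_pos_iff_support_of_nonneg (fun p => (hp p).le) hi]
    have : Function.support (fun p => ψ (proj p) * r j p) = univ :=
      eq_univ_of_forall fun p => (hp p).ne'
    rw [this]; simp
  have hCle : ∀ j, |C j| ≤ ‖ψ‖ := fun j => by
    rw [hCr]; exact abs_integral_mul_le (hr j).cont (hr j).pos (hr1 j) ψ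
  have hCadd : ∀ j n, C (j + n) = ∫ p, ψ (F^[n] (proj p)) * r j p ∂unitSquare := fun j n => by
    have := hrχ j (ψi n)
    simp only [ψi, ContinuousMap.comp_apply, ContinuousMap.coe_mk] at this
    rw [← this, hC]
    refine integral_congr_ae (ae_of_all _ fun p => ?_)
    simp only
    rw [add_comm, Function.iterate_add_apply]
  -- the space means `C j` converge by loss of memory
  have hcauchy : ∀ j n, |C (j + n) - C n| ≤ 2 * ‖ψ‖ * τ ^ n := fun j n => by
    have := hdecay n (r j) (fun _ => 1) (hrR j) (logLip_one (by linarith)) (hr1 j) (by simp) ψ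
    simp only [mul_one] at this
    rw [hCadd]; exact this
  obtain ⟨l, hl⟩ : ∃ l, Tendsto C atTop (𝓝 l) := by
    refine cauchySeq_tendsto_of_complete (Metric.cauchySeq_iff'.2 fun e he => ?_)
    have h0 : Tendsto (fun n => 2 * ‖ψ‖ * τ ^ n) atTop (𝓝 0) := by
      simpa using (tendsto_pow_atTop_nhds_zero_of_lt_one hτ0 hτ1).const_mul (2 * ‖ψ‖)
    obtain ⟨N, hN⟩ := (h0.eventually (Iio_mem_nhds he)).exists
    refine ⟨N, fun n hn => ?_⟩
    obtain ⟨k, rfl⟩ := Nat.exists_eq_add_of_le hn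
    rw [Real.dist_eq, add_comm]
    exact (hcauchy k N).trans_lt hN
  refine ⟨l, ?_⟩
  set u : ℕ → Torus → ℝ := fun k p => ψ (F^[k] p) - C k with hu
  have hcorr : ∀ j n, |∫ p, u j p * u (j + n) p ∂(volume : Measure Torus)|
      ≤ (2 * ‖ψ‖ * ‖ψ‖) * τ ^ n := by
    intro j n
    have e1 : ∫ p, u j p * u (j + n) p ∂(volume : Measure Torus)
        = ∫ p, u j (proj p) * u (j + n) (proj p) ∂unitSquare :=
      (integral_comp_proj ⟨fun p => u j p * u (j + n) p,
        ((ψi j).continuous.sub continuous_const).mul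
          ((ψi (j + n)).continuous.sub continuous_const)⟩).symm
    have i1 := integrable_unitSquare (hψn j)
    have i2 := integrable_unitSquare (hψn (j + n))
    have i3 : Integrable (fun p => ψ (F^[j] (proj p)) * ψ (F^[j + n] (proj p))) unitSquare :=
      integrable_unitSquare ((hψn j).mul (hψn (j + n)))
    have i4 : Integrable (fun p => ψ (F^[j] (proj p)) * ψ (F^[j + n] (proj p))
        - C (j + n) * ψ (F^[j] (proj p))) unitSquare := i3.sub (i1.const_mul _)
    have i5 : Integrable (fun p => C j * ψ (F^[j + n] (proj p)) - C j * C (j + n)) unitSquare :=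
      (i2.const_mul _).sub (integrable_const _)
    have e2 : ∫ p, u j (proj p) * u (j + n) (proj p) ∂unitSquare
        = ∫ p, ψ (F^[j] (proj p)) * ψ (F^[j + n] (proj p)) ∂unitSquare - C j * C (j + n) := by
      have : ∀ p, u j (proj p) * u (j + n) (proj p)
          = (ψ (F^[j] (proj p)) * ψ (F^[j + n] (proj p)) - C (j + n) * ψ (F^[j] (proj p)))
            - (C j * ψ (F^[j + n] (proj p)) - C j * C (j + n)) := fun p => by
        simp only [hu]; ring
      simp only [this]
      rw [integral_sub i4 i5,
        integral_sub i3 (i1.const_mul _), integral_sub (i2.const_mul _) (integrable_const _),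
        integral_const_mul, integral_const_mul, integral_const, probReal_univ, one_smul]
      simp only [hC]; ring
    -- the density `ψ r_j / C j` is again log-Lipschitz
    set r' : ℝ × ℝ → ℝ := fun p => (C j)⁻¹ * (ψ (proj p) * r j p) with hr'
    have hr'L : LogLip Φ R r' := by
      refine ⟨continuous_const.mul (hψc.mul (hr j).cont), fun x y => ?_, fun x y => ?_, fun p => ?_, ?_⟩
      · simp only [hr', hψ.periodic_fst, (hr j).periodic_fst]
      · simp only [hr', hψ.periodic_snd, (hr j).periodic_snd]
      · exact mul_pos (inv_pos.2 (hCpos j)) (mul_pos (hψ.pos p) ((hr j).pos p))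
      · intro x y x' y'
        simp only [hr']
        rw [mul_assoc]
        refine mul_le_mul_of_nonneg_left ?_ (inv_pos.2 (hCpos j)).le
        refine (mul_le_mul (hψ.le x y x' y') ((hr j).le x y x' y') ((hr j).pos _).le
          (mul_nonneg (hψ.pos (x', y')).le (Real.exp_pos _).le)).trans (le_of_eq ?_)
        rw [hRdef, add_mul, Real.exp_add]; ring
    have hr'1 : ∫ p, r' p ∂unitSquare = 1 := by
      simp only [hr']
      rw [integral_const_mul, ← hCr, inv_mul_cancel₀ (hCpos j).ne']
    have e3 : ∫ p, ψ (F^[j] (proj p)) * ψ (F^[j + n] (proj p)) ∂unitSquare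
        = C j * ∫ p, ψ (F^[n] (proj p)) * r' p ∂unitSquare := by
      have := hrχ j (ψ * ψi n)
      simp only [ψi, ContinuousMap.mul_apply, ContinuousMap.comp_apply, ContinuousMap.coe_mk] at this
      rw [← integral_const_mul]
      have e : ∀ p, ψ (F^[j] (proj p)) * ψ (F^[j + n] (proj p))
          = ψ (F^[j] (proj p)) * ψ (F^[n] (F^[j] (proj p))) := fun p => by
        rw [add_comm, Function.iterate_add_apply]
      simp only [e]
      rw [this]
      refine integral_congr_ae (ae_of_all _ fun p => ?_)
      simp only [hr']
      field_simp [(hCpos j).ne']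
    rw [e1, e2, e3, hCadd, ← mul_sub, abs_mul]
    calc |C j| * _ ≤ ‖ψ‖ * (2 * ‖ψ‖ * τ ^ n) :=
          mul_le_mul (hCle j) (hdecay n r' (r j) hr'L (hrR j) hr'1 (hr1 j) ψ) (abs_nonneg _)
            (norm_nonneg _)
      _ = _ := by ring
  have hae := ae_tendsto_average_of_correlation (ν := (volume : Measure Torus)) (u := u)
    (M := ‖ψ‖ + ‖ψ‖) (C := 2 * ‖ψ‖ * ‖ψ‖) (θ := τ)
    (fun k => ((ψi k).continuous.sub continuous_const).measurable)
    (fun k p => (abs_sub _ _).trans (add_le_add (ψ.norm_coe_le_norm _) (hCle k)))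
    (by positivity) hτ0 hτ1 hcorr
  filter_upwards [hae] with p hp
  have := hp.add hl.cesaro
  rw [zero_add] at this
  refine this.congr fun n => ?_
  rw [birkhoffAverage_eq_sum, ← mul_add, ← Finset.sum_add_distrib]
  simp [hu]

/-- A fibered expanding map of the torus has an absolutely continuous invariant probability
measure for which Lebesgue almost every point is generic. -/
lemma exists_isSRB (h : ExpandingFibers m T s c Φ D κ) {F : Torus → Torus}
    (hFc : Continuous F) (hF : ∀ p, F (proj p) = proj (m * p.1, T p.2 + c p.1)) :
    ∃ μ : Measure Torus, IsSRB F μ ∧ μ ≪ volume := by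
  obtain ⟨μ, hμ, hgen⟩ := exists_measure_ae_generic (F := F) (ν := (volume : Measure Torus))
    (dense_lipschitz Torus) (by
      rintro ψ ⟨K, hK⟩
      -- after adding a constant, a Lipschitz function becomes positive and log-Lipschitz
      set K' := max K 0 with hK'
      set N := ‖ψ‖ + 1 with hN
      let ψ' : C(Torus, ℝ) := ψ + ContinuousMap.const _ N
      have hψ' : ∀ q, ψ' q = ψ q + N := fun q => rfl
      have hge : ∀ q, 1 ≤ ψ' q := fun q => by
        have := (abs_le.1 (ψ.norm_coe_le_norm q)).1
        rw [hψ', hN]; linarith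
      have hdist : ∀ x y x' y' : ℝ, dist (proj (x, y)) (proj (x', y')) ≤ |x - x'| + |Φ y - Φ y'| := by
        intro x y x' y'
        have hcirc : ∀ u v : ℝ, dist (u : Circ) (v : Circ) ≤ |u - v| := fun u v => by
          rw [dist_eq_norm, ← AddCircle.coe_sub]
          exact (QuotientAddGroup.norm_mk_le_norm).trans_eq (Real.norm_eq_abs _)
        refine max_le ((hcirc x x').trans ?_) ((hcirc y y').trans ((h.Φ_ge y y').trans ?_)) <;>
        linarith [abs_nonneg (x - x'), abs_nonneg (Φ y - Φ y')]
      have hcoe : ∀ y : ℝ, ((y + 1 : ℝ) : Circ) = y := fun y => AddCircle.coe_add_period 1 y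
      have hL : LogLip Φ K' fun p => ψ' (proj p) := by
        refine ⟨ψ'.continuous.comp continuous_proj, fun x y => ?_, fun x y => ?_, fun p =>
          lt_of_lt_of_le one_pos (hge _), fun x y x' y' => ?_⟩
        · simp only [proj, hcoe]
        · simp only [proj, hcoe]
        · set d := |x - x'| + |Φ y - Φ y'|
          have hd : 0 ≤ d := by positivity
          have h1 : ψ' (proj (x, y)) - ψ' (proj (x', y')) ≤ K' * d := by
            have := (le_abs_self _).trans (hK (proj (x, y)) (proj (x', y')))
            rw [hψ', hψ', add_sub_add_right_eq_sub]
            refine this.trans ?_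
            calc K * dist (proj (x, y)) (proj (x', y')) ≤ K' * dist (proj (x, y)) (proj (x', y')) :=
                  mul_le_mul_of_nonneg_right (le_max_left _ _) dist_nonneg
              _ ≤ K' * d := mul_le_mul_of_nonneg_left (hdist _ _ _ _) (le_max_right _ _)
          have h2 := hge (proj (x', y'))
          have h3 := Real.add_one_le_exp (K' * d)
          have h4 : 0 ≤ K' * d := mul_nonneg (le_max_right _ _) hd
          nlinarith
      obtain ⟨l, hl⟩ := h.exists_ae_tendsto hFc hF (le_max_right _ _) hL
      refine ⟨l - N, hl.mono fun p hp => ?_⟩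
      refine (hp.sub_const N).congr' ?_
      filter_upwards [eventually_ne_atTop 0] with n hn
      rw [← birkhoffAverage_const_fun F hn p N]
      simp only [birkhoffAverage_eq_sum, ← mul_sub, ← Finset.sum_sub_distrib, hψ',
        add_sub_cancel_right])
  have : IsProbabilityMeasure μ := hμ
  obtain ⟨p₀, hp₀⟩ := hgen.exists
  refine ⟨μ, ⟨hμ, measurePreserving_of_generic hFc hp₀, hgen⟩, ?_⟩
  have hD := h.D_nonneg
  refine absolutelyContinuous_of_integral_le (C := Real.exp (5 * (20 * D)))
    fun ψ hψ => ?_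
  choose r hr hr1 hrχ using h.exists_density_iterate le_rfl hFc hF
  -- the `μ`-mean is a limit of means of image densities, which are at most `exp (100 * D)`
  have hlim : Tendsto (fun n => ∫ p, birkhoffAverage ℝ F ψ n p ∂(volume : Measure Torus)) atTop
      (𝓝 (∫ _, (∫ q, ψ q ∂μ) ∂(volume : Measure Torus))) := by
    refine tendsto_integral_of_dominated_convergence (fun _ => ‖ψ‖) (fun n => ?_)
      (integrable_const _) (fun n => ae_of_all _ fun p => ?_) (hgen.mono fun p hp => hp ψ)
    · have hcn : Continuous fun p => birkhoffAverage ℝ F ψ n p := by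
        simp only [birkhoffAverage_eq_sum]
        exact continuous_const.mul (continuous_finsetSum _
          fun k _ => ψ.continuous.comp (hFc.iterate k))
      exact hcn.aestronglyMeasurable
    · exact abs_birkhoffAverage_le F ψ (norm_nonneg _) ψ.norm_coe_le_norm n p
  rw [integral_const, probReal_univ, one_smul] at hlim
  refine le_of_tendsto hlim ?_
  filter_upwards [eventually_ge_atTop 1] with n hn
  have hn0 : (0 : ℝ) < n := by exact_mod_cast hn
  have hk : ∀ k, ∫ p, ψ (F^[k] p) ∂(volume : Measure Torus)
      ≤ Real.exp (5 * (20 * D)) * ∫ x, ψ x := by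
    intro k
    have e1 : ∫ p, ψ (F^[k] p) ∂(volume : Measure Torus)
        = ∫ p, ψ (F^[k] (proj p)) ∂unitSquare :=
      (integral_comp_proj (ψ.comp ⟨F^[k], hFc.iterate k⟩)).symm
    have hc : Continuous fun p => ψ (proj p) := ψ.continuous.comp continuous_proj
    have hrle : ∀ p, r k p ≤ Real.exp (5 * (20 * D)) := by
      intro p
      have h1 : ∫ _, r k p * Real.exp (-(5 * (20 * D))) ∂unitSquare ≤ ∫ p', r k p' ∂unitSquare := by
        refine integral_mono (integrable_const _) (integrable_unitSquare (hr k).cont) fun p' => ?_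
        have := h.logLip_le_mul_exp (by positivity) (hr k) p p'
        simp only [Real.exp_neg]
        rwa [← div_eq_mul_inv, div_le_iff₀ (Real.exp_pos _)]
      rw [hr1, integral_const, probReal_univ, one_smul, Real.exp_neg, ← div_eq_mul_inv,
        div_le_iff₀ (Real.exp_pos _), one_mul] at h1
      exact h1
    rw [e1, hrχ, ← integral_comp_proj, ← integral_const_mul]
    refine integral_mono (integrable_unitSquare (hc.mul (hr k).cont))
      ((integrable_unitSquare hc).const_mul _) fun p => ?_
    change ψ (proj p) * r k p ≤ _
    rw [mul_comm]
    exact mul_le_mul_of_nonneg_right (hrle p) (hψ _)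
  simp only [birkhoffAverage_eq_sum]
  have hki : ∀ k, Integrable (fun p => ψ (F^[k] p)) (volume : Measure Torus) := fun k =>
    integrable_continuousMap volume (ψ.comp ⟨F^[k], hFc.iterate k⟩)
  rw [integral_const_mul, integral_finsetSum _ fun k _ => hki k]
  calc (n : ℝ)⁻¹ * ∑ k ∈ Finset.range n, ∫ p, ψ (F^[k] p) ∂(volume : Measure Torus)
      ≤ (n : ℝ)⁻¹ * ∑ k ∈ Finset.range n, (Real.exp (5 * (20 * D)) * ∫ x, ψ x) := by
        gcongr
        exact hk _
    _ = _ := by simp; field_simp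

end ExpandingFibers
end PartHyp

namespace PartHyp

/-! ### From generic points to SRB measures -/

/-- An SRB measure is unique, because its generic points also determine any other one. -/
lemma IsSRB.unique {F : Torus → Torus} {μ ν : Measure Torus} (hμ : IsSRB F μ) (hν : IsSRB F ν) :
    ν = μ := by
  have := hμ.isProbabilityMeasure
  have := hν.isProbabilityMeasure
  obtain ⟨p, hp, hq⟩ := (hμ.ae_generic.and hν.ae_generic).exists
  exact ext_of_integral_continuousMap fun ψ => tendsto_nhds_unique (hq ψ) (hp ψ)

variable {φ : ℝ → ℝ} {ε : ℝ}

/-- If almost every point is generic, the central exponent is the mean of `logSlope`. It is smaller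
than the unstable exponent `log m` because all slopes are at most `10 / 3 < m`. -/
lemma isCentralExponent_of_generic (hφ : IsProfile φ) (hε : 0 < ε) (hε1 : ε < 1) {δ : ℝ}
    {m : ℕ} (hm : 5 ≤ m) {a : ℝ} {μ : Measure Torus} (hμ : IsSRB (skew φ ε δ m a) μ)
    (hgen : ∀ᵐ p ∂μ, IsGeneric (skew φ ε δ m a) μ p) :
    IsCentralExponent (skew φ ε δ m a) μ (∫ q, logSlope hφ hε hε1 q ∂μ) := by
  have := hμ.isProbabilityMeasure
  have hm' : (5 : ℝ) ≤ m := by exact_mod_cast hm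
  refine ⟨Real.log m, ?_, Real.log_pos (by linarith),
    hgen.mono fun p hp => hasExponentsAt_of_isGeneric hφ hε hε1 hm hp,
    hμ.ae_generic.mono fun p hp => hasExponentsAt_of_isGeneric hφ hε hε1 hm hp⟩
  have h1 : ∫ q, logSlope hφ hε hε1 q ∂μ ≤ ∫ _, Real.log (10 / 3) ∂μ := by
    refine integral_mono (integrable_continuousMap μ _) (integrable_const _) fun q => ?_
    exact Real.log_le_log (fSlope_pos hφ _) (fSlope_le hφ _)
  rw [integral_const, probReal_univ, one_smul] at h1
  exact h1.trans_lt (Real.log_lt_log (by norm_num) (by linarith))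

/-! ### The expanding regime -/

lemma IsProfile.le_self (hφ : IsProfile φ) {u : ℝ} (hu : u ∈ Icc (0 : ℝ) 1) : φ u ≤ u := by
  rcases eq_or_ne u (1 / 2) with rfl | h2
  · rw [hφ.half]
  rcases eq_or_lt_of_le hu.1 with rfl | h0
  · exact (hφ.eq_zero 0 fun h => by norm_num at h).le
  rcases eq_or_lt_of_le hu.2 with rfl | h1
  · exact (hφ.range 1).2
  · exact (hφ.lt_self u ⟨⟨h0, h1⟩, h2⟩).le

/-- A point where the slope is less than two is mapped by `f_{ε,a}`, `a ≥ 1`, outside the deformed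
interval, where the slope is two. -/
lemma fSlope_mul_fSlope_ge (hφ : IsProfile φ) (hε : 0 < ε) (hε1 : ε < 1 / 10) {t : ℝ}
    (ht : 19 / 20 * ε ≤ t) (ht' : t ≤ 3 * ε) (y : ℝ) :
    4 / 3 ≤ fSlope φ ε y * fSlope φ ε (fLift φ ε y + t) := by
  by_cases hu : ε⁻¹ * Int.fract y ∈ Icc (1 / 10 : ℝ) 1
  · set u := ε⁻¹ * Int.fract y with hudef
    have hfr : Int.fract y = ε * u := by rw [hudef, mul_inv_cancel_left₀ hε.ne']
    have h1 := hφ.le_self ⟨by linarith [hu.1], hu.2⟩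
    have h2 := (hφ.range u).1
    set v := ε * (2 * u - φ u) + t with hv
    have hv1 : ε < v := by
      have : ε * (1 / 10) ≤ ε * (2 * u - φ u) := by gcongr; linarith [hu.1]
      rw [hv]; linarith
    have hv2 : v < 1 := by
      have : ε * (2 * u - φ u) ≤ ε * 2 := by gcongr; linarith [hu.2]
      rw [hv]; linarith
    have e : fLift φ ε y + t = v + ((2 * ⌊y⌋ : ℤ) : ℝ) := by
      rw [fLift, ← hudef, hv]
      push_cast
      have := Int.self_sub_floor y
      linarith
    have hfv : Int.fract v = v := Int.fract_eq_self.2 ⟨by linarith, hv2⟩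
    have hs : fSlope φ ε v = 2 := by
      rw [fSlope, hfv, hφ.deriv_eq_zero, sub_zero]
      rintro ⟨-, h⟩
      rw [inv_mul_eq_div, div_le_one hε] at h
      linarith
    rw [e, fSlope_add_int, hs]
    linarith [fSlope_ge (ε := ε) hφ y]
  · have hs : fSlope φ ε y = 2 := by rw [fSlope, hφ.deriv_eq_zero hu, sub_zero]
    rw [hs]
    linarith [fSlope_ge (ε := ε) hφ (fLift φ ε y + t)]

lemma exists_fSlope_lipschitz (hφ : IsProfile φ) (hε : 0 < ε) (hε1 : ε < 1) :
    ∃ B, 0 ≤ B ∧ ∀ y z, |fSlope φ ε y - fSlope φ ε z| ≤ B * |y - z| := by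
  have hc : Continuous (deriv (deriv φ)) :=
    (contDiff_infty_iff_deriv.1 hφ.contDiff_deriv).2.continuous
  obtain ⟨C, hC⟩ := (isCompact_Icc (a := (0 : ℝ)) (b := ε⁻¹)).exists_bound_of_continuousOn
    hc.continuousOn
  have hb : ∀ y, ‖-(ε⁻¹ * deriv (deriv φ) (ε⁻¹ * Int.fract y))‖ ≤ ε⁻¹ * C := fun y => by
    rw [norm_neg, norm_mul, Real.norm_of_nonneg (inv_pos.2 hε).le]
    refine mul_le_mul_of_nonneg_left (hC _ ⟨?_, ?_⟩) (inv_pos.2 hε).le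
    · exact mul_nonneg (inv_pos.2 hε).le (Int.fract_nonneg y)
    · exact mul_le_of_le_one_right (inv_pos.2 hε).le (Int.fract_lt_one y).le
  refine ⟨ε⁻¹ * C, (norm_nonneg _).trans (hb 0), fun y z => ?_⟩
  have := convex_univ.norm_image_sub_le_of_norm_hasDerivWithin_le (f := fSlope φ ε)
    (fun x _ => (hasDerivAt_fSlope hφ hε hε1 x).hasDerivWithinAt) (fun x _ => hb x)
    (mem_univ z) (mem_univ y)
  simpa using this

lemma abs_cos_two_pi_sub_le (x x' : ℝ) :
    |Real.cos (2 * Real.pi * x) - Real.cos (2 * Real.pi * x')| ≤ 2 * Real.pi * |x - x'| := by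
  have := Real.lipschitzWith_cos.dist_le_mul (2 * Real.pi * x) (2 * Real.pi * x')
  rw [Real.dist_eq, Real.dist_eq, NNReal.coe_one, one_mul, ← mul_sub, abs_mul,
    abs_of_pos Real.two_pi_pos] at this
  exact this

/-- For `a ≥ 1` the skew product expands the fibers in the metric with density
`1 + 9 / 10 * fSlope`: if `s` and `s'` are the slopes at a point and at its image, then
`s + 9 / 10 * s * s' ≥ s + 6 / 5 ≥ 11 / 10 * (1 + 9 / 10 * s)`. -/
lemma expandingFibers (hφ : IsProfile φ) (hε : 0 < ε) (hε1 : ε < 1 / 10) :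
    ∃ D, ∀ δ : ℝ, 0 < δ → δ < 1 / 20 → ∀ m : ℕ, 22 * (1 + 12 * (δ * ε * (2 * Real.pi))) ≤ 21 * m →
      ∀ a : ℝ, 1 ≤ a → a ≤ 2 →
      ExpandingFibers m (fun y => fLift φ ε y + a * ε) (fSlope φ ε)
        (fun x => δ * ε * Real.cos (2 * Real.pi * x)) (fun y => y + 9 / 10 * fLift φ ε y) D
        (δ * ε * (2 * Real.pi)) := by
  have hε1' : ε < 1 := by linarith
  obtain ⟨B, hB0, hB⟩ := exists_fSlope_lipschitz hφ hε hε1'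
  refine ⟨3 / 2 * B, fun δ hδ hδ1 m hm a ha1 ha2 => ?_⟩
  have hΦge : ∀ y y', |y - y'| ≤ |y + 9 / 10 * fLift φ ε y - (y' + 9 / 10 * fLift φ ε y')| := by
    intro y y'
    rcases le_total y' y with h | h
    · have := fLift_sub_ge hφ hε hε1' h
      rw [abs_of_nonneg (by linarith), abs_of_nonneg (by linarith)]; linarith
    · have := fLift_sub_ge hφ hε hε1' h
      rw [abs_of_nonpos (by linarith), abs_of_nonpos (by linarith)]; linarith
  have hd := hasDerivAt_fLift hφ hε hε1'
  have hct : ∀ x : ℝ, |δ * ε * Real.cos (2 * Real.pi * x)| ≤ 1 / 20 * ε := fun x => by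
    rw [abs_mul, abs_of_pos (by positivity)]
    calc δ * ε * |Real.cos (2 * Real.pi * x)| ≤ 1 / 20 * ε * 1 := by
          gcongr; exact Real.abs_cos_le_one _
      _ = _ := mul_one _
  refine
    { hasDerivAt := fun y => (hd y).add_const _
      continuous_s := continuous_fSlope hφ hε hε1'
      s_ge := fSlope_ge hφ
      T_add_one := fun y => by rw [fLift_add_one]; ring
      s_add_one := fun y => by simpa using fSlope_add_int (φ := φ) (ε := ε) y 1
      c_add_one := fun x => by
        rw [mul_add, mul_one, Real.cos_add_two_pi]
      c_lip := fun x x' => ?_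
      Φ_add_one := fun y => by rw [fLift_add_one]; ring
      Φ_lip := fun y y' => ?_
      Φ_ge := hΦge
      log_lip := fun y y' => ?_
      contract := fun x => ?_
      D_nonneg := by positivity
      m_large := hm }
  · rw [← mul_sub, abs_mul, abs_of_pos (by positivity : 0 < δ * ε), mul_assoc (δ * ε)]
    exact mul_le_mul_of_nonneg_left (abs_cos_two_pi_sub_le x x') (by positivity)
  · have h1 := abs_fLift_sub_le hφ hε hε1' y' y
    have e : y + 9 / 10 * fLift φ ε y - (y' + 9 / 10 * fLift φ ε y')
        = (y - y') + 9 / 10 * (fLift φ ε y - fLift φ ε y') := by ring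
    rw [e]
    refine (abs_add_le _ _).trans ?_
    rw [abs_mul, abs_of_pos (by norm_num : (0 : ℝ) < 9 / 10)]
    linarith
  · have h1 := (le_abs_self _).trans (hB y y')
    have h2 := fSlope_ge (ε := ε) hφ y'
    set d := |y + 9 / 10 * fLift φ ε y - (y' + 9 / 10 * fLift φ ε y')|
    have h3 : B * |y - y'| ≤ B * d := mul_le_mul_of_nonneg_left (hΦge y y') hB0
    have h4 := Real.add_one_le_exp (3 / 2 * B * d)
    have h5 : 0 ≤ B * d := by positivity
    nlinarith
  · set t := a * ε + δ * ε * Real.cos (2 * Real.pi * x) with ht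
    have htt := abs_le.1 (hct x)
    have ht1 : 19 / 20 * ε ≤ t := by nlinarith [htt.1]
    have ht2 : t ≤ 3 * ε := by nlinarith [htt.2]
    set Ψ : ℝ → ℝ := fun y => (fLift φ ε y + t + 9 / 10 * fLift φ ε (fLift φ ε y + t))
      - 11 / 10 * (y + 9 / 10 * fLift φ ε y) with hΨ
    have hΨd : ∀ y, HasDerivAt Ψ ((fSlope φ ε y + 9 / 10 * (fSlope φ ε (fLift φ ε y + t) * fSlope φ ε y))
        - 11 / 10 * (1 + 9 / 10 * fSlope φ ε y)) y := by
      intro y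
      have h1 := (hd y).add_const t
      have h2 : HasDerivAt (fun y => fLift φ ε (fLift φ ε y + t))
          (fSlope φ ε (fLift φ ε y + t) * fSlope φ ε y) y := (hd _).comp y h1
      exact (h1.add (h2.const_mul (9 / 10))).sub
        (((hasDerivAt_id y).add ((hd y).const_mul (9 / 10))).const_mul (11 / 10))
    have hmono : Monotone Ψ := by
      refine monotone_of_hasDerivAt_nonneg (fun y => hΨd y) fun y => ?_
      have h1 := fSlope_mul_fSlope_ge hφ hε hε1 ht1 ht2 y
      have h2 := fSlope_pos (ε := ε) hφ y
      simp only [Pi.zero_apply]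
      nlinarith
    have key : ∀ y y', y' ≤ y → |y + 9 / 10 * fLift φ ε y - (y' + 9 / 10 * fLift φ ε y')| ≤
        10 / 11 * |fLift φ ε y + t + 9 / 10 * fLift φ ε (fLift φ ε y + t) -
          (fLift φ ε y' + t + 9 / 10 * fLift φ ε (fLift φ ε y' + t))| := by
      intro y y' h
      have h1 := hmono h
      have h2 := fLift_sub_ge hφ hε hε1' h
      simp only [hΨ] at h1
      rw [abs_of_nonneg (by linarith), abs_of_nonneg (by linarith)]
      linarith
    have e : ∀ y, fLift φ ε y + a * ε + δ * ε * Real.cos (2 * Real.pi * x) = fLift φ ε y + t :=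
      fun y => by rw [ht]; ring
    intro y y'
    simp only [e]
    rcases le_total y' y with h | h
    · exact key y y' h
    · rw [abs_sub_comm, abs_sub_comm (fLift φ ε y + t + _)]
      exact key y' y h

lemma four_thirds_le_circDeriv (hφ : IsProfile φ) (hε : 0 < ε) (hε1 : ε < 1 / 10) {a : ℝ}
    (ha : 1 ≤ a) (ha2 : a ≤ 2) (y : Circ) :
    4 / 3 ≤ circDeriv (fEpsA φ ε a ∘ fEpsA φ ε a) y := by
  rw [← coe_rep y]
  set t := rep y
  have hd : ∀ t, HasDerivAt (fun t => fLift φ ε t + a * ε) (fSlope φ ε t) t := fun t =>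
    (hasDerivAt_fLift hφ hε (by linarith) t).add_const _
  rw [circDeriv_eq (g := fun t => fLift φ ε (fLift φ ε t + a * ε) + a * ε)
    (fun t => by simp only [Function.comp, fEpsA_coe hφ hε]) ((hd _).comp t (hd t)), mul_comm]
  exact fSlope_mul_fSlope_ge hφ hε hε1 (by nlinarith) (by nlinarith) t

/-- The conclusions about the SRB measure in the expanding regime. -/
lemma expanding_regime (hφ : IsProfile φ) (hε : 0 < ε) (hε1 : ε < 1 / 10) {δ : ℝ} (hδ : 0 < δ)
    (hδ1 : δ < 1 / 20) {m : ℕ} (hm5 : 5 ≤ m)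
    (hm : 22 * (1 + 12 * (δ * ε * (2 * Real.pi))) ≤ 21 * m) {a : ℝ} (ha : 1 ≤ a) (ha2 : a ≤ 2) :
    ∃ μ : Measure Torus, IsSRB (skew φ ε δ m a) μ ∧
      (∀ ν : Measure Torus, IsSRB (skew φ ε δ m a) ν → ν = μ) ∧
      Ergodic (skew φ ε δ m a) μ ∧
      ∃ χ : ℝ, IsCentralExponent (skew φ ε δ m a) μ χ ∧ 0 < χ := by
  have hε1' : ε < 1 := by linarith
  obtain ⟨D, hD⟩ := expandingFibers hφ hε hε1
  have hF := continuous_skew hφ hε hε1' δ m a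
  obtain ⟨μ, hμ, hac⟩ := (hD δ hδ hδ1 m hm a ha ha2).exists_isSRB hF (skew_proj hφ hε δ m a)
  have := hμ.isProbabilityMeasure
  have hgen : ∀ᵐ p ∂μ, IsGeneric (skew φ ε δ m a) μ p := hac.ae_le hμ.ae_generic
  refine ⟨μ, hμ, fun ν hν => hμ.unique hν, ergodic_of_ae_generic hμ.invariant hgen, _,
    isCentralExponent_of_generic hφ hε hε1' hm5 hμ hgen, ?_⟩
  set ψ := logSlope hφ hε hε1' with hψ
  have hint : Integrable ψ μ := integrable_continuousMap μ _
  have hintF : Integrable (fun p => ψ (skew φ ε δ m a p)) μ :=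
    hμ.invariant.integrable_comp_of_integrable hint
  have hinv : ∫ p, ψ (skew φ ε δ m a p) ∂μ = ∫ p, ψ p ∂μ := by
    have h1 := integral_map (μ := μ) hF.aemeasurable (f := ψ) ψ.continuous.aestronglyMeasurable
    rw [hμ.invariant.map_eq] at h1
    exact h1.symm
  -- by invariance, twice the exponent is the mean over two consecutive slopes
  have h2 : ∫ _, Real.log (4 / 3) ∂μ ≤ ∫ p, (ψ p + ψ (skew φ ε δ m a p)) ∂μ := by
    refine integral_mono (integrable_const _) (hint.add hintF) fun p => ?_
    obtain ⟨v, rfl⟩ := exists_proj_eq p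
    simp only
    rw [skew_proj hφ hε, hψ, logSlope_proj, logSlope_proj,
      ← Real.log_mul (fSlope_pos hφ _).ne' (fSlope_pos hφ _).ne']
    refine Real.log_le_log (by norm_num) ?_
    have hc1 := Real.neg_one_le_cos (2 * Real.pi * v.1)
    have hc2 := Real.cos_le_one (2 * Real.pi * v.1)
    have hδε : 0 < δ * ε := by positivity
    have hδε' : δ * ε ≤ 1 / 20 * ε := by gcongr
    have e : (skewLift φ ε δ m a v).2
        = fLift φ ε v.2 + (a * ε + δ * ε * Real.cos (2 * Real.pi * v.1)) := by
      simp only [skewLift]; ring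
    rw [e]
    exact fSlope_mul_fSlope_ge hφ hε hε1 (by nlinarith) (by nlinarith) v.2
  rw [integral_const, probReal_univ, one_smul, integral_add hint hintF, hinv] at h2
  have h3 : 0 < Real.log (4 / 3) := Real.log_pos (by norm_num)
  linarith

lemma fst_iterate_skew (φ : ℝ → ℝ) (ε δ : ℝ) (m : ℕ) (a : ℝ) (n : ℕ) (p : Torus) :
    ((skew φ ε δ m a)^[n] p).1 = (fun x : Circ => m • x)^[n] p.1 := by
  induction n generalizing p with
  | zero => rfl
  | succ n ih => rw [Function.iterate_succ_apply, ih, Function.iterate_succ_apply]; rfl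

/-- Almost every point of the circle is equidistributed under multiplication by `m`. This is read
off from the first coordinate of an expanding skew product. -/
lemma ae_equidistributed (hφ : IsProfile φ) (hε : 0 < ε) (hε1 : ε < 1 / 10) {δ : ℝ} (hδ : 0 < δ)
    (hδ1 : δ < 1 / 20) {m : ℕ} (hm5 : 5 ≤ m)
    (hm : 22 * (1 + 12 * (δ * ε * (2 * Real.pi))) ≤ 21 * m) :
    ∀ᵐ x ∂(volume : Measure Circ), ∀ χ : C(Circ, ℝ),
      Tendsto (fun n => birkhoffAverage ℝ (fun x : Circ => m • x) χ n x) atTop (𝓝 (∫ x, χ x)) := by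
  obtain ⟨μ, hμ, -⟩ := expanding_regime hφ hε hε1 hδ hδ1 hm5 hm le_rfl one_le_two
  set G : Circ → Circ := fun x => m • x with hG
  have hGp : MeasurePreserving G volume volume :=
    (AddCircle.ergodic_nsmul (T := (1 : ℝ)) (by omega : 1 < m)).toMeasurePreserving
  have hGc : Continuous G := continuous_nsmul m
  have hae : ∀ᵐ x ∂(volume : Measure Circ), ∀ χ : C(Circ, ℝ),
      Tendsto (fun n => birkhoffAverage ℝ G χ n x) atTop (𝓝 (∫ q, χ q.1 ∂μ)) := by
    have h1 := Measure.ae_ae_of_ae_prod (show ∀ᵐ p ∂((volume : Measure Circ).prod volume),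
      IsGeneric (skew φ ε δ m 1) μ p from hμ.ae_generic)
    filter_upwards [h1] with x hx χ
    obtain ⟨y, hy⟩ := hx.exists
    refine (hy (χ.comp ⟨Prod.fst, continuous_fst⟩)).congr fun n => ?_
    simp only [birkhoffAverage_eq_sum, ContinuousMap.comp_apply, ContinuousMap.coe_mk,
      fst_iterate_skew, hG]
  filter_upwards [hae] with x hx χ
  have hlim : Tendsto (fun n => ∫ x, birkhoffAverage ℝ G χ n x ∂(volume : Measure Circ)) atTop
      (𝓝 (∫ _, (∫ q, χ q.1 ∂μ) ∂(volume : Measure Circ))) := by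
    refine tendsto_integral_of_dominated_convergence (fun _ => ‖χ‖) (fun n => ?_)
      (integrable_const _) (fun n => ae_of_all _ fun p => ?_) (hae.mono fun p hp => hp χ)
    · have hcn : Continuous fun p => birkhoffAverage ℝ G χ n p := by
        simp only [birkhoffAverage_eq_sum]
        exact continuous_const.mul (continuous_finsetSum _
          fun k _ => χ.continuous.comp (hGc.iterate k))
      exact hcn.aestronglyMeasurable
    · exact abs_birkhoffAverage_le G χ (norm_nonneg _) χ.norm_coe_le_norm n p
  rw [integral_const, probReal_univ, one_smul] at hlim
  have hcst : ∀ n ≥ 1, ∫ x, birkhoffAverage ℝ G χ n x ∂(volume : Measure Circ) = ∫ x, χ x := by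
    intro n hn
    have hn0 : (n : ℝ) ≠ 0 := by positivity
    have hki : ∀ k, Integrable (fun p => χ (G^[k] p)) (volume : Measure Circ) := fun k =>
      integrable_continuousMap volume (χ.comp ⟨G^[k], hGc.iterate k⟩)
    have hkv : ∀ k, ∫ p, χ (G^[k] p) = ∫ p, χ p := fun k => by
      have h1 := integral_map (μ := (volume : Measure Circ)) (hGp.iterate k).measurable.aemeasurable
        (f := χ) χ.continuous.aestronglyMeasurable
      rw [(hGp.iterate k).map_eq] at h1
      exact h1.symm
    simp only [birkhoffAverage_eq_sum]
    rw [integral_const_mul, integral_finsetSum _ fun k _ => hki k]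
    simp only [hkv]
    simp
    field_simp
  have hl : ∫ q, χ q.1 ∂μ = ∫ x, χ x :=
    tendsto_nhds_unique hlim (tendsto_const_nhds.congr' (by
      filter_upwards [eventually_ge_atTop 1] with n hn using (hcst n hn).symm))
  rw [← hl]
  exact hx χ

end PartHyp

namespace PartHyp

/-! ### Geometry of the profile near the tangency -/

/-- Quantitative form of the standing conditions: `u ↦ 2 u - φ u` contracts just to the left of its
fixed point `1 / 2` and does not contract just to the right of it, because `φ''` is negative there,
and it moves the points of `[1 / 10, 1]` that are not close to `1 / 2` up by at least `κ`. -/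
structure ProfileConstants (φ : ℝ → ℝ) (η κ : ℝ) : Prop where
  η_pos : 0 < η
  η_le : η ≤ 1 / 10
  κ_pos : 0 < κ
  κ_le : κ ≤ 1
  steep : ∀ u ∈ Ico (1 / 2 - η) (1 / 2), 1 < deriv φ u
  flat : ∀ u ∈ Icc (1 / 2) (1 / 2 + η), deriv φ u ≤ 1
  gap_left : ∀ u ∈ Icc (1 / 10) (1 / 2 - η), κ ≤ u - φ u
  gap_right : ∀ u ∈ Icc (1 / 2 + η / 2) 1, κ ≤ u - φ u

lemma IsProfile.apply_one (hφ : IsProfile φ) : φ 1 = 0 := by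
  have h1 : Tendsto φ (𝓝[>] 1) (𝓝 (φ 1)) := hφ.smooth.continuous.continuousWithinAt
  have h2 : Tendsto φ (𝓝[>] 1) (𝓝 0) := by
    refine tendsto_const_nhds.congr' ?_
    filter_upwards [self_mem_nhdsWithin] with u hu
    exact (hφ.eq_zero u fun h => not_le.2 hu h.2).symm
  exact tendsto_nhds_unique h1 h2

lemma IsProfile.lt_self_of_mem (hφ : IsProfile φ) {u : ℝ} (h0 : 0 < u) (h1 : u ≤ 1)
    (h2 : u ≠ 1 / 2) : φ u < u := by
  rcases eq_or_lt_of_le h1 with rfl | h1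
  · rw [hφ.apply_one]; exact h0
  · exact hφ.lt_self u ⟨⟨h0, h1⟩, h2⟩

lemma exists_gap (hφ : IsProfile φ) {b c : ℝ} (hb : 0 < b) (hc : c ≤ 1)
    (h : 1 / 2 ∉ Icc b c) : ∃ κ > 0, ∀ u ∈ Icc b c, κ ≤ u - φ u := by
  rcases (Icc b c).eq_empty_or_nonempty with he | hne
  · exact ⟨1, one_pos, by simp [he]⟩
  obtain ⟨v, hv, hmin⟩ := isCompact_Icc.exists_isMinOn hne
    (continuous_id.sub hφ.smooth.continuous).continuousOn
  refine ⟨v - φ v, ?_, fun u hu => hmin hu⟩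
  have := hφ.lt_self_of_mem (hb.trans_le hv.1) (hv.2.trans hc) (fun e => h (e ▸ hv))
  linarith

lemma exists_profileConstants (hφ : IsProfile φ) : ∃ η κ, ProfileConstants φ η κ := by
  have hd : HasDerivAt (deriv φ) (deriv (deriv φ) (1 / 2)) (1 / 2) :=
    (hφ.differentiable_deriv _).hasDerivAt
  have hslope := hasDerivAt_iff_tendsto_slope.1 hd
  have hev := hslope.eventually (Iio_mem_nhds hφ.deriv2_half)
  rw [eventually_nhdsWithin_iff, Metric.eventually_nhds_iff] at hev
  obtain ⟨r, hr, hball⟩ := hev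
  have key : ∀ u, |u - 1 / 2| < r → u ≠ 1 / 2 → (deriv φ u - 1) / (u - 1 / 2) < 0 := by
    intro u hu hne
    have := hball (y := u) (by rwa [Real.dist_eq]) hne
    have h2 : slope (deriv φ) (1 / 2) u < 0 := this
    rwa [slope_def_field, hφ.deriv_half] at h2
  set η := min (1 / 10) (r / 2) with hη
  have hη0 : 0 < η := by positivity
  have hη1 : η ≤ 1 / 10 := min_le_left _ _
  have hη2 : η < r := (min_le_right _ _).trans_lt (by linarith)
  obtain ⟨κ₁, hκ₁, g₁⟩ := exists_gap hφ (b := 1 / 10) (c := 1 / 2 - η) (by norm_num) (by linarith)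
    (fun h => by linarith [h.2])
  obtain ⟨κ₂, hκ₂, g₂⟩ := exists_gap hφ (b := 1 / 2 + η / 2) (c := 1) (by linarith) le_rfl
    (fun h => by linarith [h.1])
  refine ⟨η, min 1 (min κ₁ κ₂), hη0, hη1, by positivity, min_le_left _ _, ?_, ?_, ?_, ?_⟩
  · intro u hu
    have h1 := key u (by rw [abs_lt]; constructor <;> linarith [hu.1, hu.2]) hu.2.ne
    by_contra hle
    exact not_le.2 h1 (div_nonneg_of_nonpos (by linarith) (by linarith [hu.2]))
  · intro u hu
    rcases eq_or_lt_of_le hu.1 with rfl | hlt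
    · exact hφ.deriv_half.le
    have h1 := key u (by rw [abs_lt]; constructor <;> linarith [hu.1, hu.2]) hlt.ne'
    by_contra hle
    exact not_le.2 h1 (div_nonneg (by linarith) (by linarith))
  · exact fun u hu => ((min_le_right _ _).trans (min_le_left _ _)).trans (g₁ u hu)
  · exact fun u hu => ((min_le_right _ _).trans (min_le_right _ _)).trans (g₂ u hu)

/-! ### The trapping region -/

/-- The parameter range of the contracting regime. The noise and the parameter `a` move points by at
most `3 δ`, which is less than `κ / 2`. -/
structure TrapParams (φ : ℝ → ℝ) (η κ ε δ a : ℝ) : Prop where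
  profile : IsProfile φ
  const : ProfileConstants φ η κ
  ε_pos : 0 < ε
  ε_lt : ε < 1 / 10
  δ_pos : 0 < δ
  δ_lt : δ < 1 / 60
  δ_lt_η : δ < η
  δ_lt_κ : 6 * δ < κ
  le_a : -2 * δ ≤ a
  a_lt : a + δ < 0

/-- The skew product near the circle `y = 0`, in the coordinate `u = y / ε`. -/
noncomputable def innerMap (φ : ℝ → ℝ) (δ : ℝ) (m : ℕ) (a : ℝ) (p : ℝ × ℝ) : ℝ × ℝ :=
  (m * p.1, 2 * p.2 - φ p.2 + (a + δ * Real.cos (2 * Real.pi * p.1)))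

lemma skew_proj_scale {φ : ℝ → ℝ} {ε : ℝ} (hφ : IsProfile φ) (hε : 0 < ε) (hε1 : ε < 1) (δ : ℝ)
    (m : ℕ) (a : ℝ) {p : ℝ × ℝ} (h0 : 0 ≤ p.2) (h1 : p.2 < 1) :
    skew φ ε δ m a (proj (p.1, ε * p.2))
      = proj ((innerMap φ δ m a p).1, ε * (innerMap φ δ m a p).2) := by
  rw [skew_proj hφ hε]
  congr 1
  have hf : Int.fract (ε * p.2) = ε * p.2 :=
    Int.fract_eq_self.2 ⟨by positivity, by nlinarith⟩
  simp only [skewLift, innerMap, fLift, hf, inv_mul_cancel_left₀ hε.ne']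
  ext
  · rfl
  · simp only; ring

lemma fSlope_scale {φ : ℝ → ℝ} {ε : ℝ} (hε : 0 < ε) (hε1 : ε < 1) {u : ℝ} (h0 : 0 ≤ u)
    (h1 : u < 1) : fSlope φ ε (ε * u) = 2 - deriv φ u := by
  have hf : Int.fract (ε * u) = ε * u := Int.fract_eq_self.2 ⟨by positivity, by nlinarith⟩
  rw [fSlope, hf, inv_mul_cancel_left₀ hε.ne']

namespace TrapParams

variable {φ : ℝ → ℝ} {η κ ε δ a : ℝ}

lemma hasDerivAt_two_mul_sub (h : TrapParams φ η κ ε δ a) (u : ℝ) :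
    HasDerivAt (fun u => 2 * u - φ u) (2 - deriv φ u) u := by
  have h2 : HasDerivAt (fun t : ℝ => 2 * t) 2 u := by
    simpa using (hasDerivAt_id u).const_mul (2 : ℝ)
  exact h2.sub (h.profile.differentiable u).hasDerivAt

lemma strictMono_two_mul_sub (h : TrapParams φ η κ ε δ a) : StrictMono fun u => 2 * u - φ u := by
  refine strictMono_of_hasDerivAt_pos (fun u => h.hasDerivAt_two_mul_sub u) fun u => ?_
  have := (abs_le.1 (h.profile.deriv_le u)).2
  linarith

lemma noise_mem (h : TrapParams φ η κ ε δ a) (x : ℝ) :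
    a + δ * Real.cos (2 * Real.pi * x) ∈ Icc (a - δ) (a + δ) := by
  have h1 := Real.neg_one_le_cos (2 * Real.pi * x)
  have h2 := Real.cos_le_one (2 * Real.pi * x)
  have := h.δ_pos
  constructor <;> nlinarith

/-- The trapping region is mapped into itself, and strictly below its upper boundary. -/
lemma innerMap_mem (h : TrapParams φ η κ ε δ a) (m : ℕ) {p : ℝ × ℝ}
    (hp : p.2 ∈ Ioo (δ - a) (1 / 2)) :
    (innerMap φ δ m a p).2 ∈ Ioo (δ - a) (1 / 2) ∧ (innerMap φ δ m a p).2 ≤ 1 / 2 + (a + δ) := by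
  have hc := h.noise_mem p.1
  have hmono := h.strictMono_two_mul_sub
  have h1 := hmono hp.1
  have h2 := hmono hp.2
  have hs : φ (δ - a) = 0 := h.profile.eq_zero _ fun hh => by
    linarith [hh.1, h.le_a, h.δ_lt]
  simp only [hs, h.profile.half] at h1 h2
  have := h.a_lt
  simp only [innerMap, mem_Ioo]
  refine ⟨⟨?_, ?_⟩, ?_⟩ <;> linarith [hc.1, hc.2]

lemma iterate_mem (h : TrapParams φ η κ ε δ a) (m : ℕ) {p : ℝ × ℝ}
    (hp : p.2 ∈ Ioo (δ - a) (1 / 2)) (n : ℕ) :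
    ((innerMap φ δ m a)^[n] p).2 ∈ Ioo (δ - a) (1 / 2) := by
  induction n with
  | zero => exact hp
  | succ n ih => rw [Function.iterate_succ_apply']; exact (h.innerMap_mem m ih).1

/-- The heights of the absorbing strip inside the trapping region. -/
def core (η δ a : ℝ) : Set ℝ := Icc (1 / 2 - η) (1 / 2 + (a + δ))

lemma core_subset (h : TrapParams φ η κ ε δ a) : core η δ a ⊆ Ioo (δ - a) (1 / 2) := by
  intro u hu
  have h1 := h.le_a
  have h2 := h.a_lt
  have h3 := h.δ_lt
  have h4 := h.const.η_le
  exact ⟨by linarith [hu.1], by linarith [hu.2]⟩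

lemma innerMap_mem_core (h : TrapParams φ η κ ε δ a) (m : ℕ) {p : ℝ × ℝ}
    (hp : p.2 ∈ Ioo (δ - a) (1 / 2)) (hp' : 1 / 2 - η ≤ p.2) :
    (innerMap φ δ m a p).2 ∈ core η δ a := by
  refine ⟨?_, (h.innerMap_mem m hp).2⟩
  have hc := h.noise_mem p.1
  have h1 := h.strictMono_two_mul_sub.monotone hp'
  have h2 := h.const.gap_left (1 / 2 - η) ⟨by linarith [h.const.η_le], le_rfl⟩
  have := h.le_a
  have := h.δ_lt_κ
  have := h.δ_pos
  simp only [innerMap] at h1 ⊢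
  linarith [hc.1]

lemma iterate_mem_core (h : TrapParams φ η κ ε δ a) (m : ℕ) {p : ℝ × ℝ}
    (hp : p.2 ∈ core η δ a) (n : ℕ) : ((innerMap φ δ m a)^[n] p).2 ∈ core η δ a := by
  induction n with
  | zero => exact hp
  | succ n ih =>
    rw [Function.iterate_succ_apply']
    exact h.innerMap_mem_core m (h.core_subset ih) ih.1

/-- Every point of the trapping region reaches the core: below the core the distance to the
lower boundary grows geometrically. -/
lemma exists_iterate_mem_core (h : TrapParams φ η κ ε δ a) (m : ℕ) {p : ℝ × ℝ}
    (hp : p.2 ∈ Ioo (δ - a) (1 / 2)) : ∃ n, ((innerMap φ δ m a)^[n] p).2 ∈ core η δ a := by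
  by_contra hno
  push Not at hno
  have hlow : ∀ n, ((innerMap φ δ m a)^[n] p).2 < 1 / 2 - η := by
    intro n
    by_contra hge
    push Not at hge
    refine hno (n + 1) ?_
    rw [Function.iterate_succ_apply']
    exact h.innerMap_mem_core m (h.iterate_mem m hp n) hge
  have hgrow : ∀ n, (1 + κ) ^ n * (p.2 - (δ - a)) ≤ ((innerMap φ δ m a)^[n] p).2 - (δ - a) := by
    intro n
    induction n with
    | zero => simp
    | succ n ih =>
      rw [Function.iterate_succ_apply', pow_succ]
      set q := (innerMap φ δ m a)^[n] p with hq
      have hqm := h.iterate_mem m hp n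
      rw [← hq] at hqm
      have hql := hlow n
      rw [← hq] at hql
      have hc := h.noise_mem q.1
      have hκ := h.const.κ_pos
      have hκ1 := h.const.κ_le
      have hstep : (1 + κ) * (q.2 - (δ - a)) ≤ (innerMap φ δ m a q).2 - (δ - a) := by
        simp only [innerMap]
        have h5 := h.le_a
        have h6 := h.δ_lt_κ
        have h7 := h.δ_pos
        rcases lt_or_ge q.2 (1 / 10) with hlt | hge
        · rw [h.profile.eq_zero q.2 fun hh => not_le.2 hlt hh.1]
          nlinarith [hqm.1, hc.1]
        · have h8 := h.const.gap_left q.2 ⟨hge, hql.le⟩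
          have h9 : κ * (q.2 - (δ - a)) ≤ κ * (1 / 2) := by
            gcongr
            linarith [hqm.2, h.a_lt]
          linarith [hc.1]
      calc (1 + κ) ^ n * (1 + κ) * (p.2 - (δ - a))
          = (1 + κ) * ((1 + κ) ^ n * (p.2 - (δ - a))) := by ring
        _ ≤ (1 + κ) * (q.2 - (δ - a)) := by gcongr
        _ ≤ _ := hstep
  have hpos : 0 < p.2 - (δ - a) := by linarith [hp.1]
  obtain ⟨n, hn⟩ := pow_unbounded_of_one_lt (1 / (p.2 - (δ - a)))
    (by linarith [h.const.κ_pos] : 1 < 1 + κ)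
  rw [div_lt_iff₀ hpos] at hn
  have h1 := hgrow n
  have h2 := h.iterate_mem m hp n
  linarith [h2.2, h.a_lt, h.δ_pos]

/-- The slope is bounded away from one on the core. -/
lemma exists_rate (h : TrapParams φ η κ ε δ a) :
    ∃ τ, 0 < τ ∧ τ < 1 ∧ ∀ u ∈ core η δ a, 0 < 2 - deriv φ u ∧ 2 - deriv φ u ≤ τ := by
  have hne : (core η δ a).Nonempty :=
    ⟨1 / 2 - η, le_rfl, by linarith [h.le_a, h.δ_lt_η]⟩
  obtain ⟨v, hv, hmax⟩ := isCompact_Icc.exists_isMaxOn hne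
    (continuous_const.sub h.profile.contDiff_deriv.continuous :
      Continuous fun u => 2 - deriv φ u).continuousOn
  have hpos : ∀ u, 0 < 2 - deriv φ u := fun u => by
    have := (abs_le.1 (h.profile.deriv_le u)).2
    linarith
  refine ⟨2 - deriv φ v, hpos v, ?_, fun u hu => ⟨hpos u, hmax hu⟩⟩
  have := h.const.steep v ⟨hv.1, (h.core_subset hv).2⟩
  linarith

lemma fst_iterate_innerMap (m : ℕ) (p : ℝ × ℝ) (n : ℕ) :
    ((innerMap φ δ m a)^[n] p).1 = (m : ℝ) ^ n * p.1 := by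
  induction n with
  | zero => simp
  | succ n ih => rw [Function.iterate_succ_apply', innerMap, ih, pow_succ]; ring

/-- Two points of the core on the same fiber approach each other exponentially. -/
lemma exists_contraction (h : TrapParams φ η κ ε δ a) (m : ℕ) :
    ∃ τ, 0 < τ ∧ τ < 1 ∧ (∀ u ∈ core η δ a, 2 - deriv φ u ≤ τ) ∧
      ∀ p q : ℝ × ℝ, p.1 = q.1 → p.2 ∈ core η δ a → q.2 ∈ core η δ a →
        ∀ n, |((innerMap φ δ m a)^[n] p).2 - ((innerMap φ δ m a)^[n] q).2| ≤ τ ^ n := by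
  obtain ⟨τ, hτ0, hτ1, hτ⟩ := h.exists_rate
  refine ⟨τ, hτ0, hτ1, fun u hu => (hτ u hu).2, fun p q hpq hp hq n => ?_⟩
  induction n with
  | zero =>
    have h1 := h.core_subset hp
    have h2 := h.core_subset hq
    have h3 := h.a_lt
    have h4 := h.δ_pos
    simp only [Function.iterate_zero, id, pow_zero]
    rw [abs_le]
    constructor <;> linarith [h1.1, h1.2, h2.1, h2.2]
  | succ n ih =>
    rw [Function.iterate_succ_apply', Function.iterate_succ_apply']
    set p' := (innerMap φ δ m a)^[n] p with hp'
    set q' := (innerMap φ δ m a)^[n] q with hq'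
    have e1 : p'.1 = q'.1 := by rw [hp', hq', fst_iterate_innerMap, fst_iterate_innerMap, hpq]
    have m1 : p'.2 ∈ core η δ a := h.iterate_mem_core m hp n
    have m2 : q'.2 ∈ core η δ a := h.iterate_mem_core m hq n
    have hconv : Convex ℝ (core η δ a) := convex_Icc _ _
    have h1 := hconv.norm_image_sub_le_of_norm_hasDerivWithin_le
      (f := fun u => 2 * u - φ u) (f' := fun u => 2 - deriv φ u) (C := τ)
      (fun u _ => (h.hasDerivAt_two_mul_sub u).hasDerivWithinAt)
      (fun u (hu : u ∈ core η δ a) => by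
        rw [Real.norm_of_nonneg (hτ u hu).1.le]; exact (hτ u hu).2) m2 m1
    simp only [Real.norm_eq_abs] at h1
    simp only [innerMap, e1, add_sub_add_right_eq_sub]
    rw [pow_succ']
    exact h1.trans (mul_le_mul_of_nonneg_left ih hτ0.le)

/-- In rescaled coordinates the skew product acts on the trapping region as `innerMap`. -/
lemma iterate_skew_proj_scale (h : TrapParams φ η κ ε δ a) (m : ℕ) {p : ℝ × ℝ}
    (hp : p.2 ∈ Ioo (δ - a) (1 / 2)) (n : ℕ) :
    (skew φ ε δ m a)^[n] (proj (p.1, ε * p.2))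
      = proj (((innerMap φ δ m a)^[n] p).1, ε * ((innerMap φ δ m a)^[n] p).2) := by
  induction n with
  | zero => rfl
  | succ n ih =>
    rw [Function.iterate_succ_apply', ih, Function.iterate_succ_apply']
    have hm := h.iterate_mem m hp n
    have := h.a_lt
    have := h.δ_pos
    exact skew_proj_scale h.profile h.ε_pos (by linarith [h.ε_lt]) δ m a (by linarith [hm.1])
      (by linarith [hm.2])

lemma proj_mem_trapRegion (h : TrapParams φ η κ ε δ a) (x : ℝ) {u : ℝ}
    (hu : u ∈ Ioo (δ - a) (1 / 2)) : proj (x, ε * u) ∈ trapRegion ε δ a := by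
  have hε := h.ε_pos
  have h1 := h.ε_lt
  have h2 := h.a_lt
  have h3 := h.δ_pos
  have hf : Int.fract (ε * u) = ε * u :=
    Int.fract_eq_self.2 ⟨by nlinarith [hu.1], by nlinarith [hu.2]⟩
  change rep ((ε * u : ℝ) : Circ) ∈ Ioo ((δ - a) * ε) (ε / 2)
  rw [rep_coe, hf]
  exact ⟨by nlinarith [hu.1], by nlinarith [hu.2]⟩

lemma exists_eq_of_mem_trapRegion (h : TrapParams φ η κ ε δ a) {p : Torus}
    (hp : p ∈ trapRegion ε δ a) (x : ℝ) (hx : (x : Circ) = p.1) :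
    ∃ u ∈ Ioo (δ - a) (1 / 2), p = proj (x, ε * u) := by
  have hε := h.ε_pos
  refine ⟨rep p.2 / ε, ⟨(lt_div_iff₀ hε).2 hp.1, (div_lt_iff₀ hε).2 (by linarith [hp.2])⟩, ?_⟩
  rw [mul_div_cancel₀ _ hε.ne', proj]
  simp only [coe_rep, hx]

lemma mapsTo_trapRegion (h : TrapParams φ η κ ε δ a) (m : ℕ) :
    MapsTo (skew φ ε δ m a) (trapRegion ε δ a) (trapRegion ε δ a) := by
  intro p hp
  obtain ⟨u, hu, hpu⟩ := h.exists_eq_of_mem_trapRegion hp (rep p.1) (coe_rep _)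
  have := h.iterate_skew_proj_scale m (p := (rep p.1, u)) hu 1
  simp only [Function.iterate_one] at this
  rw [hpu, this]
  exact h.proj_mem_trapRegion _ (h.innerMap_mem m (p := (rep p.1, u)) hu).1

lemma dist_proj_scale_le (h : TrapParams φ η κ ε δ a) (x u v : ℝ) :
    dist (proj (x, ε * u)) (proj (x, ε * v)) ≤ |u - v| := by
  have hε := h.ε_pos
  have h1 : dist ((ε * u : ℝ) : Circ) ((ε * v : ℝ) : Circ) ≤ |u - v| := by
    rw [dist_eq_norm, ← AddCircle.coe_sub, ← mul_sub]
    refine (QuotientAddGroup.norm_mk_le_norm).trans ?_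
    rw [Real.norm_eq_abs, abs_mul, abs_of_pos hε]
    exact mul_le_of_le_one_left (abs_nonneg _) (by linarith [h.ε_lt])
  exact max_le (le_of_eq_of_le (dist_self (x : Circ)) (abs_nonneg _)) h1

lemma tendsto_dist_iterate (h : TrapParams φ η κ ε δ a) (m : ℕ) {p q : Torus}
    (hp : p ∈ trapRegion ε δ a) (hq : q ∈ trapRegion ε δ a) (hpq : p.1 = q.1) :
    Tendsto (fun n : ℕ => dist ((skew φ ε δ m a)^[n] p) ((skew φ ε δ m a)^[n] q)) atTop (𝓝 0) := by
  obtain ⟨u, hu, hpu⟩ := h.exists_eq_of_mem_trapRegion hp (rep p.1) (coe_rep _)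
  obtain ⟨v, hv, hqv⟩ := h.exists_eq_of_mem_trapRegion hq (rep p.1) (by rw [coe_rep, hpq])
  set x := rep p.1
  rw [hpu, hqv]
  obtain ⟨τ, hτ0, hτ1, -, hτ⟩ := h.exists_contraction m
  obtain ⟨n₁, hn₁⟩ := h.exists_iterate_mem_core m (p := (x, u)) hu
  obtain ⟨n₂, hn₂⟩ := h.exists_iterate_mem_core m (p := (x, v)) hv
  obtain ⟨N, hN⟩ : ∃ N, N = n₁ + n₂ := ⟨_, rfl⟩
  have k₁ : ((innerMap φ δ m a)^[N] (x, u)).2 ∈ core η δ a := by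
    rw [hN, add_comm, Function.iterate_add_apply]
    exact h.iterate_mem_core m hn₁ n₂
  have k₂ : ((innerMap φ δ m a)^[N] (x, v)).2 ∈ core η δ a := by
    rw [hN, Function.iterate_add_apply]
    exact h.iterate_mem_core m hn₂ n₁
  rw [← tendsto_add_atTop_iff_nat N]
  refine squeeze_zero (fun n => dist_nonneg) (fun n => ?_)
    (tendsto_pow_atTop_nhds_zero_of_lt_one hτ0.le hτ1)
  have e₁ := h.iterate_skew_proj_scale m (p := (x, u)) hu (n + N)
  have e₂ := h.iterate_skew_proj_scale m (p := (x, v)) hv (n + N)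
  simp only at e₁ e₂
  rw [e₁, e₂, fst_iterate_innerMap, fst_iterate_innerMap]
  refine (h.dist_proj_scale_le _ _ _).trans ?_
  rw [Function.iterate_add_apply, Function.iterate_add_apply]
  exact hτ _ _ (by rw [fst_iterate_innerMap, fst_iterate_innerMap]) k₁ k₂ n

/-- The points of the circle that are equidistributed under multiplication by `m`. -/
def equidistributed (m : ℕ) : Set Circ :=
  {x | ∀ χ : C(Circ, ℝ),
    Tendsto (fun n => birkhoffAverage ℝ (fun x : Circ => m • x) χ n x) atTop (𝓝 (∫ x, χ x))}

/-- Sequences that are eventually close to a common number, at every scale, have a common limit. -/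
lemma exists_common_limit {X : Type*} {G : Set X} (hG : G.Nonempty) {A : ℕ → X → ℝ}
    (hA : ∀ e > 0, ∃ I : ℝ, ∀ x ∈ G, ∀ᶠ n in atTop, |A n x - I| ≤ e) :
    ∃ c, ∀ x ∈ G, Tendsto (fun n => A n x) atTop (𝓝 c) := by
  obtain ⟨x₀, hx₀⟩ := hG
  have hcau : CauchySeq fun n => A n x₀ := by
    refine Metric.cauchySeq_iff'.2 fun e he => ?_
    obtain ⟨I, hI⟩ := hA (e / 4) (by positivity)
    obtain ⟨N, hN⟩ := eventually_atTop.1 (hI x₀ hx₀)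
    refine ⟨N, fun n hn => ?_⟩
    have h1 := abs_le.1 (hN n hn)
    have h2 := abs_le.1 (hN N le_rfl)
    rw [Real.dist_eq, abs_lt]
    constructor <;> linarith [h1.1, h1.2, h2.1, h2.2]
  obtain ⟨c, hc⟩ := cauchySeq_tendsto_of_complete hcau
  refine ⟨c, fun x hx => Metric.tendsto_atTop.2 fun e he => ?_⟩
  obtain ⟨I, hI⟩ := hA (e / 4) (by positivity)
  have hIc : |c - I| ≤ e / 4 := le_of_tendsto ((hc.sub_const I).abs) (hI x₀ hx₀)
  obtain ⟨N, hN⟩ := eventually_atTop.1 (hI x hx)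
  refine ⟨N, fun n hn => ?_⟩
  have h1 := abs_le.1 (hN n hn)
  have h2 := abs_le.1 hIc
  rw [Real.dist_eq, abs_lt]
  constructor <;> linarith [h1.1, h1.2, h2.1, h2.2]

lemma coe_fst_iterate_innerMap (m : ℕ) (t u : ℝ) (i : ℕ) :
    ((((innerMap φ δ m a)^[i] (t, u)).1 : ℝ) : Circ) = (fun x : Circ => m • x)^[i] (t : Circ) := by
  rw [fst_iterate_innerMap]
  induction i with
  | zero => simp
  | succ i ih =>
    rw [Function.iterate_succ_apply', ← ih, pow_succ', ← AddCircle.coe_nsmul, nsmul_eq_mul,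
      mul_assoc]

/-- Because of the fiber contraction, the orbit of a point of the lower boundary of the core is up
to a small error a function of the base point in its recent past. -/
lemma dist_iterate_le (h : TrapParams φ η κ ε δ a) (m : ℕ) {τ : ℝ}
    (hτ : ∀ p q : ℝ × ℝ, p.1 = q.1 → p.2 ∈ core η δ a → q.2 ∈ core η δ a →
      ∀ n, |((innerMap φ δ m a)^[n] p).2 - ((innerMap φ δ m a)^[n] q).2| ≤ τ ^ n)
    (x : Circ) (i j : ℕ) :
    dist ((skew φ ε δ m a)^[j] ((skew φ ε δ m a)^[i] (x, ((ε * (1 / 2 - η) : ℝ) : Circ))))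
      ((skew φ ε δ m a)^[j] ((fun x : Circ => m • x)^[i] x, ((ε * (1 / 2 - η) : ℝ) : Circ)))
      ≤ τ ^ j := by
  have hu₀c : 1 / 2 - η ∈ core η δ a := ⟨le_rfl, by linarith [h.le_a, h.δ_lt_η]⟩
  have hu₀W := h.core_subset hu₀c
  obtain ⟨t, rfl⟩ : ∃ t : ℝ, (t : Circ) = x := ⟨rep x, coe_rep x⟩
  have e1 := h.iterate_skew_proj_scale m (p := (t, 1 / 2 - η)) hu₀W i
  have e2 := coe_fst_iterate_innerMap (φ := φ) (δ := δ) (a := a) m t (1 / 2 - η) i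
  have hqc := h.iterate_mem_core m (p := (t, 1 / 2 - η)) hu₀c i
  generalize (innerMap φ δ m a)^[i] (t, 1 / 2 - η) = q at e1 e2 hqc
  have e3 : ((t : Circ), ((ε * (1 / 2 - η) : ℝ) : Circ)) = proj (t, ε * (1 / 2 - η)) := rfl
  rw [← e2, e3, e1]
  have e4 : ((q.1 : Circ), ((ε * (1 / 2 - η) : ℝ) : Circ)) = proj (q.1, ε * (1 / 2 - η)) := rfl
  rw [e4, h.iterate_skew_proj_scale m (p := q) (h.core_subset hqc) j,
    h.iterate_skew_proj_scale m (p := (q.1, 1 / 2 - η)) hu₀W j, fst_iterate_innerMap,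
    fst_iterate_innerMap]
  exact (h.dist_proj_scale_le _ _ _).trans (hτ q (q.1, 1 / 2 - η) rfl hqc hu₀c j)

/-- Time averages in the trapping region over equidistributed base points have a common limit:
the orbit nearly is a function of the base point in its recent past. -/
lemma exists_tendsto_birkhoffAverage (h : TrapParams φ η κ ε δ a) (m : ℕ)
    (hne : (equidistributed m).Nonempty) (ψ : C(Torus, ℝ)) :
    ∃ c, ∀ p ∈ trapRegion ε δ a, p.1 ∈ equidistributed m →
      Tendsto (fun n => birkhoffAverage ℝ (skew φ ε δ m a) ψ n p) atTop (𝓝 c) := by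
  have hFc := continuous_skew h.profile h.ε_pos (by linarith [h.ε_lt]) δ m a
  have hu₀W : 1 / 2 - η ∈ Ioo (δ - a) (1 / 2) :=
    h.core_subset ⟨le_rfl, by linarith [h.le_a, h.δ_lt_η]⟩
  obtain ⟨y₀, hy₀⟩ : ∃ y₀ : Circ, y₀ = ((ε * (1 / 2 - η) : ℝ) : Circ) := ⟨_, rfl⟩
  obtain ⟨τ, hτ0, hτ1, -, hτ⟩ := h.exists_contraction m
  have huc := CompactSpace.uniformContinuous_of_continuous ψ.continuous
  have hbase : ∀ e > 0, ∃ I : ℝ, ∀ x ∈ equidistributed m, ∀ᶠ n in atTop,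
      |birkhoffAverage ℝ (skew φ ε δ m a) ψ n (x, y₀) - I| ≤ e := by
    intro e he
    obtain ⟨ρ, hρ, hmod⟩ := Metric.uniformContinuous_iff.1 huc (e / 4) (by positivity)
    obtain ⟨j, hj⟩ := exists_pow_lt_of_lt_one hρ hτ1
    obtain ⟨ψj, hψj⟩ : ∃ ψj : C(Circ, ℝ), ∀ x, ψj x = ψ ((skew φ ε δ m a)^[j] (x, y₀)) :=
      ⟨⟨fun x => ψ ((skew φ ε δ m a)^[j] (x, y₀)),
        ψ.continuous.comp ((hFc.iterate j).comp (by fun_prop))⟩, fun _ => rfl⟩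
    refine ⟨∫ x, ψj x, fun x hx => ?_⟩
    have hshadow : ∀ i, |ψ ((skew φ ε δ m a)^[i] ((skew φ ε δ m a)^[j] (x, y₀)))
        - ψj ((fun x : Circ => m • x)^[i] x)| ≤ e / 4 := by
      intro i
      rw [← Function.iterate_add_apply, add_comm, Function.iterate_add_apply, hψj,
        ← Real.dist_eq, hy₀]
      exact (hmod ((h.dist_iterate_le m hτ x i j).trans_lt hj)).le
    have h1 := tendsto_birkhoffAverage_sub_iterate (F := skew φ ε δ m a) ψ.norm_coe_le_norm
      (x, y₀) j
    filter_upwards [h1.eventually (Metric.ball_mem_nhds _ (by positivity : 0 < e / 4)),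
      (hx ψj).eventually (Metric.ball_mem_nhds _ (by positivity : 0 < e / 4))] with n a1 a2
    have a3 := abs_birkhoffAverage_sub_le_of_orbits (by positivity : 0 ≤ e / 4) hshadow n
    rw [Real.dist_eq, abs_lt] at a1 a2
    rw [abs_le] at a3 ⊢
    constructor <;> linarith [a1.1, a1.2, a2.1, a2.2, a3.1, a3.2]
  obtain ⟨c, hc⟩ := exists_common_limit hne hbase
  refine ⟨c, fun p hp hpx => ?_⟩
  have hq : ((p.1, y₀) : Torus) ∈ trapRegion ε δ a := by
    have := h.proj_mem_trapRegion (rep p.1) hu₀W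
    rwa [proj, coe_rep, ← hy₀] at this
  refine tendsto_birkhoffAverage_of_tendsto_sub (q := (p.1, y₀)) (ϕ := ψ) ?_ (hc p.1 hpx)
  have hd := h.tendsto_dist_iterate m hp hq rfl
  rw [Metric.tendsto_atTop] at hd ⊢
  intro e he
  obtain ⟨ρ, hρ, hmod⟩ := Metric.uniformContinuous_iff.1 huc e he
  obtain ⟨N, hN⟩ := hd ρ hρ
  refine ⟨N, fun n hn => ?_⟩
  have := hN n hn
  rw [Real.dist_eq, sub_zero, abs_of_nonneg dist_nonneg] at this
  rw [Real.dist_eq, sub_zero, ← Real.dist_eq]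
  exact hmod this

end TrapParams
end PartHyp

namespace PartHyp

/-! ### The contracting regime -/

namespace TrapParams

lemma iterate_mem_equidistributed {m : ℕ} {x : Circ} (hx : x ∈ equidistributed m) (n : ℕ) :
    (fun x : Circ => m • x)^[n] x ∈ equidistributed m := fun χ =>
  (tendsto_birkhoffAverage_iterate χ.norm_coe_le_norm n).2 (hx χ)

/-- The part of the torus over the heights in the core. -/
def coreStrip (η ε δ a : ℝ) : Set Torus :=
  Prod.snd ⁻¹' ((fun u : ℝ => ((ε * u : ℝ) : Circ)) '' core η δ a)

lemma isClosed_coreStrip (η ε δ a : ℝ) : IsClosed (coreStrip η ε δ a) := by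
  refine IsClosed.preimage continuous_snd (IsCompact.isClosed ?_)
  exact isCompact_Icc.image ((AddCircle.continuous_mk' 1).comp (continuous_const_mul ε))

variable {φ : ℝ → ℝ} {η κ ε δ a : ℝ}

lemma coreStrip_subset (h : TrapParams φ η κ ε δ a) : coreStrip η ε δ a ⊆ trapRegion ε δ a := by
  rintro p ⟨u, hu, hup⟩
  have := h.proj_mem_trapRegion (rep p.1) (h.core_subset hu)
  have e : proj (rep p.1, ε * u) = p := Prod.ext (coe_rep _) hup
  rwa [e] at this

lemma exists_forall_iterate_mem_coreStrip (h : TrapParams φ η κ ε δ a) (m : ℕ) {p : Torus}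
    (hp : p ∈ trapRegion ε δ a) :
    ∃ N, ∀ n, (skew φ ε δ m a)^[n] ((skew φ ε δ m a)^[N] p) ∈ coreStrip η ε δ a := by
  obtain ⟨u, hu, hpu⟩ := h.exists_eq_of_mem_trapRegion hp (rep p.1) (coe_rep _)
  obtain ⟨N, hN⟩ := h.exists_iterate_mem_core m (p := (rep p.1, u)) hu
  refine ⟨N, fun n => ?_⟩
  rw [← Function.iterate_add_apply, hpu, h.iterate_skew_proj_scale m (p := (rep p.1, u)) hu]
  refine ⟨_, ?_, rfl⟩
  rw [Function.iterate_add_apply]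
  exact h.iterate_mem_core m hN n

/-- If almost every orbit enters the trapping region, and almost every base point is
equidistributed, then there is exactly one SRB measure. It lives in the core, and its central
exponent is the mean of a negative function. -/
lemma exists_isSRB (h : TrapParams φ η κ ε δ a) {m : ℕ} (hm : 5 ≤ m)
    (hent : ∀ᵐ p ∂(volume : Measure Torus), ∃ n, (skew φ ε δ m a)^[n] p ∈ trapRegion ε δ a)
    (heq : ∀ᵐ x ∂(volume : Measure Circ), x ∈ equidistributed m) :
    ∃ μ : Measure Torus, IsSRB (skew φ ε δ m a) μ ∧
      (∀ ν : Measure Torus, IsSRB (skew φ ε δ m a) ν → ν = μ) ∧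
      Ergodic (skew φ ε δ m a) μ ∧ μ.support ⊆ trapRegion ε δ a ∧
      ∃ χ : ℝ, IsCentralExponent (skew φ ε δ m a) μ χ ∧ χ < 0 := by
  have hε1 : ε < 1 := by linarith [h.ε_lt]
  have hFc := continuous_skew h.profile h.ε_pos hε1 δ m a
  choose c hc using fun ψ => h.exists_tendsto_birkhoffAverage m heq.exists ψ
  have hconv : ∀ p, p.1 ∈ equidistributed m → (∃ n, (skew φ ε δ m a)^[n] p ∈ trapRegion ε δ a) →
      ∀ ψ : C(Torus, ℝ), Tendsto (fun n => birkhoffAverage ℝ (skew φ ε δ m a) ψ n p) atTop (𝓝 (c ψ)) := by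
    rintro p hp ⟨n, hn⟩ (ψ : C(Torus, ℝ))
    refine (tendsto_birkhoffAverage_iterate ψ.norm_coe_le_norm n).1 (hc ψ _ hn ?_)
    rw [fst_iterate_skew]
    exact iterate_mem_equidistributed hp n
  have heq' : ∀ᵐ p ∂(volume : Measure Torus), p.1 ∈ equidistributed m :=
    Measure.quasiMeasurePreserving_fst.ae heq
  obtain ⟨p₀, hp₀, hp₀'⟩ := (heq'.and hent).exists
  obtain ⟨μ, hμ, hμp⟩ := exists_measure_of_tendsto_birkhoffAverage
    fun ψ => ⟨c ψ, hconv p₀ hp₀ hp₀' ψ⟩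
  have hcμ : ∀ ψ, c ψ = ∫ q, ψ q ∂μ := fun ψ =>
    tendsto_nhds_unique (hconv p₀ hp₀ hp₀' ψ) (hμp ψ)
  have hgood : ∀ p, p.1 ∈ equidistributed m → (∃ n, (skew φ ε δ m a)^[n] p ∈ trapRegion ε δ a) →
      IsGeneric (skew φ ε δ m a) μ p := fun p h1 h2 ψ => hcμ ψ ▸ hconv p h1 h2 ψ
  have hSRB : IsSRB (skew φ ε δ m a) μ := ⟨hμ, measurePreserving_of_generic hFc hμp, by
    filter_upwards [heq', hent] with p h1 h2 using hgood p h1 h2⟩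
  -- the orbit of `p₀` ends up in the core, which is closed, so `μ` is carried by the core
  have hcore : ∀ᵐ p ∂μ, p ∈ coreStrip η ε δ a := by
    obtain ⟨n₀, hn₀⟩ := hp₀'
    obtain ⟨N, hN⟩ := h.exists_forall_iterate_mem_coreStrip m hn₀
    have hne : (coreStrip η ε δ a).Nonempty := ⟨_, hN 0⟩
    let ψ : C(Torus, ℝ) := ⟨fun p => Metric.infDist p (coreStrip η ε δ a),
      Metric.continuous_infDist_pt _⟩
    have h0 : Tendsto (fun n => birkhoffAverage ℝ (skew φ ε δ m a) ψ n
        ((skew φ ε δ m a)^[N] ((skew φ ε δ m a)^[n₀] p₀))) atTop (𝓝 0) := by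
      refine tendsto_const_nhds.congr fun n => ?_
      rw [birkhoffAverage_eq_sum, Finset.sum_eq_zero, mul_zero]
      exact fun k _ => Metric.infDist_zero_of_mem (hN k)
    have h1 := tendsto_nhds_unique (hμp ψ) ((tendsto_birkhoffAverage_iterate ψ.norm_coe_le_norm
      n₀).1 ((tendsto_birkhoffAverage_iterate ψ.norm_coe_le_norm N).1 h0))
    rw [integral_eq_zero_iff_of_nonneg (f := ψ) (fun p => Metric.infDist_nonneg)
      (integrable_continuousMap μ ψ)] at h1
    filter_upwards [h1] with p hp
    exact ((isClosed_coreStrip η ε δ a).mem_iff_infDist_zero hne).2 hp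
  have hmap : μ.map Prod.fst = (volume : Measure Circ) := by
    have := Measure.isProbabilityMeasure_map (μ := μ) measurable_fst.aemeasurable (f := Prod.fst)
    refine ext_of_integral_continuousMap fun χ => ?_
    rw [integral_map measurable_fst.aemeasurable χ.continuous.aestronglyMeasurable]
    refine tendsto_nhds_unique (hμp (χ.comp ⟨Prod.fst, continuous_fst⟩)) ((hp₀ χ).congr fun n => ?_)
    simp only [birkhoffAverage_eq_sum, ContinuousMap.comp_apply, ContinuousMap.coe_mk,
      fst_iterate_skew]
  have hbase : ∀ᵐ p ∂μ, p.1 ∈ equidistributed m := by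
    rw [← hmap] at heq
    exact ae_of_ae_map measurable_fst.aemeasurable heq
  have hgen : ∀ᵐ p ∂μ, IsGeneric (skew φ ε δ m a) μ p := by
    filter_upwards [hbase, hcore] with p h1 h2
    exact hgood p h1 ⟨0, h.coreStrip_subset h2⟩
  refine ⟨μ, hSRB, fun ν hν => hSRB.unique hν, ergodic_of_ae_generic hSRB.invariant hgen,
    (Measure.support_subset_of_isClosed (isClosed_coreStrip η ε δ a) hcore).trans
      h.coreStrip_subset, _, isCentralExponent_of_generic h.profile h.ε_pos hε1 hm hSRB hgen, ?_⟩
  obtain ⟨τ, hτ0, hτ1, hτ⟩ := h.exists_rate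
  have hle : ∫ p, logSlope h.profile h.ε_pos hε1 p ∂μ ≤ ∫ _, Real.log τ ∂μ := by
    refine integral_mono_ae (integrable_continuousMap μ _) (integrable_const _) ?_
    filter_upwards [hcore] with p hp
    obtain ⟨u, hu, hup⟩ := hp
    have e : p = proj (rep p.1, ε * u) := (Prod.ext (coe_rep _) hup).symm
    have hW := h.core_subset hu
    have h3 := h.a_lt
    have h4 := h.δ_pos
    rw [e, logSlope_proj, fSlope_scale h.ε_pos hε1 (by linarith [hW.1]) (by linarith [hW.2])]
    exact Real.log_le_log (hτ u hu).1 (hτ u hu).2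
  rw [integral_const, probReal_univ, one_smul] at hle
  exact hle.trans_lt (Real.log_neg hτ0 hτ1)

end TrapParams
end PartHyp

namespace PartHyp

/-! ### A weight that makes the map expanding off the trapping region -/

/-- `ρ` is a weight on the half line, adapted to a passage that starts at `c`, where the steps have
length at least `κ / 2` up to `1`, and then doubles. The weight is bounded by `R`, grows by `3 / 2`
at each step of the passage, and decreases at most by `1 / 2` under a doubling. -/
structure IsWeight (κ c R : ℝ) (ρ : ℝ → ℝ) : Prop where
  continuous : Continuous ρ
  one_le : ∀ u, 1 ≤ ρ u
  le : ∀ u, ρ u ≤ R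
  eq_one : ∀ u ≤ c, ρ u = 1
  passage : ∀ u u', c ≤ u → u + κ / 2 ≤ u' → u' ≤ 2 → 3 / 2 * ρ u ≤ ρ u'
  doubling : ∀ u u', 1 ≤ u → u ≤ u' → u' ≤ 2 * u → ρ u ≤ 2 * ρ u'
  far : ∀ u, R ≤ u → ρ u ≤ 2

/-- The weight is `1` up to `c`, then an exponential up to `2`, and then proportional to `1 / u` until
it reaches `1` again. -/
lemma exists_isWeight {κ c : ℝ} (hκ : 0 < κ) (hc : c ≤ 1) : ∃ R ρ, IsWeight κ c R ρ := by
  obtain ⟨K, hK0, hK⟩ : ∃ K, 0 < K ∧ Real.exp (K * (κ / 2)) = 3 / 2 := by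
    refine ⟨Real.log (3 / 2) / (κ / 2), div_pos (Real.log_pos (by norm_num)) (by linarith), ?_⟩
    rw [div_mul_cancel₀ _ (by positivity), Real.exp_log (by norm_num)]
  obtain ⟨R, hR⟩ : ∃ R, R = Real.exp (K * (2 - c)) := ⟨_, rfl⟩
  have hR1 : 1 ≤ R := by rw [hR]; exact Real.one_le_exp (mul_nonneg hK0.le (by linarith))
  have hmax : ∀ u : ℝ, 2 ≤ max u 2 := fun u => le_max_right _ _
  have hquot : ∀ u : ℝ, 2 * R / max u 2 ≤ R := fun u => by
    rw [div_le_iff₀ (by linarith [hmax u])]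
    nlinarith [hmax u]
  have near : ∀ u, c ≤ u → u ≤ 2 →
      max 1 (min (Real.exp (K * (u - c))) (2 * R / max u 2)) = Real.exp (K * (u - c)) := by
    intro u h1 h2
    rw [max_eq_right h2, mul_div_cancel_left₀ _ two_ne_zero, min_eq_left, max_eq_right]
    · exact Real.one_le_exp (mul_nonneg hK0.le (by linarith))
    · rw [hR]; gcongr
  have far : ∀ u, 2 ≤ u →
      max 1 (min (Real.exp (K * (u - c))) (2 * R / max u 2)) = max 1 (2 * R / u) := by
    intro u h2
    rw [min_eq_right, max_eq_left h2]
    refine (hquot u).trans ?_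
    rw [hR]; gcongr
  refine ⟨R, fun u => max 1 (min (Real.exp (K * (u - c))) (2 * R / max u 2)), ?_,
    fun u => le_max_left _ _, fun u => max_le hR1 ((min_le_right _ _).trans (hquot u)), ?_, ?_, ?_,
    ?_⟩
  · refine continuous_const.max (Continuous.min (by fun_prop) ?_)
    exact continuous_const.div (by fun_prop) fun u => by linarith [hmax u]
  · intro u hu
    refine max_eq_left ((min_le_left _ _).trans (Real.exp_le_one_iff.2 ?_))
    exact mul_nonpos_of_nonneg_of_nonpos hK0.le (by linarith)
  · intro u u' h1 h2 h3
    rw [near u h1 (by linarith), near u' (by linarith) h3, ← hK, ← Real.exp_add]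
    refine Real.exp_le_exp.2 ?_
    rw [← mul_add]
    exact mul_le_mul_of_nonneg_left (by linarith) hK0.le
  · intro u u' h1 h2 h3
    rcases le_total u' 2 with h4 | h4
    · rw [near u (by linarith) (by linarith), near u' (by linarith) h4]
      have : Real.exp (K * (u - c)) ≤ Real.exp (K * (u' - c)) := by gcongr
      linarith [Real.exp_pos (K * (u' - c))]
    rw [far u' h4]
    have key : R ≤ u' * max 1 (2 * R / u') / 2 := by
      have : 2 * R / u' ≤ max 1 (2 * R / u') := le_max_right _ _
      rw [div_le_iff₀ (by linarith)] at this
      linarith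
    have h5 : (1 : ℝ) ≤ max 1 (2 * R / u') := le_max_left _ _
    rcases le_total u 2 with h6 | h6
    · refine (max_le hR1 ((min_le_right _ _).trans (hquot u))).trans (key.trans ?_)
      nlinarith
    · rw [far u h6]
      refine max_le (by linarith) ?_
      rw [div_le_iff₀ (by linarith)]
      nlinarith
  · intro u hu
    refine max_le one_le_two ((min_le_right _ _).trans ?_)
    rw [div_le_iff₀ (by linarith [hmax u])]
    linarith [le_max_left u 2]

/-- The choice of small constants for the expansion off the trapping region: on the interval of
length `η'` to the left of `1 / 2` the slope is at least `1 - τ`, where `τ` is so small that the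
loss is compensated by the noise. -/
structure EntranceParams (φ : ℝ → ℝ) (η κ ε δ a R : ℝ) (ρ : ℝ → ℝ) (η' τ : ℝ) : Prop
    extends TrapParams φ η κ ε δ a where
  weight : IsWeight κ (1 / 2 + η / 2) R ρ
  R_le : 2 * R * ε ≤ 1
  η'_pos : 0 < η'
  η'_le : η' ≤ 1 / 20
  τ_pos : 0 < τ
  τ_le : τ * (4 * R) ≤ δ * ε
  slope_ge : ∀ u ∈ Icc (1 / 2 - η') (1 / 2), 1 - τ ≤ 2 - deriv φ u

lemma IsProfile.deriv_eq_zero_of_one_le {φ : ℝ → ℝ} (hφ : IsProfile φ) {u : ℝ} (hu : 1 ≤ u) :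
    deriv φ u = 0 := by
  rcases eq_or_lt_of_le hu with rfl | hu
  · refine IsLocalMin.deriv_eq_zero (Eventually.of_forall fun v => ?_)
    rw [hφ.apply_one]; exact (hφ.range v).1
  · exact hφ.deriv_eq_zero fun hh => not_le.2 hu hh.2

namespace EntranceParams

variable {φ : ℝ → ℝ} {η κ ε δ a R : ℝ} {ρ : ℝ → ℝ} {η' τ : ℝ}

/-- A fundamental domain of the circle without the deep part of the trapping region. -/
def outer (ε δ a η' : ℝ) : Set ℝ := Icc (ε * (1 / 2 - η')) (1 + ε * (δ - a + η'))

lemma one_le_R (h : EntranceParams φ η κ ε δ a R ρ η' τ) : 1 ≤ R :=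
  (h.weight.one_le 0).trans (h.weight.le 0)

/-- The map off the trapping region, in the coordinate `u = y / ε`. The second case covers both the
points of the circle off the deformed interval, and those that are slightly above `0`. -/
lemma fLift_outer (h : EntranceParams φ η κ ε δ a R ρ η' τ) {u : ℝ} (hu0 : 0 ≤ u)
    (hu : ε * u ≤ 1 + ε * (δ - a + η')) :
    (u < 1 ∧ fLift φ ε (ε * u) = ε * (2 * u - φ u) ∧ fSlope φ ε (ε * u) = 2 - deriv φ u) ∨
      (1 ≤ u ∧ fLift φ ε (ε * u) = ε * (2 * u) ∧ fSlope φ ε (ε * u) = 2) := by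
  have hε := h.ε_pos
  have hε1 := h.ε_lt
  rcases lt_or_ge (ε * u) 1 with h1 | h1
  · have hf : Int.fract (ε * u) = ε * u := Int.fract_eq_self.2 ⟨by positivity, h1⟩
    have e1 : fLift φ ε (ε * u) = ε * (2 * u - φ u) := by
      rw [fLift, hf, inv_mul_cancel_left₀ hε.ne']; ring
    have e2 : fSlope φ ε (ε * u) = 2 - deriv φ u := by
      rw [fSlope, hf, inv_mul_cancel_left₀ hε.ne']
    rcases lt_or_ge u 1 with h2 | h2
    · exact Or.inl ⟨h2, e1, e2⟩
    · refine Or.inr ⟨h2, ?_, ?_⟩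
      · rw [e1]
        rcases eq_or_lt_of_le h2 with rfl | h3
        · rw [h.profile.apply_one, sub_zero]
        · rw [h.profile.eq_zero u fun hh => not_le.2 h3 hh.2, sub_zero]
      · rw [e2, h.profile.deriv_eq_zero_of_one_le h2, sub_zero]
  · have hb : ε * (δ - a + η') < ε * (1 / 10) := by
      have := h.le_a
      have := h.δ_lt
      have := h.η'_le
      gcongr
      linarith
    have hf : Int.fract (ε * u) = ε * u - 1 := by
      rw [← Int.fract_sub_one, Int.fract_eq_self]
      constructor <;> linarith
    have hs : ε⁻¹ * (ε * u - 1) < 1 / 10 := by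
      rw [inv_mul_lt_iff₀ hε]; linarith
    refine Or.inr ⟨by nlinarith, ?_, ?_⟩
    · rw [fLift, hf, h.profile.eq_zero _ fun hh => not_le.2 hs hh.1]; ring
    · rw [fSlope, hf, h.profile.deriv_eq_zero fun hh => not_le.2 hs hh.1, sub_zero]

/-- Off the trapping region the map does not contract the weighted metric, up to the factor
`1 - τ`. Near `1 / 2` the slope is nearly at least one; on the passage up to `1` the slope is at least
`2 / 3` and the weight grows by `3 / 2`; afterwards the slope is two and the weight is at most halved,
also when the image wraps around the circle (`k ≥ 1`), where the weight before is at most two. -/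
lemma weight_le (h : EntranceParams φ η κ ε δ a R ρ η' τ) {u u' : ℝ} {k : ℤ}
    (hu : ε * u ∈ outer ε δ a η') (hu' : ε * u' ∈ outer ε δ a η')
    (hk : ε * u' = fLift φ ε (ε * u) + (a * ε - δ * ε / 2) - k) :
    (1 - τ) * ρ u ≤ fSlope φ ε (ε * u) * ρ u' := by
  have hε := h.ε_pos
  have hε1 := h.ε_lt
  have hδ := h.δ_pos
  have hδ1 := h.δ_lt
  have hη := h.const.η_pos
  have hη1 := h.const.η_le
  have hη' := h.η'_pos
  have hη'1 := h.η'_le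
  have hτ := h.τ_pos
  have ha := h.le_a
  have ha' := h.a_lt
  have hu1 : 1 / 2 - η' ≤ u := le_of_mul_le_mul_left hu.1 hε
  have hu1' : 1 / 2 - η' ≤ u' := le_of_mul_le_mul_left hu'.1 hε
  have hb : ε * (δ - a + η') ≤ ε * (1 / 10) := by gcongr; linarith
  have hρ := h.weight.one_le u
  have hρ' := h.weight.one_le u'
  have hk0 : 0 ≤ k := by
    by_contra hneg
    have : (k : ℝ) ≤ -1 := by exact_mod_cast (by omega : k ≤ -1)
    have h0 : 0 < fLift φ ε (ε * u) := by
      rcases h.fLift_outer (by linarith) hu.2 with ⟨h1, e, -⟩ | ⟨h1, e, -⟩ <;> rw [e]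
      · have := h.profile.le_self (u := u) ⟨by linarith, h1.le⟩
        have : 0 < 2 * u - φ u := by linarith
        positivity
      · positivity
    have h1 : fLift φ ε (ε * u) + (a * ε - δ * ε / 2) ≤ ε * (1 / 10) := by linarith [hu'.2]
    rcases h.fLift_outer (by linarith) hu.2 with ⟨h2, e, -⟩ | ⟨h2, e, -⟩
    · rw [e] at h1
      have := h.profile.le_self (u := u) ⟨by linarith, h2.le⟩
      nlinarith
    · rw [e] at h1
      nlinarith
  rcases h.fLift_outer (by linarith) hu.2 with ⟨h1, e, es⟩ | ⟨h1, e, es⟩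
  · have hk1 : k = 0 := by
      by_contra hne
      have : (1 : ℝ) ≤ k := by exact_mod_cast (by omega : 1 ≤ k)
      have := (h.profile.range u).1
      rw [e] at hk
      nlinarith
    rw [hk1, e, Int.cast_zero, sub_zero] at hk
    have hk' : u' = 2 * u - φ u + (a - δ / 2) :=
      mul_left_cancel₀ hε.ne' (hk.trans (by ring))
    rw [es]
    rcases le_total u (1 / 2 + η / 2) with h2 | h2
    · rw [h.weight.eq_one u h2, mul_one]
      have hs : 1 - τ ≤ 2 - deriv φ u := by
        rcases le_total u (1 / 2) with h3 | h3
        · exact h.slope_ge u ⟨hu1, h3⟩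
        · have := h.const.flat u ⟨h3, by linarith⟩
          linarith
      have hpos : 0 < 2 - deriv φ u := by
        have := (abs_le.1 (h.profile.deriv_le u)).2
        linarith
      nlinarith
    · have hg := h.const.gap_right u ⟨h2, h1.le⟩
      have hκ := h.δ_lt_κ
      have h3 := h.weight.passage u u' h2 (by linarith)
        (by have := (h.profile.range u).1; linarith)
      have h4 := (abs_le.1 (h.profile.deriv_le u)).2
      nlinarith
  · rw [es]
    rcases eq_or_lt_of_le hk0 with hk1 | hk1
    · rw [← hk1, e, Int.cast_zero, sub_zero] at hk
      have hk' : u' = 2 * u + (a - δ / 2) := mul_left_cancel₀ hε.ne' (hk.trans (by ring))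
      have := h.weight.doubling u u' h1 (by linarith) (by linarith)
      nlinarith
    · have : (1 : ℝ) ≤ k := by exact_mod_cast hk1
      rw [e] at hk
      have hR := h.R_le
      have hfar : R ≤ u := by
        refine le_of_mul_le_mul_left ?_ hε
        nlinarith
      have := h.weight.far u hfar
      nlinarith

/-- Length in the weighted metric, measured from the origin. -/
noncomputable def weightedLength (ε : ℝ) (ρ : ℝ → ℝ) (y : ℝ) : ℝ := ∫ t in (0 : ℝ)..y, ρ (ε⁻¹ * t)

lemma hasDerivAt_weightedLength (h : EntranceParams φ η κ ε δ a R ρ η' τ) (y : ℝ) :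
    HasDerivAt (weightedLength ε ρ) (ρ (ε⁻¹ * y)) y :=
  have hc : Continuous fun t => ρ (ε⁻¹ * t) := h.weight.continuous.comp (continuous_const_mul _)
  (hc.integral_hasStrictDerivAt 0 y).hasDerivAt

lemma sub_le_weightedLength (h : EntranceParams φ η κ ε δ a R ρ η' τ) {y z : ℝ} (hyz : y ≤ z) :
    z - y ≤ weightedLength ε ρ z - weightedLength ε ρ y := by
  have := mul_sub_le_image_sub_of_le_deriv (C := 1)
    (fun y => (h.hasDerivAt_weightedLength y).differentiableAt)
    (fun y => by rw [(h.hasDerivAt_weightedLength y).deriv]; exact h.weight.one_le _) hyz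
  linarith

lemma weightedLength_le (h : EntranceParams φ η κ ε δ a R ρ η' τ) {y z : ℝ} (hyz : y ≤ z) :
    weightedLength ε ρ z - weightedLength ε ρ y ≤ R * (z - y) :=
  image_sub_le_mul_sub_of_deriv_le
    (fun y => (h.hasDerivAt_weightedLength y).differentiableAt)
    (fun y => by rw [(h.hasDerivAt_weightedLength y).deriv]; exact h.weight.le _) hyz

lemma weightedLength_image (h : EntranceParams φ η κ ε δ a R ρ η' τ) {p q : ℝ} {k : ℤ}
    (hpq : p ≤ q) (hp : p ∈ outer ε δ a η') (hq : q ∈ outer ε δ a η')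
    (hp' : fLift φ ε p + (a * ε - δ * ε / 2) - k ∈ outer ε δ a η')
    (hq' : fLift φ ε q + (a * ε - δ * ε / 2) - k ∈ outer ε δ a η') :
    (1 - τ) * (weightedLength ε ρ q - weightedLength ε ρ p)
      ≤ weightedLength ε ρ (fLift φ ε q + (a * ε - δ * ε / 2) - k)
        - weightedLength ε ρ (fLift φ ε p + (a * ε - δ * ε / 2) - k) := by
  have hε := h.ε_pos
  have hε1 : ε < 1 := by linarith [h.ε_lt]
  have hd : ∀ y, HasDerivAt (fun y => weightedLength ε ρ (fLift φ ε y + (a * ε - δ * ε / 2) - k)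
      - (1 - τ) * weightedLength ε ρ y)
      (ρ (ε⁻¹ * (fLift φ ε y + (a * ε - δ * ε / 2) - k)) * fSlope φ ε y
        - (1 - τ) * ρ (ε⁻¹ * y)) y := fun y =>
    ((h.hasDerivAt_weightedLength _).comp y (((hasDerivAt_fLift h.profile hε hε1 y).add_const
      _).sub_const _)).sub ((h.hasDerivAt_weightedLength y).const_mul _)
  have hmono := monotoneOn_of_deriv_nonneg (convex_Icc p q)
    (fun y _ => (hd y).continuousAt.continuousWithinAt)
    (fun y _ => (hd y).differentiableAt.differentiableWithinAt) fun y hy => by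
      rw [(hd y).deriv]
      rw [interior_Icc] at hy
      have hm := fLift_strictMono h.profile hε hε1
      have e : ∀ t, ε * (ε⁻¹ * t) = t := fun t => mul_inv_cancel_left₀ hε.ne' t
      have := h.weight_le (u := ε⁻¹ * y) (u' := ε⁻¹ * (fLift φ ε y + (a * ε - δ * ε / 2) - k))
        (k := k) (by rw [e]; exact ⟨hp.1.trans hy.1.le, hy.2.le.trans hq.2⟩)
        (by
          rw [e]
          exact ⟨hp'.1.trans (by linarith [hm hy.1]), le_trans (by linarith [hm hy.2]) hq'.2⟩)
        (by rw [e, e])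
      rw [e] at this
      linarith
  have := hmono (left_mem_Icc.2 hpq) (right_mem_Icc.2 hpq) hpq
  simp only at this
  linarith

lemma weightedLength_le_two_mul (h : EntranceParams φ η κ ε δ a R ρ η' τ) {p q : ℝ} (hpq : p ≤ q)
    (hp : p ∈ outer ε δ a η') (hq : q ∈ outer ε δ a η') :
    weightedLength ε ρ q - weightedLength ε ρ p ≤ 2 * R := by
  refine (h.weightedLength_le hpq).trans ?_
  have := h.one_le_R
  have hε := h.ε_pos
  have h1 : ε * (δ - a + η') ≤ ε * (1 / 2 - η') + 1 := by
    have : δ - a + η' ≤ 1 / 2 - η' := by linarith [h.le_a, h.δ_lt, h.η'_le]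
    have := mul_le_mul_of_nonneg_left this hε.le
    linarith
  nlinarith [hp.1, hq.2]

/-- Intervals that stay off the deep part of the trapping region grow in the weighted metric by a
definite amount at each step, because the noise spreads them. -/
lemma weightedLength_ge (h : EntranceParams φ η κ ε δ a R ρ η' τ) {p q : ℕ → ℝ} {k : ℕ → ℤ} {N : ℕ}
    (hpq : ∀ n, p n ≤ q n)
    (hp : ∀ n, p (n + 1) ≤ fLift φ ε (p n) + (a * ε - δ * ε / 2))
    (hq : ∀ n, fLift φ ε (q n) + (a * ε - δ * ε / 2) + δ * ε ≤ q (n + 1))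
    (hpX : ∀ n ≤ N, p n - k n ∈ outer ε δ a η') (hqX : ∀ n ≤ N, q n - k n ∈ outer ε δ a η') :
    ∀ n ≤ N, n * (δ * ε / 2)
      ≤ weightedLength ε ρ (q n - k n) - weightedLength ε ρ (p n - k n) := by
  have hε := h.ε_pos
  have hδ := h.δ_pos
  have hδε : 0 < δ * ε := by positivity
  intro n
  induction n with
  | zero =>
    intro _
    have := h.sub_le_weightedLength (sub_le_sub_right (hpq 0) (k 0 : ℝ))
    simp only [Nat.cast_zero, zero_mul]
    linarith [hpq 0]
  | succ n ih =>
    intro hn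
    have ih := ih (by omega)
    have e : ∀ y, fLift φ ε (y - k n) = fLift φ ε y - 2 * k n := fun y => by
      have := fLift_add_int (φ := φ) (ε := ε) y (-k n)
      push_cast at this
      rw [sub_eq_add_neg, this]; ring
    have eP : fLift φ ε (p n - k n) + (a * ε - δ * ε / 2) - ((k (n + 1) - 2 * k n : ℤ) : ℝ)
        = fLift φ ε (p n) + (a * ε - δ * ε / 2) - k (n + 1) := by rw [e]; push_cast; ring
    have eQ : fLift φ ε (q n - k n) + (a * ε - δ * ε / 2) - ((k (n + 1) - 2 * k n : ℤ) : ℝ)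
        = fLift φ ε (q n) + (a * ε - δ * ε / 2) - k (n + 1) := by rw [e]; push_cast; ring
    have hm := (fLift_strictMono h.profile hε (by linarith [h.ε_lt])).monotone (hpq n)
    have h1 := hp n
    have h2 := hq n
    have hX1 := hpX (n + 1) hn
    have hX2 := hqX (n + 1) hn
    have key := h.weightedLength_image (k := k (n + 1) - 2 * k n)
      (sub_le_sub_right (hpq n) (k n : ℝ)) (hpX n (by omega)) (hqX n (by omega))
      (by rw [eP]; exact ⟨hX1.1.trans (by linarith), le_trans (by linarith) hX2.2⟩)
      (by rw [eQ]; exact ⟨hX1.1.trans (by linarith), le_trans (by linarith) hX2.2⟩)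
    rw [eP, eQ] at key
    have s1 := h.sub_le_weightedLength
      (y := p (n + 1) - k (n + 1)) (z := fLift φ ε (p n) + (a * ε - δ * ε / 2) - k (n + 1))
      (by linarith)
    have s2 := h.sub_le_weightedLength
      (y := fLift φ ε (q n) + (a * ε - δ * ε / 2) - k (n + 1)) (z := q (n + 1) - k (n + 1))
      (by linarith)
    have s3 := h.weightedLength_le_two_mul (sub_le_sub_right (hpq n) (k n : ℝ))
      (hpX n (by omega)) (hqX n (by omega))
    have s4 := mul_le_mul_of_nonneg_left s3 h.τ_pos.le
    have s5 := h.τ_le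
    push_cast
    linarith

/-- Within bounded time the spreading intervals meet the deep part of the trapping region. -/
lemma exists_mem_inner (h : EntranceParams φ η κ ε δ a R ρ η' τ) {p q : ℕ → ℝ} {N : ℕ}
    (hN : 4 * R < N * (δ * ε)) (hpq : ∀ n, p n ≤ q n)
    (hp : ∀ n, p (n + 1) ≤ fLift φ ε (p n) + (a * ε - δ * ε / 2))
    (hq : ∀ n, fLift φ ε (q n) + (a * ε - δ * ε / 2) + δ * ε ≤ q (n + 1)) :
    ∃ n ≤ N, ∃ y ∈ Icc (p n) (q n), ∃ k : ℤ,
      y - k ∈ Ioo (ε * (δ - a + η')) (ε * (1 / 2 - η')) := by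
  by_contra! hno
  have hk : ∀ n, ∃ k : ℤ, n ≤ N → p n - k ∈ outer ε δ a η' ∧ q n - k ∈ outer ε δ a η' := by
    intro n
    refine ⟨⌊p n - ε * (1 / 2 - η')⌋, fun hn => ?_⟩
    have h1 := Int.floor_le (p n - ε * (1 / 2 - η'))
    have h2 := Int.lt_floor_add_one (p n - ε * (1 / 2 - η'))
    generalize ⌊p n - ε * (1 / 2 - η')⌋ = k at h1 h2 ⊢
    have h3 : q n - k ≤ 1 + ε * (δ - a + η') := by
      by_contra! hlt
      have hη : ε * (δ - a + η') < ε * (1 / 2 - η') := by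
        have := h.ε_pos
        gcongr ε * ?_
        linarith [h.le_a, h.δ_lt, h.η'_le]
      -- a point of the interval just above `1 + ε * (δ - a + η')`
      obtain ⟨y, hy1, hy2⟩ := exists_between (show max (p n - k) (1 + ε * (δ - a + η'))
        < min (q n - k + 1) (1 + ε * (1 / 2 - η')) from by
          have := hpq n
          rw [max_lt_iff, lt_min_iff, lt_min_iff]
          refine ⟨⟨?_, ?_⟩, ?_, ?_⟩ <;> linarith)
      rw [max_lt_iff] at hy1
      rw [lt_min_iff] at hy2
      rcases le_total y (q n - k) with hyq | hyq
      · exact hno n hn (y + k) ⟨by linarith, by linarith⟩ (k + 1)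
          ⟨by push_cast; linarith, by push_cast; linarith⟩
      · exact hno n hn (q n) ⟨hpq n, le_rfl⟩ (k + 1)
          ⟨by push_cast; linarith, by push_cast; linarith⟩
    exact ⟨⟨by linarith, by linarith [hpq n]⟩, by linarith [hpq n], h3⟩
  choose k hk using hk
  have h1 := h.weightedLength_ge hpq hp hq (fun n hn => (hk n hn).1) (fun n hn => (hk n hn).2) N le_rfl
  have h2 := h.weightedLength_le_two_mul (sub_le_sub_right (hpq N) (k N : ℝ)) (hk N le_rfl).1
    (hk N le_rfl).2
  linarith

end EntranceParams
end PartHyp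

namespace PartHyp

/-! ### Almost every orbit enters the trapping region -/

/-- The slope `L` of a family of curves that is preserved by the dynamics (after rescaling the
`m` pieces of an image curve) and is small against the noise and against the trapping region. -/
structure IsCurveSlope (ε δ η' L : ℝ) (m : ℕ) : Prop where
  pos : 0 < L
  le_inner : L ≤ ε * η'
  le_noise : 10 / 3 * L ≤ δ * ε / 2
  invariant : 10 / 3 * L + δ * ε * (2 * Real.pi) ≤ L * m

/-- The height over `m ^ n * x` of the `n`-th image of the graph of `g`. -/
noncomputable def curveHeight (φ : ℝ → ℝ) (ε δ : ℝ) (m : ℕ) (a : ℝ) (g : ℝ → ℝ) (n : ℕ) (x : ℝ) :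
    ℝ := ((skewLift φ ε δ m a)^[n] (x, g x)).2

/-- The points of the unit interval over which the graph of `g` never enters the trapping
region. -/
def missingSet (φ : ℝ → ℝ) (ε δ : ℝ) (m : ℕ) (a : ℝ) (g : ℝ → ℝ) : Set ℝ :=
  {x | x ∈ Ioc (0 : ℝ) 1 ∧ ∀ i, (skew φ ε δ m a)^[i] (proj (x, g x)) ∉ trapRegion ε δ a}

section Grid

/-- The cell of the grid of mesh `1 / M` that contains a given point of the unit interval. -/
lemma exists_cell {M : ℕ} (hM : 0 < M) {s : ℝ} (hs : s ∈ Icc (0 : ℝ) 1) :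
    ∃ j < M, s ∈ Icc ((j : ℝ) / M) ((j + 1) / M) := by
  have hM' : (0 : ℝ) < M := by exact_mod_cast hM
  rcases lt_or_ge ⌊(M : ℝ) * s⌋₊ M with hlt | hge
  · refine ⟨_, hlt, ?_, ?_⟩
    · rw [div_le_iff₀ hM']
      linarith [Nat.floor_le (mul_nonneg hM'.le hs.1)]
    · rw [le_div_iff₀ hM', mul_comm]
      exact (Nat.lt_floor_add_one _).le
  · obtain ⟨j, rfl⟩ : ∃ j, M = j + 1 := ⟨M - 1, by omega⟩
    have h1 := (Nat.le_floor_iff (mul_nonneg hM'.le hs.1)).1 hge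
    have h2 : s = 1 := le_antisymm hs.2 (by
      by_contra! hlt
      nlinarith)
    refine ⟨j, by omega, ?_, ?_⟩
    · rw [h2, div_le_one hM']; push_cast; linarith
    · rw [h2, le_div_iff₀ hM']; push_cast; linarith

lemma exists_cos_mul_eq {M : ℕ} (hM : 0 < M) {s : ℝ} (hs : s ∈ Icc (0 : ℝ) 1) :
    (∃ x ∈ Icc (0 : ℝ) 1, M * |x - s| ≤ 1 ∧ Real.cos (2 * Real.pi * (M * x)) = 1) ∧
      ∃ x ∈ Icc (0 : ℝ) 1, M * |x - s| ≤ 1 ∧ Real.cos (2 * Real.pi * (M * x)) = -1 := by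
  have hM' : (0 : ℝ) < M := by exact_mod_cast hM
  obtain ⟨j, hj, hjs⟩ := exists_cell hM hs
  have hj' : (j : ℝ) + 1 ≤ M := by exact_mod_cast hj
  have h1 := (div_le_iff₀ hM').1 hjs.1
  have h2 := (le_div_iff₀ hM').1 hjs.2
  have key : ∀ t ∈ Icc (0 : ℝ) 1, ((j + t) / M : ℝ) ∈ Icc (0 : ℝ) 1 ∧
      M * |(j + t) / M - s| ≤ 1 ∧ (M : ℝ) * ((j + t) / M) = j + t := by
    intro t ht
    have e : (M : ℝ) * ((j + t) / M) = j + t := mul_div_cancel₀ _ hM'.ne'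
    refine ⟨⟨div_nonneg (add_nonneg (by positivity) ht.1) hM'.le, ?_⟩, ?_, e⟩
    · rw [div_le_one hM']; linarith [ht.2]
    · rw [← abs_of_pos hM', ← abs_mul, abs_of_pos hM', mul_sub, e, abs_le]
      constructor <;> linarith [ht.1, ht.2]
  refine ⟨⟨_, (key 0 ⟨le_rfl, zero_le_one⟩).1, (key 0 ⟨le_rfl, zero_le_one⟩).2.1, ?_⟩,
    ⟨_, (key (1 / 2) ⟨by norm_num, by norm_num⟩).1, (key (1 / 2) ⟨by norm_num, by norm_num⟩).2.1,
      ?_⟩⟩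
  · rw [(key 0 ⟨le_rfl, zero_le_one⟩).2.2, add_zero, mul_comm]
    exact Real.cos_nat_mul_two_pi j
  · rw [(key (1 / 2) ⟨by norm_num, by norm_num⟩).2.2,
      show 2 * Real.pi * ((j : ℝ) + 1 / 2) = j * (2 * Real.pi) + Real.pi by ring]
    exact Real.cos_nat_mul_two_pi_add_pi j

end Grid

namespace EntranceParams

variable {φ : ℝ → ℝ} {η κ ε δ a R : ℝ} {ρ : ℝ → ℝ} {η' τ : ℝ} {L : ℝ} {m : ℕ} {g : ℝ → ℝ}

lemma curveHeight_succ (φ : ℝ → ℝ) (ε δ : ℝ) (m : ℕ) (a : ℝ) (g : ℝ → ℝ) (n : ℕ) (x : ℝ) :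
    curveHeight φ ε δ m a g (n + 1) x = fLift φ ε (curveHeight φ ε δ m a g n x) + a * ε
      + δ * ε * Real.cos (2 * Real.pi * ((m ^ n : ℕ) * x)) := by
  rw [curveHeight, Function.iterate_succ_apply', skewLift, iterate_skewLift_fst]
  push_cast
  rfl

lemma m_pos (h : EntranceParams φ η κ ε δ a R ρ η' τ) (hL : IsCurveSlope ε δ η' L m) : 0 < m := by
  have := hL.invariant
  have h1 : 0 < δ * ε * (2 * Real.pi) :=
    mul_pos (mul_pos h.δ_pos h.ε_pos) Real.two_pi_pos
  have h2 := hL.pos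
  rcases Nat.eq_zero_or_pos m with rfl | hm
  · rw [Nat.cast_zero] at this; linarith
  · exact hm

lemma abs_curveHeight_sub_le (h : EntranceParams φ η κ ε δ a R ρ η' τ)
    (hL : IsCurveSlope ε δ η' L m) (hg : ∀ x x', |g x - g x'| ≤ L * |x - x'|) (n : ℕ) (x x' : ℝ) :
    |curveHeight φ ε δ m a g n x - curveHeight φ ε δ m a g n x'|
      ≤ L * ((m ^ n : ℕ) * |x - x'|) := by
  induction n with
  | zero => simpa [curveHeight] using hg x x'
  | succ n ih =>
    have hδε : 0 < δ * ε := mul_pos h.δ_pos h.ε_pos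
    have h1 := abs_fLift_sub_le h.profile h.ε_pos (by linarith [h.ε_lt])
      (curveHeight φ ε δ m a g n x') (curveHeight φ ε δ m a g n x)
    have h2 := abs_cos_two_pi_sub_le ((m ^ n : ℕ) * x) ((m ^ n : ℕ) * x')
    rw [← mul_sub, abs_mul, Nat.abs_cast] at h2
    have h3 : 0 ≤ ((m ^ n : ℕ) : ℝ) * |x - x'| := by positivity
    have h4 := mul_le_mul_of_nonneg_right hL.invariant h3
    have h5 := mul_le_mul_of_nonneg_left h2 hδε.le
    rw [curveHeight_succ, curveHeight_succ]
    have e : ∀ A B C D : ℝ, A + a * ε + δ * ε * C - (B + a * ε + δ * ε * D)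
        = (A - B) + δ * ε * (C - D) := fun A B C D => by ring
    rw [e]
    refine (abs_add_le _ _).trans ?_
    rw [abs_mul, abs_of_pos hδε]
    have e2 : L * (((m ^ (n + 1) : ℕ) : ℝ) * |x - x'|) = L * m * (((m ^ n : ℕ) : ℝ) * |x - x'|) := by
      push_cast; ring
    rw [e2]
    linarith

lemma iterate_skew_proj_curve (h : EntranceParams φ η κ ε δ a R ρ η' τ) (g : ℝ → ℝ) (n : ℕ) (x : ℝ) :
    (skew φ ε δ m a)^[n] (proj (x, g x)) = proj ((m ^ n : ℕ) * x, curveHeight φ ε δ m a g n x) := by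
  rw [iterate_skew_proj h.profile h.ε_pos]
  congr 1
  ext
  · rw [iterate_skewLift_fst]; push_cast; rfl
  · rfl

lemma proj_mem_trapRegion_of_sub (h : EntranceParams φ η κ ε δ a R ρ η' τ) (x : ℝ) {y : ℝ} {k : ℤ}
    (hy : y - k ∈ Ioo (ε * (δ - a)) (ε * (1 / 2))) : proj (x, y) ∈ trapRegion ε δ a := by
  have hε := h.ε_pos
  have := h.proj_mem_trapRegion x (u := ε⁻¹ * (y - k))
    ⟨(lt_inv_mul_iff₀ hε).2 hy.1, (inv_mul_lt_iff₀ hε).2 hy.2⟩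
  rwa [mul_inv_cancel_left₀ hε.ne', proj_sub_intCast] at this

/-- Within bounded time one of the pieces of the image of a curve lies in the trapping region. -/
lemma exists_piece (h : EntranceParams φ η κ ε δ a R ρ η' τ)
    (hL : IsCurveSlope ε δ η' L m) (hg : ∀ x x', |g x - g x'| ≤ L * |x - x'|) {N : ℕ}
    (hN : 4 * R < N * (δ * ε)) :
    ∃ n ≤ N, ∃ j < m ^ n, ∀ x ∈ Icc ((j : ℝ) / (m ^ n : ℕ)) ((j + 1) / (m ^ n : ℕ)),
      (skew φ ε δ m a)^[n] (proj (x, g x)) ∈ trapRegion ε δ a := by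
  have hε := h.ε_pos
  have hε1 : ε < 1 := by linarith [h.ε_lt]
  have hm := h.m_pos hL
  have hM : ∀ n, 0 < m ^ n := fun n => pow_pos hm n
  have hlip := h.abs_curveHeight_sub_le hL hg
  have hcont : ∀ n, Continuous (curveHeight φ ε δ m a g n) := fun n => by
    refine continuous_iff_continuousAt.2 fun x => ?_
    rw [ContinuousAt, tendsto_iff_dist_tendsto_zero]
    refine squeeze_zero (fun _ => dist_nonneg) (fun y => hlip n y x) ?_
    have : Continuous fun y => L * (((m ^ n : ℕ) : ℝ) * |y - x|) := by fun_prop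
    simpa using this.tendsto x
  have hne : (Icc (0 : ℝ) 1).Nonempty := ⟨0, le_rfl, zero_le_one⟩
  choose s hs hmin using fun n => isCompact_Icc.exists_isMinOn hne (hcont n).continuousOn
  choose t ht hmax using fun n => isCompact_Icc.exists_isMaxOn hne (hcont n).continuousOn
  have hclose : ∀ n x x', ((m ^ n : ℕ) : ℝ) * |x - x'| ≤ 1 →
      |curveHeight φ ε δ m a g n x - curveHeight φ ε δ m a g n x'| ≤ L := fun n x x' hx =>
    (hlip n x x').trans (mul_le_of_le_one_right hL.pos.le hx)
  have hf : ∀ n x x', ((m ^ n : ℕ) : ℝ) * |x - x'| ≤ 1 →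
      |fLift φ ε (curveHeight φ ε δ m a g n x) - fLift φ ε (curveHeight φ ε δ m a g n x')|
        ≤ δ * ε / 2 := fun n x x' hx =>
    (abs_fLift_sub_le h.profile hε hε1 _ _).trans (by
      have := hclose n x x' hx
      linarith [hL.le_noise])
  obtain ⟨n, hn, y, hy, k, hk⟩ := h.exists_mem_inner (N := N)
    (p := fun n => curveHeight φ ε δ m a g n (s n)) (q := fun n => curveHeight φ ε δ m a g n (t n))
    hN (fun n => hmin n (ht n))
    (fun n => by
      obtain ⟨x, hx, hxs, hcos⟩ := (exists_cos_mul_eq (hM n) (hs n)).2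
      refine (hmin (n + 1) hx).trans ?_
      change curveHeight φ ε δ m a g (n + 1) x ≤ _
      rw [curveHeight_succ, hcos]
      have := (abs_le.1 (hf n x (s n) hxs)).2
      linarith)
    (fun n => by
      obtain ⟨x, hx, hxs, hcos⟩ := (exists_cos_mul_eq (hM n) (ht n)).1
      refine le_trans ?_ (hmax (n + 1) hx)
      change _ ≤ curveHeight φ ε δ m a g (n + 1) x
      rw [curveHeight_succ, hcos]
      have := (abs_le.1 (hf n x (t n) hxs)).1
      linarith)
  obtain ⟨x, hx, rfl⟩ := isPreconnected_Icc.intermediate_value (hs n) (ht n)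
    (hcont n).continuousOn hy
  obtain ⟨j, hj, hxj⟩ := exists_cell (hM n) hx
  refine ⟨n, hn, j, hj, fun x' hx' => ?_⟩
  rw [h.iterate_skew_proj_curve]
  refine h.proj_mem_trapRegion_of_sub _ (k := k) ?_
  have hM' : (0 : ℝ) < (m ^ n : ℕ) := by exact_mod_cast hM n
  have h1 : ((m ^ n : ℕ) : ℝ) * |x' - x| ≤ 1 := by
    have e : |x' - x| ≤ 1 / (m ^ n : ℕ) := by
      have e1 : ((j : ℝ) + 1) / (m ^ n : ℕ) = j / (m ^ n : ℕ) + 1 / (m ^ n : ℕ) := add_div _ _ _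
      rw [e1] at hxj hx'
      rw [abs_le]
      constructor <;> linarith [hx'.1, hx'.2, hxj.1, hxj.2]
    rw [le_div_iff₀ hM'] at e
    linarith
  have h2 := abs_le.1 (hclose n x' x h1)
  have h3 := hL.le_inner
  constructor <;> linarith [hk.1, hk.2, h2.1, h2.2]

/-- The missing set of a curve is covered by rescaled missing sets of the pieces of an image
curve. -/
lemma missingSet_subset (h : EntranceParams φ η κ ε δ a R ρ η' τ) (hm : 0 < m) (n : ℕ) {j₀ : ℕ}
    (hj₀ : ∀ x ∈ Icc ((j₀ : ℝ) / (m ^ n : ℕ)) ((j₀ + 1) / (m ^ n : ℕ)),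
      (skew φ ε δ m a)^[n] (proj (x, g x)) ∈ trapRegion ε δ a) :
    missingSet φ ε δ m a g ⊆ ⋃ j ∈ (Finset.range (m ^ n)).erase j₀,
      (fun x : ℝ => ((m ^ n : ℕ) : ℝ) * x) ⁻¹' ((fun x : ℝ => x + -(j : ℝ)) ⁻¹'
        missingSet φ ε δ m a fun t => curveHeight φ ε δ m a g n ((t + j) / (m ^ n : ℕ))) := by
  rintro x ⟨hx, hmiss⟩
  have hM : 0 < m ^ n := pow_pos hm n
  have hM' : (0 : ℝ) < (m ^ n : ℕ) := by exact_mod_cast hM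
  have hMx : 0 < ((m ^ n : ℕ) : ℝ) * x := mul_pos hM' hx.1
  obtain ⟨j, hj⟩ : ∃ j, ⌈((m ^ n : ℕ) : ℝ) * x⌉₊ = j + 1 :=
    ⟨⌈((m ^ n : ℕ) : ℝ) * x⌉₊ - 1, by have := Nat.ceil_pos.2 hMx; omega⟩
  have h1 : ((m ^ n : ℕ) : ℝ) * x ≤ j + 1 := by
    have := Nat.le_ceil (((m ^ n : ℕ) : ℝ) * x)
    rw [hj] at this
    exact_mod_cast this
  have h2 : (j : ℝ) < ((m ^ n : ℕ) : ℝ) * x := Nat.lt_ceil.1 (by omega)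
  have hjM : j < m ^ n := by
    have : (j : ℝ) < (m ^ n : ℕ) := h2.trans_le (mul_le_of_le_one_right hM'.le hx.2)
    exact_mod_cast this
  have hne : j ≠ j₀ := by
    rintro rfl
    refine hmiss n (hj₀ x ⟨?_, ?_⟩)
    · rw [div_le_iff₀ hM']; linarith
    · rw [le_div_iff₀ hM']; linarith
  rw [mem_iUnion₂]
  refine ⟨j, Finset.mem_erase.2 ⟨hne, Finset.mem_range.2 hjM⟩, ⟨?_, ?_⟩, fun i => ?_⟩
  · simp only; linarith
  · simp only; linarith
  · have e : (((m ^ n : ℕ) : ℝ) * x + -(j : ℝ) + j) / (m ^ n : ℕ) = x := by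
      rw [neg_add_cancel_right, mul_div_cancel_left₀ _ hM'.ne']
    have := hmiss (i + n)
    rw [Function.iterate_add_apply, h.iterate_skew_proj_curve] at this
    simp only
    rwa [e, ← proj_add_natCast _ _ j, neg_add_cancel_right]

lemma volume_missingSet_le (h : EntranceParams φ η κ ε δ a R ρ η' τ)
    (hL : IsCurveSlope ε δ η' L m) {N : ℕ} (hN : 4 * R < N * (δ * ε)) (k : ℕ) (g : ℝ → ℝ)
    (hg : ∀ x x', |g x - g x'| ≤ L * |x - x'|) :
    volume (missingSet φ ε δ m a g) ≤ ENNReal.ofReal ((1 - 1 / (m ^ N : ℕ)) ^ k) := by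
  have hm := h.m_pos hL
  induction k generalizing g with
  | zero =>
    refine (measure_mono (fun x hx => hx.1 : missingSet φ ε δ m a g ⊆ Ioc (0 : ℝ) 1)).trans ?_
    simp
  | succ k ih =>
    obtain ⟨n, hn, j₀, hj₀, hpiece⟩ := h.exists_piece hL hg hN
    have hM' : (0 : ℝ) < (m ^ n : ℕ) := by exact_mod_cast pow_pos hm n
    have hθ : 0 ≤ 1 - 1 / ((m ^ N : ℕ) : ℝ) := by
      rw [sub_nonneg, div_le_one (by exact_mod_cast pow_pos hm N)]
      exact_mod_cast pow_pos hm N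
    have hg' : ∀ j : ℕ, ∀ x x',
        |curveHeight φ ε δ m a g n ((x + j) / (m ^ n : ℕ))
          - curveHeight φ ε δ m a g n ((x' + j) / (m ^ n : ℕ))| ≤ L * |x - x'| := by
      intro j x x'
      have := h.abs_curveHeight_sub_le hL hg n ((x + j) / (m ^ n : ℕ)) ((x' + j) / (m ^ n : ℕ))
      rwa [← sub_div, add_sub_add_right_eq_sub, abs_div, Nat.abs_cast,
        mul_div_cancel₀ _ hM'.ne'] at this
    calc volume (missingSet φ ε δ m a g)
        ≤ ∑ j ∈ (Finset.range (m ^ n)).erase j₀, volume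
          ((fun x : ℝ => ((m ^ n : ℕ) : ℝ) * x) ⁻¹' ((fun x : ℝ => x + -(j : ℝ)) ⁻¹'
            missingSet φ ε δ m a fun t => curveHeight φ ε δ m a g n ((t + j) / (m ^ n : ℕ)))) :=
          (measure_mono (h.missingSet_subset hm n hpiece)).trans (measure_biUnion_finset_le _ _)
      _ ≤ ∑ j ∈ (Finset.range (m ^ n)).erase j₀,
            ENNReal.ofReal (1 / (m ^ n : ℕ)) * ENNReal.ofReal ((1 - 1 / (m ^ N : ℕ)) ^ k) := by
          refine Finset.sum_le_sum fun j _ => ?_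
          rw [Real.volume_preimage_mul_left hM'.ne', measure_preimage_add_right,
            abs_of_pos (inv_pos.2 hM'), one_div]
          gcongr
          exact ih _ (hg' j)
      _ = ENNReal.ofReal (((m ^ n : ℕ) - 1) * (1 / (m ^ n : ℕ)) * (1 - 1 / (m ^ N : ℕ)) ^ k) := by
          have hc : ((m ^ n - 1 : ℕ) : ℝ) = ((m ^ n : ℕ) : ℝ) - 1 := by
            rw [Nat.cast_sub (pow_pos hm n), Nat.cast_one]
          rw [Finset.sum_const, Finset.card_erase_of_mem (Finset.mem_range.2 hj₀),
            Finset.card_range, nsmul_eq_mul, ← hc, ENNReal.ofReal_mul (by positivity),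
            ENNReal.ofReal_mul (by positivity), ENNReal.ofReal_natCast, mul_assoc]
      _ ≤ ENNReal.ofReal ((1 - 1 / (m ^ N : ℕ)) ^ (k + 1)) := by
          refine ENNReal.ofReal_le_ofReal ?_
          rw [pow_succ', sub_mul, one_mul, mul_one_div_cancel hM'.ne']
          gcongr

/-- Almost every orbit enters the trapping region. -/
lemma ae_exists_iterate_mem_trapRegion (h : EntranceParams φ η κ ε δ a R ρ η' τ)
    (hL : IsCurveSlope ε δ η' L m) :
    ∀ᵐ p ∂(volume : Measure Torus), ∃ n, (skew φ ε δ m a)^[n] p ∈ trapRegion ε δ a := by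
  have hm := h.m_pos hL
  have hδε : 0 < δ * ε := mul_pos h.δ_pos h.ε_pos
  obtain ⟨N, hN⟩ := exists_nat_gt (4 * R / (δ * ε))
  rw [div_lt_iff₀ hδε] at hN
  have hnull : ∀ y : ℝ, volume (missingSet φ ε δ m a fun _ => y) = 0 := by
    intro y
    have hlim : Tendsto (fun k : ℕ => ENNReal.ofReal ((1 - 1 / ((m ^ N : ℕ) : ℝ)) ^ k)) atTop
        (𝓝 0) := by
      have hMN : (1 : ℝ) ≤ (m ^ N : ℕ) := by exact_mod_cast pow_pos hm N
      rw [← ENNReal.ofReal_zero]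
      refine ENNReal.tendsto_ofReal (tendsto_pow_atTop_nhds_zero_of_lt_one ?_ ?_)
      · rw [sub_nonneg, div_le_one (by linarith)]; exact hMN
      · have : 0 < 1 / ((m ^ N : ℕ) : ℝ) := by positivity
        linarith
    refine le_antisymm (ge_of_tendsto' hlim fun k => ?_) zero_le
    exact h.volume_missingSet_le hL hN k _ fun x x' => by
      rw [sub_self, abs_zero]
      exact mul_nonneg hL.pos.le (abs_nonneg _)
  have hrep : Measurable rep :=
    measurable_subtype_coe.comp (AddCircle.measurableEquivIco (1 : ℝ) 0).measurable
  have hW : MeasurableSet (trapRegion ε δ a) := (hrep.comp measurable_snd) measurableSet_Ioo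
  have hF := continuous_skew h.profile h.ε_pos (by linarith [h.ε_lt]) δ m a
  have hmeas : MeasurableSet {p : Torus | ∃ n, (skew φ ε δ m a)^[n] p ∈ trapRegion ε δ a} := by
    simp only [ofPred_exists]
    exact MeasurableSet.iUnion fun n => (hF.iterate n).measurable hW
  rw [← measurePreserving_proj.map_eq,
    ae_map_iff measurePreserving_proj.measurable.aemeasurable hmeas, ae_iff]
  have hmeas' : MeasurableSet
      {p | ¬∃ n, (skew φ ε δ m a)^[n] (proj p) ∈ trapRegion ε δ a} :=
    (measurePreserving_proj.measurable hmeas).compl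
  rw [unitSquare, Measure.prod_apply_symm hmeas']
  refine (lintegral_congr fun y => ?_).trans lintegral_zero
  rw [Measure.restrict_apply (measurable_prodMk_right hmeas')]
  refine measure_mono_null ?_ (hnull y)
  exact fun x hx => ⟨hx.2, not_exists.1 hx.1⟩

end EntranceParams

lemma exists_slope_ge {φ : ℝ → ℝ} (hφ : IsProfile φ) {τ : ℝ} (hτ : 0 < τ) :
    ∃ η' > 0, η' ≤ 1 / 20 ∧ ∀ u ∈ Icc (1 / 2 - η') (1 / 2), 1 - τ ≤ 2 - deriv φ u := by
  obtain ⟨r, hr, hball⟩ := Metric.continuous_iff.1 hφ.contDiff_deriv.continuous (1 / 2) τ hτ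
  refine ⟨min (1 / 20) (r / 2), by positivity, min_le_left _ _, fun u hu => ?_⟩
  have h1 : min (1 / 20) (r / 2) ≤ r / 2 := min_le_right _ _
  have h2 := hball u (by
    rw [Real.dist_eq, abs_lt]
    constructor <;> linarith [hu.1, hu.2])
  rw [Real.dist_eq, hφ.deriv_half] at h2
  linarith [(abs_lt.1 h2).2]

end PartHyp
theorem theorem4 (φ : ℝ → ℝ) (hφ : PartHyp.IsProfile φ) :
    ∃ ε₀ > (0 : ℝ), ∃ δ₀ > (0 : ℝ),
      ∀ ε : ℝ, 0 < ε → ε < ε₀ → ∀ δ : ℝ, 0 < δ → δ < δ₀ →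
        ∃ m₀ : ℕ, ∀ m : ℕ, m₀ ≤ m → ∀ a : ℝ, -2 * δ ≤ a → a ≤ 2 →
          (a + δ < 0 →
            MapsTo (PartHyp.skew φ ε δ m a)
              (PartHyp.trapRegion ε δ a) (PartHyp.trapRegion ε δ a) ∧
            (∀ p ∈ PartHyp.trapRegion ε δ a, ∀ q ∈ PartHyp.trapRegion ε δ a, p.1 = q.1 →
              Tendsto (fun n : ℕ => dist ((PartHyp.skew φ ε δ m a)^[n] p)
                ((PartHyp.skew φ ε δ m a)^[n] q)) atTop (𝓝 0)) ∧
            ∃ μ : Measure PartHyp.Torus,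
              PartHyp.IsSRB (PartHyp.skew φ ε δ m a) μ ∧
              (∀ ν : Measure PartHyp.Torus, PartHyp.IsSRB (PartHyp.skew φ ε δ m a) ν → ν = μ) ∧
              Ergodic (PartHyp.skew φ ε δ m a) μ ∧
              μ.support ⊆ PartHyp.trapRegion ε δ a ∧
              ∃ χ : ℝ, PartHyp.IsCentralExponent (PartHyp.skew φ ε δ m a) μ χ ∧ χ < 0) ∧
          (1 ≤ a →
            (∀ y : PartHyp.Circ,
              4 / 3 ≤ PartHyp.circDeriv (PartHyp.fEpsA φ ε a ∘ PartHyp.fEpsA φ ε a) y) ∧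
            ∃ μ : Measure PartHyp.Torus,
              PartHyp.IsSRB (PartHyp.skew φ ε δ m a) μ ∧
              (∀ ν : Measure PartHyp.Torus, PartHyp.IsSRB (PartHyp.skew φ ε δ m a) ν → ν = μ) ∧
              Ergodic (PartHyp.skew φ ε δ m a) μ ∧
              ∃ χ : ℝ, PartHyp.IsCentralExponent (PartHyp.skew φ ε δ m a) μ χ ∧ 0 < χ) := by
  -- `η`, `κ`, `R` and `ρ` depend on `φ` only; `τ`, `η'`, `L` and the bounds on `m` depend also on
  -- `ε` and `δ`, but not on `a`
  obtain ⟨η, κ, hc⟩ := PartHyp.exists_profileConstants hφ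
  obtain ⟨R, ρ, hρ⟩ := PartHyp.exists_isWeight hc.κ_pos
    (by linarith [hc.η_le] : 1 / 2 + η / 2 ≤ 1)
  have hR : 0 < 2 * R := by linarith [(hρ.one_le 0).trans (hρ.le 0)]
  have hη := hc.η_pos
  have hκ := hc.κ_pos
  refine ⟨min (1 / 10) (1 / (2 * R)), by positivity, min (1 / 60) (min η (κ / 6)), by positivity,
    fun ε hε hε' δ hδ hδ' => ?_⟩
  rw [lt_min_iff, lt_div_iff₀ hR] at hε'
  rw [lt_min_iff, lt_min_iff] at hδ'
  have hδε : 0 < δ * ε := mul_pos hδ hε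
  obtain ⟨τ, hτ0, hτ⟩ : ∃ τ > 0, τ * (4 * R) ≤ δ * ε :=
    ⟨δ * ε / (4 * R), div_pos hδε (by linarith), (div_mul_cancel₀ _ (by linarith)).le⟩
  obtain ⟨η', hη'0, hη'1, hslope⟩ := PartHyp.exists_slope_ge hφ hτ0
  obtain ⟨L, hL0, hL1, hL2⟩ : ∃ L > 0, L ≤ ε * η' ∧ 10 / 3 * L ≤ δ * ε / 2 :=
    ⟨min (ε * η') (3 / 20 * (δ * ε)), by positivity, min_le_left _ _, by
      linarith [min_le_right (ε * η') (3 / 20 * (δ * ε))]⟩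
  obtain ⟨m₁, hm₁⟩ := exists_nat_ge ((10 / 3 * L + δ * ε * (2 * Real.pi)) / L)
  obtain ⟨m₂, hm₂⟩ := exists_nat_ge (22 * (1 + 12 * (δ * ε * (2 * Real.pi))))
  refine ⟨max 5 (max m₁ m₂), fun m hm a ha ha2 => ?_⟩
  rw [max_le_iff, max_le_iff] at hm
  have hm₁' : (m₁ : ℝ) ≤ m := by exact_mod_cast hm.2.1
  have hm₂' : (m₂ : ℝ) ≤ m := by exact_mod_cast hm.2.2
  have hm' : 22 * (1 + 12 * (δ * ε * (2 * Real.pi))) ≤ 21 * m := by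
    have : (0 : ℝ) ≤ m := Nat.cast_nonneg m
    linarith
  have hL : PartHyp.IsCurveSlope ε δ η' L m := ⟨hL0, hL1, hL2, by
    have := (div_le_iff₀ hL0).1 (hm₁.trans hm₁')
    linarith⟩
  refine ⟨fun haδ => ?_, fun ha1 => ⟨PartHyp.four_thirds_le_circDeriv hφ hε hε'.1 ha1 ha2,
    PartHyp.expanding_regime hφ hε hε'.1 hδ (by linarith) hm.1 hm' ha1 ha2⟩⟩
  have h : PartHyp.EntranceParams φ η κ ε δ a R ρ η' τ :=
    { profile := hφ, const := hc, ε_pos := hε, ε_lt := hε'.1, δ_pos := hδ, δ_lt := hδ'.1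
      δ_lt_η := hδ'.2.1, δ_lt_κ := by linarith [hδ'.2.2], le_a := ha, a_lt := haδ
      weight := hρ, R_le := by linarith [hε'.2], η'_pos := hη'0, η'_le := hη'1
      τ_pos := hτ0, τ_le := hτ, slope_ge := hslope }
  exact ⟨h.mapsTo_trapRegion m, fun p hp q hq hpq => h.tendsto_dist_iterate m hp hq hpq,
    h.exists_isSRB hm.1 (h.ae_exists_iterate_mem_trapRegion hL)
      (PartHyp.ae_equidistributed hφ hε hε'.1 hδ (by linarith) hm.1 hm')⟩
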